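/- **Lemma 3.1.** Let $\Gamma=\mathrm{PSL}_2(\mathbb Z)$ with generators $S=\pm\begin{pmatrix}0&1\\-1&0\end{pmatrix}$, $T=\pm\begin{pmatrix}1&1\\0&1\end{pmatrix}$, let $\eta$ be an irreducible representation of $\Gamma$ with finite image on a finite-dimensional complex normed space $V$, let $N$ be the order of $\eta(T)$, and let $\nu\in\mathbb C$ with $\operatorname{Re}\nu>-\tfrac12$. Complex powers $z^{-2\nu-1}$ are taken with the principal branch on $\mathbb C\setminus(-\infty,0]$. * $\mathcal S_{\nu,\eta}$ is the space of twice continuously differentiable $u:\mathbb H\to V$ on the upper half plane such that $u(\gamma z)=\eta(\gamma)u(z)$ for all $\gamma\in\Gamma$; $\|u\|^2$ is integrable for $y^{-2}dx\,dy$ over the standard fundamental domain of $\Gamma$; $-y^2(\partial_x^2+\partial_y^2)u=(\tfrac14-\nu^2)u$; and $\int_0^N u(z+t)\,dt=0$ for all $z\in\mathbb H$. * $\mathcal F_{\nu,\eta}$ is the space of holomorphic $f:\mathbb C\setminus\mathbb R\to V$ such that $f(z+1)=\eta(T)f(z)$; $f(z)=O(1)$ as $|\operatorname{Im}z|\to\infty$;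 the limits $f(\pm i\infty)$ of $f(z)$ as $\operatorname{Im} z\to\pm\infty$ exist and $f(i\infty)+f(-i\infty)=0$; and $z\mapsto f(z)-z^{-2\nu-1}\eta(S)f(-1/z)$ extends holomorphically to $\mathbb C\setminus(-\infty,0]$. * $\Psi^o_{\nu,\eta}$ is the space of holomorphic $\psi:\mathbb C\setminus(-\infty,0]\to V$ such that $$\eta(T)\psi(z)=\psi(z+1)+(z+1)^{-2\nu-1}\eta(ST^{-1})\psi\Big(\frac z{z+1}\Big);$$ the limits $\ell_\pm$ of $\psi(z)+z^{-2\nu-1}\eta(S)\psi(-1/z)$ as $\operatorname{Im}z\to\pm\infty$ exist and $e^{-\pi i\nu}\ell_++e^{\pi i\nu}\ell_-=0$; and for some $0<C<2\operatorname{Re}\nu+1$ one has $\psi(z)=O(\min\{1,|z|^{-C}\})$ uniformly on every closed subsector $|\arg z|\le\pi-\delta$ ($\delta>0$) of $\mathbb C\setminus(-\infty,0]$. Then every $u\in\mathcal S_{\nu,\eta}$ has an expansion $$u(x+iy)=\sum_{k\in\mathbb Z,\,k\neq0}\sqrt y\,K_\nu\Big(\frac{2\pi|k|y}N\Big)e^{2\pi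 i\frac kNx}\,v_k$$ with unique $v_k\in V$, where $K_\nu(t)=\int_0^\infty e^{-t\cosh r}\cosh(\nu r)\,dr$ for $t>0$, and the formulas $$f_u(z)=\begin{cases}\ \ \sum_{k>0}k^\nu e^{2\pi i\frac kNz}v_k,&\operatorname{Im}z>0,\\-\sum_{k<0}|k|^\nu e^{2\pi i\frac kNz}v_k,&\operatorname{Im}z<0,\end{cases}\qquad \psi_u(z)=f_u(z)-z^{-2\nu-1}\eta(S)f_u\Big(\frac{-1}z\Big)\quad(z\in\mathbb C\setminus\mathbb R),$$ where the series converge and $\psi_u$ is extended holomorphically to $\mathbb C\setminus(-\infty,0]$, define linear maps $\mathcal S_{\nu,\eta}\to\mathcal F_{\nu,\eta}$, $u\mapsto f_u$, and $\mathcal S_{\nu,\eta}\to\Psi^o_{\nu,\eta}$, $u\mapsto\psi_u$. -/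

import Mathlib

open scoped MatrixGroups

noncomputable section

namespace LewisCorr

open Complex MeasureTheory Filter Topology
open UpperHalfPlane hiding I

/-- The generator `S = ±(0 1; -1 0)` of `PSL(2, ℤ)` (the sign is irrelevant in `PSL`). -/
def S : PSL(2, ℤ) := QuotientGroup.mk ModularGroup.S

/-- The generator `T = ±(1 1; 0 1)` of `PSL(2, ℤ)`. -/
def T : PSL(2, ℤ) := QuotientGroup.mk ModularGroup.T

/-- `ℂ ∖ ℝ`. The set `ℂ ∖ (-∞, 0]` is Mathlib's `Complex.slitPlane`. -/
def nonreal : Set ℂ := {z | z.im ≠ 0}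

lemma nonreal_sub_slit {z : ℂ} (hz : z ∈ nonreal) : z ∈ slitPlane := Or.inr hz

/-- `z ↦ z + 1` on `ℂ ∖ ℝ`. -/
def shift (z : nonreal) : nonreal :=
  ⟨(z : ℂ) + 1, by have h : (z : ℂ).im ≠ 0 := z.2; simpa [nonreal] using h⟩

/-- `z ↦ -1/z` on `ℂ ∖ ℝ`. -/
def negInv (z : nonreal) : nonreal :=
  ⟨-1 / (z : ℂ), by
    have h : (z : ℂ).im ≠ 0 := z.2
    have h0 : (z : ℂ) ≠ 0 := by rintro h0; simp [h0] at h
    have h1 : normSq (z : ℂ) ≠ 0 := by simpa using h0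
    simp only [nonreal, Set.mem_ofPred_eq, neg_div, one_div, neg_im, inv_im]
    simpa using ⟨h, h0⟩⟩

/-- The inclusion `ℂ ∖ ℝ ⊆ ℂ ∖ (-∞, 0]`. -/
def toSlit (z : nonreal) : slitPlane := ⟨z, nonreal_sub_slit z.2⟩

lemma slit_shift_mem {z : ℂ} (hz : z ∈ slitPlane) : z + 1 ∈ slitPlane := by
  rcases hz with h | h
  · left; simp; linarith
  · right; simpa using h

/-- `z ↦ z + 1` on `ℂ ∖ (-∞, 0]`. -/
def slitShift (z : slitPlane) : slitPlane := ⟨(z : ℂ) + 1, slit_shift_mem z.2⟩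

lemma slit_frac_mem {z : ℂ} (hz : z ∈ slitPlane) : z / (z + 1) ∈ slitPlane := by
  have h0 : z ≠ 0 := slitPlane_ne_zero hz
  have h1 : z + 1 ≠ 0 := slitPlane_ne_zero (slit_shift_mem hz)
  have e : z / (z + 1) = (z⁻¹ + 1)⁻¹ := by
    have h2 : z⁻¹ + 1 = (z + 1) / z := by field_simp; ring
    rw [h2, inv_div]
  rw [e]
  have inv_mem : ∀ w : ℂ, w ∈ slitPlane → w⁻¹ ∈ slitPlane := by
    intro w hw
    have hp : 0 < normSq w := normSq_pos.2 (slitPlane_ne_zero hw)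
    rcases hw with h | h
    · left; rw [inv_re]; positivity
    · right; rw [inv_im]; exact div_ne_zero (neg_ne_zero.2 h) hp.ne'
  exact inv_mem _ (slit_shift_mem (inv_mem _ hz))

/-- `z ↦ z / (z + 1)` on `ℂ ∖ (-∞, 0]`. -/
def slitFrac (z : slitPlane) : slitPlane := ⟨(z : ℂ) / ((z : ℂ) + 1), slit_frac_mem z.2⟩

variable {V : Type*} [NormedAddCommGroup V] [NormedSpace ℂ V]

/-- Holomorphy of a vector valued function that is defined on an (open) set `U ⊆ ℂ` only. -/
def Holo (U : Set ℂ) (f : U → V) : Prop :=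
  ∃ g : ℂ → V, DifferentiableOn ℂ g U ∧ ∀ z : U, g z = f z

lemma Holo.zero (U : Set ℂ) : Holo U (0 : U → V) := ⟨0, differentiableOn_const 0, fun _ ↦ rfl⟩

lemma Holo.add {U : Set ℂ} {f g : U → V} (hf : Holo U f) (hg : Holo U g) : Holo U (f + g) := by
  obtain ⟨a, ha, ha'⟩ := hf
  obtain ⟨b, hb, hb'⟩ := hg
  exact ⟨a + b, ha.add hb, fun z ↦ by simp [ha', hb']⟩

lemma Holo.smul {U : Set ℂ} (c : ℂ) {f : U → V} (hf : Holo U f) : Holo U (c • f) := by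
  obtain ⟨a, ha, ha'⟩ := hf
  exact ⟨c • a, ha.const_smul c, fun z ↦ by simp [ha']⟩

/-- `N`, the order of `η(T)`. -/
def ord (η : Representation ℂ PSL(2, ℤ) V) : ℕ := orderOf (η T)

/-! ### Maass cusp forms -/

/-- `u : ℍ → V` is a Maass wave form for `η` with parameter `ν`: it is `C²`, `η`-equivariant,
square integrable over `Γ \ ℍ` for `dx dy / y²` (computed on the standard fundamental domain;
when `V` is finite dimensional and `η` has finite image, neither the norm nor the fundamental
domain matters) and satisfies `Δ u = (1/4 - ν²) u` for `Δ = -y² (∂²/∂x² + ∂²/∂y²)`. -/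
structure IsMaassForm (ν : ℂ) (η : Representation ℂ PSL(2, ℤ) V) (u : ℍ → V) : Prop where
  contDiff : ContDiffOn ℝ 2 (u ∘ ofComplex) {z : ℂ | 0 < z.im}
  equivariant : ∀ (γ : SL(2, ℤ)) (z : ℍ),
    u (γ • z) = η (QuotientGroup.mk γ : PSL(2, ℤ)) (u z)
  sqIntegrable : MemLp u 2 ((volume : Measure ℍ).restrict ModularGroup.fd)
  eigen : ∀ z : ℍ, -((z.im : ℂ) ^ 2) • Laplacian.laplacian (u ∘ ofComplex) (z : ℂ)
    = (1 / 4 - ν ^ 2) • u z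

/-- A Maass cusp form: a Maass form with `∫₀ᴺ u(z + t) dt = 0` for all `z`. -/
structure IsCuspForm (ν : ℂ) (η : Representation ℂ PSL(2, ℤ) V) (u : ℍ → V) : Prop
    extends IsMaassForm ν η u where
  cusp : ∀ z : ℍ, ∫ t in (0 : ℝ)..(ord η : ℝ), u (t +ᵥ z) = 0

lemma isOpen_upper : IsOpen {z : ℂ | 0 < z.im} := isOpen_lt continuous_const continuous_im

lemma IsMaassForm.contDiffAt {ν : ℂ} {η : Representation ℂ PSL(2, ℤ) V} {u : ℍ → V}
    (h : IsMaassForm ν η u) (z : ℍ) : ContDiffAt ℝ 2 (u ∘ ofComplex) (z : ℂ) :=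
  h.contDiff.contDiffAt (isOpen_upper.mem_nhds z.im_pos)

lemma IsMaassForm.continuous {ν : ℂ} {η : Representation ℂ PSL(2, ℤ) V} {u : ℍ → V}
    (h : IsMaassForm ν η u) : Continuous u := by
  have : u = fun z : ℍ ↦ (u ∘ ofComplex) (z : ℂ) := by ext z; simp
  rw [this]
  exact continuous_iff_continuousAt.2 fun z ↦
    ContinuousAt.comp (f := fun z : ℍ ↦ (z : ℂ)) (h.contDiffAt z).continuousAt
      continuous_coe.continuousAt

lemma IsCuspForm.intervalIntegrable {ν : ℂ} {η : Representation ℂ PSL(2, ℤ) V} {u : ℍ → V}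
    (h : IsCuspForm ν η u) (z : ℍ) (a b : ℝ) :
    IntervalIntegrable (fun t : ℝ ↦ u (t +ᵥ z)) volume a b := by
  apply Continuous.intervalIntegrable
  refine h.continuous.comp ?_
  rw [isEmbedding_coe.continuous_iff]
  have : (UpperHalfPlane.coe ∘ fun t : ℝ ↦ t +ᵥ z) = fun t : ℝ ↦ (t : ℂ) + (z : ℂ) := by
    ext t; simp
  rw [this]
  fun_prop

/-- The space `𝒮_{ν,η}` of Maass cusp forms. -/
def cuspForms (ν : ℂ) (η : Representation ℂ PSL(2, ℤ) V) : Submodule ℂ (ℍ → V) where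
  carrier := {u | IsCuspForm ν η u}
  zero_mem' :=
    { contDiff := (contDiff_const (c := (0 : V))).contDiffOn
      equivariant := fun _ _ ↦ by simp
      sqIntegrable := MemLp.zero
      eigen := fun z ↦ by
        have : ((0 : ℍ → V) ∘ ofComplex) = (0 : ℂ → V) := rfl
        rw [this, InnerProductSpace.laplacian_eq_iteratedFDeriv_complexPlane]
        simp
      cusp := fun z ↦ by simp }
  add_mem' := by
    intro u w hu hw
    have e : (u + w) ∘ ofComplex = (u ∘ ofComplex) + (w ∘ ofComplex) := rfl
    exact
    { contDiff := hu.contDiff.add hw.contDiff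
      equivariant := fun γ z ↦ by
        rw [Pi.add_apply, Pi.add_apply, hu.equivariant, hw.equivariant, map_add]
      sqIntegrable := hu.sqIntegrable.add hw.sqIntegrable
      eigen := fun z ↦ by
        rw [e, (hu.contDiffAt z).laplacian_add (hw.contDiffAt z), smul_add, hu.eigen, hw.eigen,
          Pi.add_apply, smul_add]
      cusp := fun z ↦ by
        simp only [Pi.add_apply]
        rw [intervalIntegral.integral_add (hu.intervalIntegrable z _ _)
          (hw.intervalIntegrable z _ _), hu.cusp, hw.cusp, add_zero] }
  smul_mem' := by
    intro c u hu
    have e : (c • u) ∘ ofComplex = c • (u ∘ ofComplex) := rfl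
    have hl : ∀ z : ℍ, Laplacian.laplacian (c • (u ∘ ofComplex)) (z : ℂ)
        = c • Laplacian.laplacian (u ∘ ofComplex) (z : ℂ) := by
      intro z
      rw [InnerProductSpace.laplacian_eq_iteratedFDeriv_complexPlane,
        InnerProductSpace.laplacian_eq_iteratedFDeriv_complexPlane]
      simp only [iteratedFDeriv_const_smul_apply (hu.contDiffAt z),
        _root_.smul_apply, smul_add]
    exact
    { contDiff := hu.contDiff.const_smul c
      equivariant := fun γ z ↦ by
        rw [Pi.smul_apply, Pi.smul_apply, hu.equivariant, map_smul]
      sqIntegrable := hu.sqIntegrable.const_smul c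
      eigen := fun z ↦ by
        rw [e, hl, smul_comm, hu.eigen, Pi.smul_apply, smul_comm]
      cusp := fun z ↦ by
        simp only [Pi.smul_apply]
        rw [intervalIntegral.integral_smul, hu.cusp, smul_zero] }

/-! ### The spaces `ℱ_{ν,η}` -/

/-- Membership in `ℱ_η`: `f` is holomorphic on `ℂ ∖ ℝ`, `f(z+1) = η(T) f(z)`, `f(z) = O(1)` as
`|Im z| → ∞`, and the limits `f(i∞)`, `f(-i∞)` exist and add up to zero. -/
structure IsF (η : Representation ℂ PSL(2, ℤ) V) (f : nonreal → V) : Prop where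
  holo : Holo nonreal f
  shift : ∀ z : nonreal, f (shift z) = η T (f z)
  bounded : f =O[comap (fun z : nonreal ↦ |(z : ℂ).im|) atTop] (fun _ ↦ (1 : ℝ))
  limits : ∃ a b : V, Tendsto f (comap (fun z : nonreal ↦ (z : ℂ).im) atTop) (𝓝 a) ∧
    Tendsto f (comap (fun z : nonreal ↦ (z : ℂ).im) atBot) (𝓝 b) ∧ a + b = 0

/-- The function `z ↦ f(z) - z^{-2ν-1} η(S) f(-1/z)` on `ℂ ∖ ℝ` (principal branch). -/
def periodOf (ν : ℂ) (η : Representation ℂ PSL(2, ℤ) V) (f : nonreal → V) (z : nonreal) : V :=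
  f z - (z : ℂ) ^ (-2 * ν - 1) • η S (f (negInv z))

/-- Membership in `ℱ_{ν,η}`: `f ∈ ℱ_η` and `z ↦ f(z) - z^{-2ν-1} η(S) f(-1/z)` extends
holomorphically to `ℂ ∖ (-∞, 0]`. -/
structure IsFν (ν : ℂ) (η : Representation ℂ PSL(2, ℤ) V) (f : nonreal → V) : Prop
    extends IsF η f where
  extend : ∃ ψ : slitPlane → V, Holo slitPlane ψ ∧ ∀ z : nonreal, ψ (toSlit z) = periodOf ν η f z

lemma periodOf_add (ν : ℂ) (η : Representation ℂ PSL(2, ℤ) V) (f g : nonreal → V) (z : nonreal) :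
    periodOf ν η (f + g) z = periodOf ν η f z + periodOf ν η g z := by
  simp only [periodOf, Pi.add_apply, map_add, smul_add]; abel

lemma periodOf_smul (ν : ℂ) (η : Representation ℂ PSL(2, ℤ) V) (c : ℂ) (f : nonreal → V)
    (z : nonreal) : periodOf ν η (c • f) z = c • periodOf ν η f z := by
  simp only [periodOf, Pi.smul_apply, map_smul, smul_sub]; rw [smul_comm]

/-- The space `ℱ_{ν,η}`. -/
def spaceF (ν : ℂ) (η : Representation ℂ PSL(2, ℤ) V) : Submodule ℂ (nonreal → V) where
  carrier := {f | IsFν ν η f}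
  zero_mem' :=
    { holo := Holo.zero _
      shift := fun _ ↦ by simp
      bounded := Asymptotics.isBigO_zero _ _
      limits := ⟨0, 0, tendsto_const_nhds, tendsto_const_nhds, add_zero 0⟩
      extend := ⟨0, Holo.zero _, fun z ↦ by simp [periodOf]⟩ }
  add_mem' := by
    intro f g hf hg
    obtain ⟨a, b, ha, hb, hab⟩ := hf.limits
    obtain ⟨a', b', ha', hb', hab'⟩ := hg.limits
    obtain ⟨p, hp, hp'⟩ := hf.extend
    obtain ⟨q, hq, hq'⟩ := hg.extend
    exact
    { holo := hf.holo.add hg.holo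
      shift := fun z ↦ by simp [hf.shift, hg.shift]
      bounded := hf.bounded.add hg.bounded
      limits := ⟨a + a', b + b', ha.add ha', hb.add hb', by
        rw [add_add_add_comm, hab, hab', add_zero]⟩
      extend := ⟨p + q, hp.add hq, fun z ↦ by simp [hp', hq', periodOf_add]⟩ }
  smul_mem' := by
    intro c f hf
    obtain ⟨a, b, ha, hb, hab⟩ := hf.limits
    obtain ⟨p, hp, hp'⟩ := hf.extend
    exact
    { holo := hf.holo.smul c
      shift := fun z ↦ by simp [hf.shift]
      bounded := hf.bounded.const_smul_left c
      limits := ⟨c • a, c • b, ha.const_smul c, hb.const_smul c, by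
        rw [← smul_add, hab, smul_zero]⟩
      extend := ⟨c • p, hp.smul c, fun z ↦ by simp [hp', periodOf_smul]⟩ }

/-! ### Period functions -/

/-- The function `z ↦ ψ(z) + z^{-2ν-1} η(S) ψ(-1/z)` on `ℂ ∖ ℝ` (principal branch). -/
def invOf (ν : ℂ) (η : Representation ℂ PSL(2, ℤ) V) (ψ : slitPlane → V) (z : nonreal) : V :=
  ψ (toSlit z) + (z : ℂ) ^ (-2 * ν - 1) • η S (ψ (toSlit (negInv z)))

/-- Membership in `Ψ_{ν,η}`: holomorphic solutions on `ℂ ∖ (-∞, 0]` of the Lewis equation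
`η(T) ψ(z) = ψ(z+1) + (z+1)^{-2ν-1} η(S T⁻¹) ψ(z/(z+1))` that satisfy the condition on the
(existing) limits of `ψ(z) + z^{-2ν-1} η(S) ψ(-1/z)` as `Im z → ±∞`. -/
structure IsPsi (ν : ℂ) (η : Representation ℂ PSL(2, ℤ) V) (ψ : slitPlane → V) : Prop where
  holo : Holo slitPlane ψ
  lewis : ∀ z : slitPlane, η T (ψ z)
    = ψ (slitShift z) + ((z : ℂ) + 1) ^ (-2 * ν - 1) • η (S * T⁻¹) (ψ (slitFrac z))
  limits : ∃ a b : V, Tendsto (invOf ν η ψ) (comap (fun z : nonreal ↦ (z : ℂ).im) atTop) (𝓝 a) ∧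
    Tendsto (invOf ν η ψ) (comap (fun z : nonreal ↦ (z : ℂ).im) atBot) (𝓝 b) ∧
    exp (-(Real.pi * I * ν)) • a + exp (Real.pi * I * ν) • b = 0

/-- Membership in `Ψ°_{ν,η}`: `ψ ∈ Ψ_{ν,η}` and `ψ(z) = O(min {1, |z|^{-C}})` on `ℂ ∖ (-∞, 0]` for
some `0 < C < 2 Re ν + 1`, the estimate being uniform on every closed subsector
`|arg z| ≤ π - δ` (with the same `C` for all `δ`). -/
structure IsPsiO (ν : ℂ) (η : Representation ℂ PSL(2, ℤ) V) (ψ : slitPlane → V) : Prop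
    extends IsPsi ν η ψ where
  growth : ∃ C : ℝ, 0 < C ∧ C < 2 * ν.re + 1 ∧ ∀ δ : ℝ, 0 < δ → ∃ K : ℝ, ∀ z : slitPlane,
    |arg (z : ℂ)| ≤ Real.pi - δ → ‖ψ z‖ ≤ K * min 1 (‖(z : ℂ)‖ ^ (-C))

lemma invOf_add (ν : ℂ) (η : Representation ℂ PSL(2, ℤ) V) (f g : slitPlane → V) :
    invOf ν η (f + g) = invOf ν η f + invOf ν η g := by
  ext z
  simp only [invOf, Pi.add_apply, map_add, smul_add]; abel

lemma invOf_smul (ν : ℂ) (η : Representation ℂ PSL(2, ℤ) V) (c : ℂ) (f : slitPlane → V) :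
    invOf ν η (c • f) = c • invOf ν η f := by
  ext z
  simp only [invOf, Pi.smul_apply, map_smul, smul_add]; rw [smul_comm]

lemma IsPsi.add {ν : ℂ} {η : Representation ℂ PSL(2, ℤ) V} {f g : slitPlane → V}
    (hf : IsPsi ν η f) (hg : IsPsi ν η g) : IsPsi ν η (f + g) := by
  obtain ⟨a, b, ha, hb, hab⟩ := hf.limits
  obtain ⟨a', b', ha', hb', hab'⟩ := hg.limits
  exact
  { holo := hf.holo.add hg.holo
    lewis := fun z ↦ by
      simp only [Pi.add_apply, map_add, hf.lewis, hg.lewis, smul_add]; abel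
    limits := ⟨a + a', b + b', by rw [invOf_add]; exact ha.add ha',
      by rw [invOf_add]; exact hb.add hb', by
        rw [smul_add, smul_add, add_add_add_comm, hab, hab', add_zero]⟩ }

lemma IsPsi.smul {ν : ℂ} {η : Representation ℂ PSL(2, ℤ) V} (c : ℂ) {f : slitPlane → V}
    (hf : IsPsi ν η f) : IsPsi ν η (c • f) := by
  obtain ⟨a, b, ha, hb, hab⟩ := hf.limits
  exact
  { holo := hf.holo.smul c
    lewis := fun z ↦ by
      simp only [Pi.smul_apply, map_smul, hf.lewis, smul_add]; rw [smul_comm]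
    limits := ⟨c • a, c • b, by rw [invOf_smul]; exact ha.const_smul c,
      by rw [invOf_smul]; exact hb.const_smul c, by
        rw [smul_comm, smul_comm _ c b, ← smul_add, hab, smul_zero]⟩ }

lemma min_one_rpow_mono {x C D : ℝ} (hx : 0 < x) (hC : 0 < C) (hCD : C ≤ D) :
    min 1 (x ^ (-D)) ≤ min 1 (x ^ (-C)) := by
  rcases le_total 1 x with h | h
  · exact min_le_min le_rfl (Real.rpow_le_rpow_of_exponent_le h (by linarith))
  · rw [min_eq_left (Real.one_le_rpow_of_pos_of_le_one_of_nonpos hx h (by linarith : -C ≤ 0))]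
    exact min_le_left _ _

lemma growth_add {C D δ : ℝ} {f g : slitPlane → V} (hC : 0 < C) (hD : 0 < D)
    (hf : ∃ K : ℝ, ∀ z : slitPlane,
      |arg (z : ℂ)| ≤ Real.pi - δ → ‖f z‖ ≤ K * min 1 (‖(z : ℂ)‖ ^ (-C)))
    (hg : ∃ K : ℝ, ∀ z : slitPlane,
      |arg (z : ℂ)| ≤ Real.pi - δ → ‖g z‖ ≤ K * min 1 (‖(z : ℂ)‖ ^ (-D))) :
    ∃ K : ℝ, ∀ z : slitPlane,
      |arg (z : ℂ)| ≤ Real.pi - δ → ‖(f + g) z‖ ≤ K * min 1 (‖(z : ℂ)‖ ^ (-(min C D))) := by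
  obtain ⟨K, hK⟩ := hf
  obtain ⟨L, hL⟩ := hg
  refine ⟨|K| + |L|, fun z hz ↦ ?_⟩
  have hx : 0 < ‖(z : ℂ)‖ := norm_pos_iff.2 (slitPlane_ne_zero z.2)
  have hm : 0 < min C D := lt_min hC hD
  have h1 := min_one_rpow_mono hx hm (min_le_left C D)
  have h2 := min_one_rpow_mono hx hm (min_le_right C D)
  have p1 : 0 ≤ min 1 (‖(z : ℂ)‖ ^ (-C)) := le_min zero_le_one (by positivity)
  have p2 : 0 ≤ min 1 (‖(z : ℂ)‖ ^ (-D)) := le_min zero_le_one (by positivity)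
  calc ‖(f + g) z‖ ≤ ‖f z‖ + ‖g z‖ := norm_add_le _ _
    _ ≤ K * min 1 (‖(z : ℂ)‖ ^ (-C)) + L * min 1 (‖(z : ℂ)‖ ^ (-D)) := add_le_add (hK z hz) (hL z hz)
    _ ≤ |K| * min 1 (‖(z : ℂ)‖ ^ (-(min C D))) + |L| * min 1 (‖(z : ℂ)‖ ^ (-(min C D))) := by
        gcongr
        · exact le_abs_self K
        · exact le_abs_self L
    _ = _ := by ring

/-- The space `Ψ°_{ν,η}` of period functions, for `Re ν > -1/2`. -/
def periodFunctions (ν : ℂ) (hν : -1 / 2 < ν.re) (η : Representation ℂ PSL(2, ℤ) V) :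
    Submodule ℂ (slitPlane → V) where
  carrier := {ψ | IsPsiO ν η ψ}
  zero_mem' :=
    { holo := Holo.zero _
      lewis := fun _ ↦ by simp
      limits := ⟨0, 0, by
        have : invOf ν η (0 : slitPlane → V) = 0 := by ext z; simp [invOf]
        rw [this]
        exact ⟨tendsto_const_nhds, tendsto_const_nhds, by simp⟩⟩
      growth := ⟨(2 * ν.re + 1) / 2, by linarith, by linarith, fun _ _ ↦ ⟨0, fun _ _ ↦ by simp⟩⟩ }
  add_mem' := by
    intro f g hf hg
    obtain ⟨C, hC, hC', hK⟩ := hf.growth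
    obtain ⟨D, hD, hD', hL⟩ := hg.growth
    exact
    { toIsPsi := hf.toIsPsi.add hg.toIsPsi
      growth := ⟨min C D, lt_min hC hD, (min_le_left C D).trans_lt hC', fun δ hδ ↦
        growth_add hC hD (hK δ hδ) (hL δ hδ)⟩ }
  smul_mem' := by
    intro c f hf
    obtain ⟨C, hC, hC', hK⟩ := hf.growth
    exact
    { toIsPsi := hf.toIsPsi.smul c
      growth := ⟨C, hC, hC', fun δ hδ ↦ by
        obtain ⟨K, hK⟩ := hK δ hδ
        refine ⟨‖c‖ * K, fun z hz ↦ ?_⟩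
        rw [Pi.smul_apply, norm_smul, mul_assoc]
        exact mul_le_mul_of_nonneg_left (hK z hz) (norm_nonneg c)⟩ }

/-! ### Fourier coefficients and the map `u ↦ f_u` -/

/-- The Bessel function `K_ν(x) = ∫₀^∞ exp(-x cosh t) cosh(ν t) dt`, for `x > 0`. -/
def besselK (ν : ℂ) (x : ℝ) : ℂ :=
  ∫ t in Set.Ioi (0 : ℝ), exp (-(x * Real.cosh t : ℝ)) * cosh (ν * t)

/-- `(v_k)_{k ≠ 0}` (with the convention `v_0 = 0`) is the family of Fourier coefficients of `u`:
`u(x + iy) = ∑_{k ≠ 0} √y K_ν(2π |k| y / N) e^{2π i k x / N} v_k`. -/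
def IsFourierCoeff (ν : ℂ) (η : Representation ℂ PSL(2, ℤ) V) (u : ℍ → V) (v : ℤ → V) : Prop :=
  v 0 = 0 ∧ ∀ z : ℍ, HasSum (fun k : ℤ ↦
    ((Real.sqrt z.im : ℂ) * besselK ν (2 * Real.pi * |(k : ℝ)| / ord η * z.im) *
      exp (2 * Real.pi * I * k / ord η * z.re)) • v k) (u z)

/-- `f` is given by the series `f(z) = ∑_{k > 0} k^ν e^{2π i k z / N} v_k` for `Im z > 0` and
`f(z) = - ∑_{k < 0} |k|^ν e^{2π i k z / N} v_k` for `Im z < 0` (convergence is part of this). -/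
def IsLewisSeries (ν : ℂ) (η : Representation ℂ PSL(2, ℤ) V) (v : ℤ → V) (f : nonreal → V) :
    Prop :=
  ∀ z : nonreal,
    (0 < (z : ℂ).im → HasSum (fun k : {k : ℤ // 0 < k} ↦
      (((|(k : ℤ)| : ℤ) : ℂ) ^ ν * exp (2 * Real.pi * I * (k : ℤ) / ord η * z)) • v k) (f z)) ∧
    ((z : ℂ).im < 0 → HasSum (fun k : {k : ℤ // k < 0} ↦
      (((|(k : ℤ)| : ℤ) : ℂ) ^ ν * exp (2 * Real.pi * I * (k : ℤ) / ord η * z)) • v k) (-(f z)))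

end LewisCorr

end

/-!
Throughout let `s = ν + 1/2`, so that `Re s > 0`.

**Fourier expansion.** The Fourier coefficients of a cusp form `u` solve
`a'' = ((2πk/N)² + (ν² - 1/4)/y²) a`, and so does `√y K_ν(2π|k|y/N)`. Square integrability makes the
Wronskian of the two vanish (`wronskian_eq_zero`), so the coefficients are multiples `v_k` of the
Bessel function (`IsEigen.exists_fourierInt_eq`). Boundedness of `u` on horizontal lines and the
asymptotics of `K_ν` show that `v_k` grows subexponentially (`isSubExp_of_besselK`), which gives
convergence of all the series.

**The period function.** Up to a constant, `√y K_ν(y)` is the *Abel transform*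
`y^s ∫₁^∞ (r² - 1)^{s-1} F(yr) dr` of `F(q) = e^{-q}` (`exists_abel_exp_neg_eq`). Hence `u(iy)` and
`u_x(iy)` are Abel transforms `U₀`, `U₁` of functions `F₀`, `-iF₁'` on the right half plane, where
`f_u(z) = (F₁(-iz) + F₀(-iz))/2` for `Im z > 0` and `f_u(z) = (F₁(iz) - F₀(iz))/2` for `Im z < 0`.
The invariance of `u` under `z ↦ -1/z` becomes `U₀(1/y) = η(S) U₀(y)` and
`U₁(1/y) = -y² η(S) U₁(y)`, which makes `U₀` and `U₁` decay rapidly at `0` as well as at `∞`.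

The integral `D(ζ) = 2s ∫₀^∞ ζ y^s (ζ² + y²)^{-s-1} U₀(y) dy` converges for `Re ζ > 0`. In the
coordinate `log ζ` it is a convolution with a power of the hyperbolic cosine, and shifting the line
of integration continues it to `ℂ ∖ (-∞, 0]` (`coshConv_eq_integral`). The part of the integral near
infinity is a Cauchy integral of `F₀`, so the boundary values on the imaginary axis recover `F₀`:
`e^{πis} D(ζ) + e^{-πis} D(-ζ) = π F₀(-iζ)` for `Im ζ > 0` (`rayTransform_jump_upper`). A primitive
`P` of minus the corresponding transform of `U₁` recovers `F₁` (`rayPrimitive_jump`). Inserting this in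
`f_u(z) - z^{-2s} η(S) f_u(-1/z)` and using that `ζ ↦ 1/ζ` interchanges `D - P` and `D + P` leaves a
constant multiple of `D - P`, which is holomorphic on `ℂ ∖ (-∞, 0]` and is `O(min 1 |z|^{-2 Re s})`
on closed subsectors (`exists_period_extension`).

The three term equation then is a formal consequence of `f_u(z + 1) = η(T) f_u(z)` and
`(S T⁻¹)³ = 1`, and linearity follows from the uniqueness of Fourier coefficients and of holomorphic
extensions.
-/

open scoped MatrixGroups

noncomputable section

namespace LewisCorr

open Complex MeasureTheory Filter Topology

/-! ### Tools from analysis -/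

section Tools

variable {E : Type*} [NormedAddCommGroup E] [NormedSpace ℂ E]

/-- Differentiation under the integral sign for integrands that are holomorphic in the parameter:
by Cauchy's estimate it is enough to dominate the integrand itself. -/
theorem hasDerivAt_integral_of_holomorphic {α : Type*} [MeasurableSpace α] {μ : Measure α}
    {F : ℂ → α → E} {z₀ : ℂ} {s : Set ℂ} {g : α → ℝ} (hs : s ∈ 𝓝 z₀) (hg : Integrable g μ)
    (hmeas : ∀ z ∈ s, AEStronglyMeasurable (F z) μ)
    (hd : ∀ᵐ a ∂μ, DifferentiableOn ℂ (F · a) s) (hb : ∀ᵐ a ∂μ, ∀ z ∈ s, ‖F z a‖ ≤ g a) :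
    Integrable (fun a ↦ deriv (F · a) z₀) μ ∧
      HasDerivAt (fun z ↦ ∫ a, F z a ∂μ) (∫ a, deriv (F · a) z₀ ∂μ) z₀ := by
  obtain ⟨r, hr, hrs⟩ := Metric.mem_nhds_iff.1 hs
  have h0 : z₀ ∈ s := mem_of_mem_nhds hs
  have hsub : ∀ w ∈ Metric.ball z₀ (r / 2), Metric.closedBall w (r / 4) ⊆ Metric.ball z₀ r := by
    intro w hw v hv
    rw [Metric.mem_ball] at *
    rw [Metric.mem_closedBall] at hv
    linarith [dist_triangle v w z₀]
  have hderiv : ∀ᵐ a ∂μ, ∀ w ∈ Metric.ball z₀ (r / 2), HasDerivAt (F · a) (deriv (F · a) w) w := by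
    filter_upwards [hd] with a ha w hw
    refine (ha.differentiableAt (mem_of_superset ?_ hrs)).hasDerivAt
    exact Metric.isOpen_ball.mem_nhds (Metric.ball_subset_ball (by linarith) hw)
  refine hasDerivAt_integral_of_dominated_loc_of_deriv_le (F' := fun z a ↦ deriv (F · a) z)
    (s := Metric.ball z₀ (r / 2)) (bound := fun a ↦ g a / (r / 4))
    (Metric.ball_mem_nhds _ (by linarith)) ?_ ?_ ?_ ?_ (hg.div_const _) hderiv
  · filter_upwards [hs] with z hz using hmeas z hz
  · exact hg.mono' (hmeas _ h0) (by filter_upwards [hb] with a ha using ha z₀ h0)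
  · obtain ⟨u, hu, hu'⟩ : ∃ u : ℕ → ℂ, (∀ n, u n ∈ Metric.ball z₀ r ∧ u n ≠ z₀) ∧
        Tendsto u atTop (𝓝 z₀) := by
      refine ⟨fun n ↦ z₀ + (r / 2 / (n + 1) : ℝ), fun n ↦ ⟨?_, ?_⟩, ?_⟩
      · rw [Metric.mem_ball, Complex.dist_eq, add_sub_cancel_left, norm_real, Real.norm_eq_abs, abs_of_pos
          (by positivity)]
        rw [div_lt_iff₀ (by positivity)]
        have : (0 : ℝ) ≤ n := by positivity
        nlinarith
      · simp only [ne_eq, add_eq_left, ofReal_eq_zero]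
        positivity
      · have : Tendsto (fun n : ℕ ↦ r / 2 / ((n : ℝ) + 1)) atTop (𝓝 0) :=
          tendsto_const_nhds.div_atTop (tendsto_natCast_atTop_atTop.atTop_add tendsto_const_nhds)
        have h2 := (continuous_ofReal.tendsto 0).comp this
        simpa using h2.const_add z₀
    refine aestronglyMeasurable_of_tendsto_ae atTop
      (f := fun n a ↦ (u n - z₀)⁻¹ • (F (u n) a - F z₀ a)) (fun n ↦ ?_) ?_
    · exact ((hmeas _ (hrs (hu n).1)).sub (hmeas _ h0)).const_smul _
    · filter_upwards [hderiv] with a ha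
      have := (ha z₀ (Metric.mem_ball_self (by linarith))).tendsto_slope
      exact this.comp (tendsto_nhdsWithin_iff.2 ⟨hu', Eventually.of_forall fun n ↦ (hu n).2⟩)
  · filter_upwards [hd, hb] with a ha hba w hw
    refine Complex.norm_deriv_le_of_forall_mem_sphere_norm_le (by linarith) ?_ fun z hz ↦
      hba z (hrs (hsub w hw (Metric.sphere_subset_closedBall hz)))
    refine DifferentiableOn.diffContOnCl (ha.mono ?_)
    rw [closure_ball _ (by linarith)]
    exact (hsub w hw).trans hrs

lemma integrable_exp_neg_mul_abs {c : ℝ} (hc : 0 < c) :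
    Integrable fun x : ℝ ↦ Real.exp (-c * |x|) := by
  rw [← integrableOn_univ, ← Set.Iic_union_Ioi (a := (0 : ℝ))]
  refine IntegrableOn.union ?_ ?_
  · refine (integrableOn_exp_mul_Iic hc 0).congr_fun (fun x hx ↦ ?_) measurableSet_Iic
    simp [abs_of_nonpos (show x ≤ 0 from hx)]
  · refine (exp_neg_integrableOn_Ioi 0 hc).congr_fun (fun x hx ↦ ?_) measurableSet_Ioi
    simp [abs_of_pos (show 0 < x from hx)]

/-- Shifting a horizontal line of integration. -/
theorem integral_horizontal_line_eq [CompleteSpace E] {f : ℂ → E} {a b c K : ℝ} (hab : a ≤ b)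
    (hc : 0 < c)
    (hf : DifferentiableOn ℂ f {w | a ≤ w.im ∧ w.im ≤ b})
    (hb : ∀ w : ℂ, a ≤ w.im → w.im ≤ b → ‖f w‖ ≤ K * Real.exp (-c * |w.re|)) :
    ∫ x : ℝ, f (x + a * I) = ∫ x : ℝ, f (x + b * I) := by
  have hline : ∀ t : ℝ, a ≤ t → t ≤ b → Integrable fun x : ℝ ↦ f (x + t * I) := by
    intro t h1 h2
    refine ((integrable_exp_neg_mul_abs hc).const_mul K).mono' ?_ (Eventually.of_forall fun x ↦ ?_)
    · refine Continuous.aestronglyMeasurable ?_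
      refine hf.continuousOn.comp_continuous (by fun_prop) fun x ↦ ?_
      simpa using ⟨h1, h2⟩
    · simpa using hb (x + t * I) (by simpa using h1) (by simpa using h2)
  have hlim : ∀ t : ℝ, a ≤ t → t ≤ b → Tendsto (fun R : ℝ ↦ ∫ x in -R..R, f (x + t * I)) atTop
      (𝓝 (∫ x : ℝ, f (x + t * I))) := fun t h1 h2 ↦
    intervalIntegral_tendsto_integral (hline t h1 h2) tendsto_neg_atTop_atBot tendsto_id
  have hv : ∀ e : ℝ, |e| = 1 → Tendsto (fun R : ℝ ↦ ∫ y in a..b, f ((e * R : ℝ) + y * I)) atTop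
      (𝓝 0) := by
    intro e he
    refine squeeze_zero_norm' (a := fun R ↦ (K * Real.exp (-c * R)) * |b - a|) ?_ ?_
    · filter_upwards [eventually_ge_atTop 0] with R hR
      refine intervalIntegral.norm_integral_le_of_norm_le_const fun y hy ↦ ?_
      rw [Set.uIoc_of_le hab] at hy
      have := hb ((e * R : ℝ) + y * I) (by simpa using hy.1.le) (by simpa using hy.2)
      have h2 : |((e * R : ℝ) + y * I : ℂ).re| = R := by
        simp [abs_mul, he, abs_of_nonneg hR]
      rwa [h2] at this
    · have : Tendsto (fun R : ℝ ↦ -c * R) atTop atBot :=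
        tendsto_id.const_mul_atTop_of_neg (by linarith)
      simpa using ((Real.tendsto_exp_atBot.comp this).const_mul K).mul_const |b - a|
  have hrect : ∀ R : ℝ, (∫ x in -R..R, f (x + a * I)) - (∫ x in -R..R, f (x + b * I)) +
      I • (∫ y in a..b, f ((1 * R : ℝ) + y * I)) - I • (∫ y in a..b, f ((-1 * R : ℝ) + y * I))
      = 0 := by
    intro R
    have := integral_boundary_rect_eq_zero_of_differentiableOn f ⟨-R, a⟩ ⟨R, b⟩ (hf.mono ?_)
    · simpa using this
    · rintro w ⟨-, hw⟩
      simpa [Set.uIcc_of_le hab] using hw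
  have h0 := (((hlim a le_rfl hab).sub (hlim b hab le_rfl)).add
    ((hv 1 (by simp)).const_smul I)).sub ((hv (-1) (by simp)).const_smul I)
  simp only [hrect] at h0
  have := tendsto_nhds_unique h0 tendsto_const_nhds
  simpa [sub_eq_zero] using this

/-- The Poisson kernel of the half plane is an approximate identity. -/
theorem tendsto_integral_poisson_kernel [CompleteSpace E] {g : ℝ → E} {t C : ℝ}
    (hg : AEStronglyMeasurable g)
    (hgb : ∀ q, ‖g q‖ ≤ C) (hgt : ContinuousAt g t) :
    Tendsto (fun h : ℝ ↦ ∫ q : ℝ, ((h / (h ^ 2 + (q - t) ^ 2) : ℝ) : ℂ) • g q) (𝓝[>] 0)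
      (𝓝 ((Real.pi : ℂ) • g t)) := by
  have hcv : ∀ h : ℝ, 0 < h → ∫ q : ℝ, ((h / (h ^ 2 + (q - t) ^ 2) : ℝ) : ℂ) • g q
      = ∫ p : ℝ, (((1 + p ^ 2)⁻¹ : ℝ) : ℂ) • g (h * p + t) := by
    intro h hh
    have h1 := integral_add_right_eq_self
      (fun q : ℝ ↦ ((h / (h ^ 2 + (q - t) ^ 2) : ℝ) : ℂ) • g q) t (μ := volume)
    have h2 := Measure.integral_comp_mul_left
      (fun q : ℝ ↦ ((h / (h ^ 2 + (q + t - t) ^ 2) : ℝ) : ℂ) • g (q + t)) h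
    rw [← h1, ← inv_smul_smul₀ (inv_ne_zero hh.ne') (∫ _, _), inv_inv]
    rw [← abs_of_pos (inv_pos.2 hh), ← h2, ← integral_smul]
    refine integral_congr_ae (Eventually.of_forall fun p ↦ ?_)
    change h • (((h / (h ^ 2 + (h * p + t - t) ^ 2) : ℝ) : ℂ) • g (h * p + t)) = _
    rw [← Complex.coe_smul, smul_smul, add_sub_cancel_right]
    congr 1
    norm_cast
    field_simp
  have hlim : Tendsto (fun h : ℝ ↦ ∫ p : ℝ, (((1 + p ^ 2)⁻¹ : ℝ) : ℂ) • g (h * p + t)) (𝓝[>] 0)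
      (𝓝 (∫ p : ℝ, (((1 + p ^ 2)⁻¹ : ℝ) : ℂ) • g t)) := by
    refine tendsto_integral_filter_of_dominated_convergence (fun p ↦ (1 + p ^ 2)⁻¹ * C) ?_ ?_
      (integrable_inv_one_add_sq.mul_const C) ?_
    · filter_upwards [self_mem_nhdsWithin] with h hh
      refine AEStronglyMeasurable.smul (by fun_prop) ?_
      have hq : Measure.QuasiMeasurePreserving (fun p : ℝ ↦ h * p + t) volume volume :=
        (measurePreserving_add_right volume t).quasiMeasurePreserving.comp
          ⟨measurable_const_mul h, by
            rw [Real.map_volume_mul_left (ne_of_gt hh)]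
            exact Measure.smul_absolutelyContinuous⟩
      exact hg.comp_quasiMeasurePreserving hq
    · filter_upwards with h
      filter_upwards with p
      rw [norm_smul, norm_real, Real.norm_of_nonneg (by positivity)]
      exact mul_le_mul_of_nonneg_left (hgb _) (by positivity)
    · filter_upwards with p
      refine Tendsto.const_smul ?_ _
      refine hgt.tendsto.comp ?_
      have : Tendsto (fun h : ℝ ↦ h * p + t) (𝓝 0) (𝓝 (0 * p + t)) := by
        apply Continuous.tendsto; fun_prop
      simp only [zero_mul, zero_add] at this
      exact this.mono_left nhdsWithin_le_nhds
  have hpi : ∫ p : ℝ, (((1 + p ^ 2)⁻¹ : ℝ) : ℂ) = Real.pi := by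
    rw [← integral_univ_inv_one_add_sq]; exact integral_ofReal
  rw [integral_smul_const, hpi] at hlim
  refine hlim.congr' ?_
  filter_upwards [self_mem_nhdsWithin] with h hh
  rw [hcv h hh]

/-- Two solutions of a scalar linear second order equation with vanishing Wronskian are
proportional. -/
theorem eq_smul_of_wronskian_eq_zero {a a' : ℝ → E} {b b' q : ℝ → ℂ}
    (hq : ContinuousOn q (Set.Ioi 0))
    (ha : ∀ y, 0 < y → HasDerivAt a (a' y) y) (ha' : ∀ y, 0 < y → HasDerivAt a' (q y • a y) y)
    (hb : ∀ y, 0 < y → HasDerivAt b (b' y) y) (hb' : ∀ y, 0 < y → HasDerivAt b' (q y * b y) y)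
    (hW : ∀ y, 0 < y → b y • a' y = b' y • a y) {y₀ : ℝ} (hy₀ : 0 < y₀) (hby₀ : b y₀ ≠ 0) :
    ∀ y, 0 < y → a y = b y • ((b y₀)⁻¹ • a y₀) := by
  intro y hy
  set v := (b y₀)⁻¹ • a y₀ with hv
  set c := min y y₀ / 2 with hc
  set d := max y y₀ + 1 with hd
  have hc0 : 0 < c := by have := lt_min hy hy₀; linarith
  have hcy : c < y := by have := min_le_left y y₀; have := lt_min hy hy₀; linarith
  have hcy0 : c < y₀ := by have := min_le_right y y₀; have := lt_min hy hy₀; linarith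
  have hdy : y < d := by have := le_max_left y y₀; linarith
  have hdy0 : y₀ < d := by have := le_max_right y y₀; linarith
  have hsub : Set.Icc c d ⊆ Set.Ioi 0 := fun x hx ↦ hc0.trans_le hx.1
  obtain ⟨M, hM⟩ := isCompact_Icc.exists_bound_of_continuousOn (hq.mono hsub)
  let K : NNReal := max 1 (Real.toNNReal M)
  have key := ODE_solution_unique_of_mem_Icc (E := E × E) (v := fun t p ↦ (p.2, q t • p.1))
    (s := fun _ ↦ Set.univ) (K := K) (f := fun t ↦ (a t, a' t))
    (g := fun t ↦ (b t • v, b' t • v)) (a := c) (b := d) (t₀ := y₀) ?_ ⟨hcy0, hdy0⟩ ?_ ?_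
    (by simp) ?_ ?_ (by simp) ?_
  · exact congrArg Prod.fst (key ⟨hcy.le, hdy.le⟩)
  · intro t ht
    refine (LipschitzWith.of_dist_le_mul fun p p' ↦ ?_).lipschitzOnWith
    rw [Prod.dist_eq]
    have h1 : ‖q t‖ ≤ K := (hM t ⟨ht.1.le, ht.2.le⟩).trans
      ((Real.le_coe_toNNReal M).trans (by exact_mod_cast le_max_right _ _))
    have h2 : (1 : ℝ) ≤ K := by exact_mod_cast le_max_left _ _
    refine max_le ?_ ?_
    · calc dist p.2 p'.2 ≤ dist p p' := le_max_right _ _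
        _ ≤ K * dist p p' := le_mul_of_one_le_left dist_nonneg h2
    · simp only [dist_smul₀]
      exact mul_le_mul h1 (le_max_left _ _) dist_nonneg (by positivity)
  · exact fun t ht ↦ ((ha t (hsub ht)).continuousAt.prodMk
      (ha' t (hsub ht)).continuousAt).continuousWithinAt
  · exact fun t ht ↦ (ha t (hc0.trans ht.1)).prodMk (ha' t (hc0.trans ht.1))
  · exact fun t ht ↦ (((hb t (hsub ht)).continuousAt.smul continuousAt_const).prodMk
      ((hb' t (hsub ht)).continuousAt.smul continuousAt_const)).continuousWithinAt
  · intro t ht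
    have := ((hb t (hc0.trans ht.1)).smul_const v).prodMk ((hb' t (hc0.trans ht.1)).smul_const v)
    simpa only [mul_smul] using this
  · have h1 : a y₀ = b y₀ • v := by rw [hv, smul_inv_smul₀ hby₀]
    have h2 : a' y₀ = b' y₀ • v := by
      rw [hv, smul_comm, ← hW y₀ hy₀, inv_smul_smul₀ hby₀]
    simp only [h1, h2]

/-- If two solutions of a scalar linear second order equation are such that the products of the
first one with the second one and with its derivative are integrable at infinity,
then their Wronskian vanishes. -/
theorem wronskian_eq_zero [CompleteSpace E] {a a' : ℝ → E} {b b' q : ℝ → ℂ}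
    (ha : ∀ y, 0 < y → HasDerivAt a (a' y) y) (ha' : ∀ y, 0 < y → HasDerivAt a' (q y • a y) y)
    (hb : ∀ y, 0 < y → HasDerivAt b (b' y) y) (hb' : ∀ y, 0 < y → HasDerivAt b' (q y * b y) y)
    (h1 : IntegrableOn (fun y ↦ b y • a y) (Set.Ioi 1))
    (h2 : IntegrableOn (fun y ↦ b' y • a y) (Set.Ioi 1)) :
    ∀ y, 0 < y → b y • a' y = b' y • a y := by
  have hder : ∀ y, 0 < y → HasDerivAt (fun y ↦ b y • a' y - b' y • a y) 0 y := by
    intro y hy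
    have := ((hb y hy).smul (ha' y hy)).sub ((hb' y hy).smul (ha y hy))
    have e : b y • q y • a y + b' y • a' y - (b' y • a' y + (q y * b y) • a y) = 0 := by module
    rwa [e] at this
  set W := b 1 • a' 1 - b' 1 • a 1 with hW
  have hconst : ∀ y, 0 < y → b y • a' y - b' y • a y = W := by
    intro y hy
    exact (convex_Ioi (0 : ℝ)).is_const_of_fderivWithin_eq_zero (𝕜 := ℝ)
      (f := fun y ↦ b y • a' y - b' y • a y)
      (fun x hx ↦ (hder x hx).differentiableAt.differentiableWithinAt)
      (fun x hx ↦ by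
        rw [fderivWithin_of_isOpen isOpen_Ioi hx, (hder x hx).hasFDerivAt.fderiv]; ext; simp)
      (Set.mem_Ioi.2 hy) (Set.mem_Ioi.2 one_pos)
  suffices W = 0 from fun y hy ↦ sub_eq_zero.1 ((hconst y hy).trans this)
  by_contra hne
  -- the product `m = b a` has derivative `W + 2 b' a`, so it grows linearly unless `W = 0`
  have hm : ∀ Y, 1 ≤ Y → b Y • a Y - b 1 • a 1 = (∫ y in (1 : ℝ)..Y, (2 : ℂ) • b' y • a y)
      + (Y - 1) • W := by
    intro Y hY
    have hbd : ∀ y, 0 < y → HasDerivAt (fun y ↦ b y • a y) ((2 : ℂ) • b' y • a y + W) y := by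
      intro y hy
      have := (hb y hy).smul (ha y hy)
      have e : (2 : ℂ) • b' y • a y + W = b y • a' y + b' y • a y := by
        rw [← hconst y hy, two_smul]; abel
      rwa [e]
    have hint : IntervalIntegrable (fun y ↦ (2 : ℂ) • b' y • a y) volume 1 Y := by
      rw [intervalIntegrable_iff_integrableOn_Ioc_of_le hY]
      exact (h2.mono_set Set.Ioc_subset_Ioi_self).smul _
    rw [← intervalIntegral.integral_eq_sub_of_hasDerivAt (f := fun y ↦ b y • a y)
      (f' := fun y ↦ (2 : ℂ) • b' y • a y + W), intervalIntegral.integral_add hint (by simp)]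
    · simp
    · intro y hy
      rw [Set.uIcc_of_le hY] at hy
      exact hbd y (by linarith [hy.1])
    · exact hint.add (by simp)
  set C := ‖b 1 • a 1‖ + ∫ y in Set.Ioi (1 : ℝ), ‖(2 : ℂ) • b' y • a y‖ with hC
  have hlow : ∀ Y, 1 ≤ Y → (Y - 1) * ‖W‖ - C ≤ ‖b Y • a Y‖ := by
    intro Y hY
    have e : (Y - 1) • W = b Y • a Y - b 1 • a 1 - ∫ y in (1 : ℝ)..Y, (2 : ℂ) • b' y • a y := by
      rw [hm Y hY]; abel
    have h3 : ‖∫ y in (1 : ℝ)..Y, (2 : ℂ) • b' y • a y‖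
        ≤ ∫ y in Set.Ioi (1 : ℝ), ‖(2 : ℂ) • b' y • a y‖ := by
      refine (intervalIntegral.norm_integral_le_integral_norm hY).trans ?_
      rw [intervalIntegral.integral_of_le hY]
      exact setIntegral_mono_set (h2.smul (2 : ℂ)).norm
        (Eventually.of_forall fun _ ↦ norm_nonneg _) Set.Ioc_subset_Ioi_self.eventuallyLE
    have h4 : (Y - 1) * ‖W‖ = ‖(Y - 1) • W‖ := by
      rw [norm_smul, Real.norm_of_nonneg (by linarith)]
    rw [h4, e]
    have h5 := norm_sub_le (b Y • a Y - b 1 • a 1) (∫ y in (1 : ℝ)..Y, (2 : ℂ) • b' y • a y)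
    have h6 := norm_sub_le (b Y • a Y) (b 1 • a 1)
    linarith
  have hWpos : 0 < ‖W‖ := norm_pos_iff.2 hne
  have hC0 : 0 ≤ C := add_nonneg (norm_nonneg _) (integral_nonneg fun _ ↦ norm_nonneg _)
  set Y₀ := 1 + (C + 1) / ‖W‖ with hY0
  have hY01 : 1 ≤ Y₀ := by rw [hY0]; have : 0 ≤ (C + 1) / ‖W‖ := by positivity
                           linarith
  have hone : IntegrableOn (fun _ : ℝ ↦ (1 : ℝ)) (Set.Ioi Y₀) := by
    refine Integrable.mono' (h1.mono_set (Set.Ioi_subset_Ioi hY01)).norm (by fun_prop) ?_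
    filter_upwards [ae_restrict_mem measurableSet_Ioi] with Y hY
    have hY' : Y₀ < Y := hY
    refine le_trans ?_ (hlow Y (hY01.trans hY'.le))
    have : (C + 1) / ‖W‖ ≤ Y - 1 := by linarith
    rw [div_le_iff₀ hWpos] at this
    simp; linarith
  simp [integrableOn_const_iff] at hone

end Tools

/-! ### Convolution with powers of the hyperbolic cosine on a strip -/

section Strip

variable {E : Type*} [NormedAddCommGroup E] [NormedSpace ℂ E]

/-- The kernel `(2 cosh w)^{-α}`; the principal branch is the right one for `|Im w| < π / 2`, where
`cosh w` has positive real part. -/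
def coshKer (α w : ℂ) : ℂ := (2 * cosh w) ^ (-α)

lemma cosh_re_eq (w : ℂ) : (cosh w).re = Real.cosh w.re * Real.cos w.im := by
  conv_lhs => rw [← re_add_im w, cosh_add, cosh_mul_I, sinh_mul_I]
  rw [← ofReal_cosh, ← ofReal_sinh, ← ofReal_cos, ← ofReal_sin]
  simp [-ofReal_cos, -ofReal_sin, -ofReal_cosh, -ofReal_sinh]

lemma exp_abs_le_two_cosh (x : ℝ) : Real.exp |x| ≤ 2 * Real.cosh x := by
  rw [Real.cosh_eq]
  rcases abs_cases x with ⟨h, _⟩ | ⟨h, _⟩ <;> rw [h] <;>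
    linarith [Real.exp_pos x, Real.exp_pos (-x)]

lemma sin_mul_exp_le_re {δ : ℝ} (hδ : 0 < δ) {w : ℂ} (hw : |w.im| ≤ Real.pi / 2 - δ) :
    Real.sin δ * Real.exp |w.re| ≤ (2 * cosh w).re := by
  have h1 : Real.sin δ ≤ Real.cos w.im := by
    rw [← Real.cos_pi_div_two_sub, ← Real.cos_abs w.im]
    exact Real.cos_le_cos_of_nonneg_of_le_pi (abs_nonneg _) (by linarith [Real.pi_pos]) hw
  have h2 : 0 ≤ Real.sin δ :=
    Real.sin_nonneg_of_nonneg_of_le_pi hδ.le (by linarith [abs_nonneg w.im, Real.pi_pos])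
  have h3 : (2 * cosh w).re = 2 * Real.cosh w.re * Real.cos w.im := by
    rw [mul_re, cosh_re_eq]; simp; ring
  rw [h3, mul_comm]
  exact mul_le_mul (exp_abs_le_two_cosh _) h1 h2 (by positivity)

lemma two_cosh_mem_slitPlane {w : ℂ} (hw : |w.im| < Real.pi / 2) : 2 * cosh w ∈ slitPlane := by
  left
  have := sin_mul_exp_le_re (δ := Real.pi / 2 - |w.im|) (by linarith) (w := w) (by linarith)
  refine lt_of_lt_of_le (mul_pos (Real.sin_pos_of_pos_of_lt_pi (by linarith) ?_)
    (Real.exp_pos _)) this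
  linarith [abs_nonneg w.im, Real.pi_pos]

lemma norm_coshKer_le {α : ℂ} (hα : 0 < α.re) {δ : ℝ} (hδ : 0 < δ) :
    ∃ K, 0 ≤ K ∧ ∀ w : ℂ, |w.im| ≤ Real.pi / 2 - δ →
      ‖coshKer α w‖ ≤ K * Real.exp (-α.re * |w.re|) := by
  refine ⟨|Real.sin δ ^ (-α.re)| * Real.exp (Real.pi * |α.im|), by positivity, fun w hw ↦ ?_⟩
  have hs : 0 < Real.sin δ :=
    Real.sin_pos_of_pos_of_lt_pi hδ (by linarith [abs_nonneg w.im, Real.pi_pos])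
  have h1 : Real.sin δ * Real.exp |w.re| ≤ ‖2 * cosh w‖ :=
    (sin_mul_exp_le_re hδ hw).trans (re_le_norm _)
  have h0 : 0 < Real.sin δ * Real.exp |w.re| := by positivity
  refine (norm_cpow_le _ _).trans ?_
  rw [div_eq_mul_inv, ← Real.exp_neg]
  have e1 : ‖2 * cosh w‖ ^ (-α).re ≤ Real.sin δ ^ (-α.re) * Real.exp (-α.re * |w.re|) := by
    rw [neg_re]
    refine (Real.rpow_le_rpow_of_nonpos h0 h1 (by linarith)).trans ?_
    rw [Real.mul_rpow hs.le (Real.exp_pos _).le, ← Real.exp_mul, mul_comm |w.re|]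
  have e2 : Real.exp (-((2 * cosh w).arg * (-α).im)) ≤ Real.exp (Real.pi * |α.im|) := by
    gcongr
    rw [neg_im, mul_neg, neg_neg]
    refine (le_abs_self _).trans ?_
    rw [abs_mul]
    gcongr
    exact abs_arg_le_pi _
  calc _ ≤ (Real.sin δ ^ (-α.re) * Real.exp (-α.re * |w.re|)) * Real.exp (Real.pi * |α.im|) :=
        mul_le_mul e1 e2 (Real.exp_pos _).le (by positivity)
    _ = _ := by rw [abs_of_nonneg (by positivity : 0 ≤ Real.sin δ ^ (-α.re))]; ring

lemma hasDerivAt_coshKer (α : ℂ) {w : ℂ} (hw : |w.im| < Real.pi / 2) :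
    HasDerivAt (coshKer α) (-α * coshKer (α + 1) w * (2 * sinh w)) w := by
  have := ((hasDerivAt_cosh w).const_mul 2).cpow_const (c := -α) (two_cosh_mem_slitPlane hw)
  rw [coshKer, neg_add, ← sub_eq_add_neg]
  exact this

lemma coshKer_eq_mul {α w : ℂ} (hw : |w.im| < Real.pi / 2) :
    coshKer α w = coshKer (α + 1) w * (2 * cosh w) := by
  rw [coshKer, coshKer, neg_add, cpow_add _ _ (slitPlane_ne_zero (two_cosh_mem_slitPlane hw)),
    cpow_neg_one, mul_assoc, inv_mul_cancel₀ (slitPlane_ne_zero (two_cosh_mem_slitPlane hw)),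
    mul_one]

/-- Holomorphic functions on the strip `|Im w| < π / 2` that decay faster than every exponential
at both ends, uniformly on closed substrips. -/
structure IsRapid (W : ℂ → E) : Prop where
  diff : DifferentiableOn ℂ W {w | |w.im| < Real.pi / 2}
  decay : ∀ n δ : ℝ, 0 < δ → ∃ C, ∀ w : ℂ, |w.im| ≤ Real.pi / 2 - δ →
    ‖W w‖ ≤ C * Real.exp (-n * |w.re|)

lemma IsRapid.exp_smul {W : ℂ → E} (hW : IsRapid W) (c : ℝ) :
    IsRapid fun w ↦ exp (c * w) • W w where
  diff := DifferentiableOn.smul (by fun_prop) hW.diff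
  decay n δ hδ := by
    obtain ⟨C, hC⟩ := hW.decay (n + |c|) δ hδ
    refine ⟨C, fun w hw ↦ ?_⟩
    have h1 : ‖exp (c * w)‖ ≤ Real.exp (|c| * |w.re|) := by
      rw [norm_exp]
      gcongr
      rw [← abs_mul]
      simpa using le_abs_self (c * w.re)
    calc ‖exp (c * w) • W w‖ = ‖exp (c * w)‖ * ‖W w‖ := norm_smul _ _
      _ ≤ Real.exp (|c| * |w.re|) * (C * Real.exp (-(n + |c|) * |w.re|)) :=
        mul_le_mul h1 (hC w hw) (norm_nonneg _) (Real.exp_pos _).le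
      _ = C * (Real.exp (|c| * |w.re|) * Real.exp (-(n + |c|) * |w.re|)) := by ring
      _ = _ := by rw [← Real.exp_add]; ring_nf

lemma IsRapid.norm_coshKer_smul_le {W : ℂ → E} (hW : IsRapid W) {α : ℂ} (hα : 0 < α.re) {δ : ℝ}
    (hδ : 0 < δ) : ∃ K, ∀ z w : ℂ, |w.im| ≤ Real.pi / 2 - δ → |(z - w).im| ≤ Real.pi / 2 - δ →
      ‖coshKer α (z - w) • W w‖
        ≤ K * Real.exp (-α.re * |z.re|) * Real.exp (-1 * |w.re|) := by
  obtain ⟨K, hK0, hK⟩ := norm_coshKer_le hα hδ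
  obtain ⟨C, hC⟩ := hW.decay (α.re + 1) δ hδ
  refine ⟨K * C, fun z w hw hzw ↦ ?_⟩
  rw [norm_smul]
  have h1 := mul_le_mul (hK _ hzw) (hC w hw) (norm_nonneg _) (by positivity)
  have hC0 : 0 ≤ C := by
    have := (norm_nonneg _).trans (hC w hw)
    exact nonneg_of_mul_nonneg_left this (Real.exp_pos _)
  refine h1.trans ?_
  have h2 : Real.exp (-α.re * |(z - w).re|) * Real.exp (-(α.re + 1) * |w.re|)
      ≤ Real.exp (-α.re * |z.re|) * Real.exp (-1 * |w.re|) := by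
    rw [← Real.exp_add, ← Real.exp_add]
    have : |z.re| ≤ |(z - w).re| + |w.re| := by
      rw [sub_re]; linarith [abs_sub_abs_le_abs_sub z.re w.re]
    refine Real.exp_le_exp.2 ?_
    nlinarith
  calc _ = K * C * (Real.exp (-α.re * |(z - w).re|) * Real.exp (-(α.re + 1) * |w.re|)) := by ring
    _ ≤ K * C * (Real.exp (-α.re * |z.re|) * Real.exp (-1 * |w.re|)) := by gcongr
    _ = _ := by ring

/-- The integral `∫ (2 cosh (z - w))^{-α} W(w) dw` over the line `Im w = Im z / 2`. For
`|Im z| < π` this line, and the shifted one through `z - w`, stay in the strip of width `π`. -/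
def coshConv (α : ℂ) (W : ℂ → E) (z : ℂ) : E :=
  ∫ x : ℝ, coshKer α (z - (x + (z.im / 2 : ℝ) * I)) • W (x + (z.im / 2 : ℝ) * I)

lemma coshConv_integrand_continuous {W : ℂ → E} (hW : IsRapid W) (α z : ℂ) {θ : ℝ}
    (hθ : |θ| < Real.pi / 2) (hz : |z.im - θ| < Real.pi / 2) :
    Continuous fun x : ℝ ↦ coshKer α (z - (x + θ * I)) • W (x + θ * I) := by
  refine Continuous.smul ?_ ?_
  · rw [continuous_iff_continuousAt]
    intro x
    refine ContinuousAt.comp (g := coshKer α) (f := fun x : ℝ ↦ z - (x + θ * I))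
      (hasDerivAt_coshKer α ?_).continuousAt (by fun_prop)
    simpa using hz
  · exact hW.diff.continuousOn.comp_continuous (by fun_prop) fun x ↦ by simpa using hθ

variable [CompleteSpace E]

/-- The value of `coshConv` does not depend on the line of integration. -/
theorem coshConv_eq_integral {W : ℂ → E} (hW : IsRapid W) {α : ℂ} (hα : 0 < α.re) {z : ℂ} {θ : ℝ}
    (hθ : |θ| < Real.pi / 2) (hz : |z.im - θ| < Real.pi / 2) :
    coshConv α W z = ∫ x : ℝ, coshKer α (z - (x + θ * I)) • W (x + θ * I) := by
  have key : ∀ a b : ℝ, a ≤ b → |a| < Real.pi / 2 → |z.im - a| < Real.pi / 2 →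
      |b| < Real.pi / 2 → |z.im - b| < Real.pi / 2 →
      ∫ x : ℝ, coshKer α (z - (x + a * I)) • W (x + a * I)
        = ∫ x : ℝ, coshKer α (z - (x + b * I)) • W (x + b * I) := by
    intro a b hab h1 h2 h3 h4
    rw [abs_lt] at h1 h2 h3 h4
    have hin : ∀ w : ℂ, a ≤ w.im → w.im ≤ b → |w.im| < Real.pi / 2 ∧ |(z - w).im| < Real.pi / 2 := by
      intro w hw1 hw2
      rw [abs_lt, abs_lt, sub_im]
      refine ⟨⟨?_, ?_⟩, ?_, ?_⟩ <;> linarith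
    obtain ⟨δ, hδ, hδ'⟩ : ∃ δ > 0, ∀ w : ℂ, a ≤ w.im → w.im ≤ b →
        |w.im| ≤ Real.pi / 2 - δ ∧ |(z - w).im| ≤ Real.pi / 2 - δ := by
      refine ⟨min (min (a + Real.pi / 2) (Real.pi / 2 - b))
        (min (Real.pi / 2 - (z.im - a)) (z.im - b + Real.pi / 2)), ?_, fun w hw1 hw2 ↦ ?_⟩
      · refine lt_min (lt_min ?_ ?_) (lt_min ?_ ?_) <;> linarith
      · set δ := min (min (a + Real.pi / 2) (Real.pi / 2 - b))
          (min (Real.pi / 2 - (z.im - a)) (z.im - b + Real.pi / 2))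
        have e1 : δ ≤ a + Real.pi / 2 := (min_le_left _ _).trans (min_le_left _ _)
        have e2 : δ ≤ Real.pi / 2 - b := (min_le_left _ _).trans (min_le_right _ _)
        have e3 : δ ≤ Real.pi / 2 - (z.im - a) := (min_le_right _ _).trans (min_le_left _ _)
        have e4 : δ ≤ z.im - b + Real.pi / 2 := (min_le_right _ _).trans (min_le_right _ _)
        rw [abs_le, abs_le, sub_im]
        refine ⟨⟨?_, ?_⟩, ?_, ?_⟩ <;> linarith
    obtain ⟨K, hK⟩ := hW.norm_coshKer_smul_le hα hδ
    refine integral_horizontal_line_eq (f := fun w ↦ coshKer α (z - w) • W w) hab one_pos ?_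
      (K := K * Real.exp (-α.re * |z.re|)) fun w hw1 hw2 ↦ hK z w (hδ' w hw1 hw2).1 (hδ' w hw1 hw2).2
    rintro w ⟨hw1, hw2⟩
    have hw := hin w hw1 hw2
    refine DifferentiableWithinAt.smul ?_ ?_
    · exact ((hasDerivAt_coshKer α hw.2).differentiableAt.comp (g := coshKer α) (f := fun w ↦ z - w) w
        (by fun_prop)).differentiableWithinAt
    · refine (hW.diff.differentiableAt (IsOpen.mem_nhds ?_ hw.1)).differentiableWithinAt
      exact isOpen_lt (by fun_prop) continuous_const
  have h1 : |z.im / 2| < Real.pi / 2 := by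
    have := abs_add_le (z.im - θ) θ
    rw [sub_add_cancel] at this
    rw [abs_div, abs_two]; linarith
  have h2 : |z.im - z.im / 2| < Real.pi / 2 := by rwa [sub_half]
  rw [coshConv]
  rcases le_total (z.im / 2) θ with h | h
  · exact key _ _ h h1 h2 hθ hz
  · exact (key _ _ h hθ hz h1 h2).symm

/-- Differentiation under the integral sign, on a fixed line of integration; the value of the
integral does not depend on that line. -/
theorem hasDerivAt_coshConv_integral {W : ℂ → E} (hW : IsRapid W) {α : ℂ} (hα : 0 < α.re) {z : ℂ}
    (hz : |z.im| < Real.pi) :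
    HasDerivAt (coshConv α W) (∫ x : ℝ,
      (-α * coshKer (α + 1) (z - (x + (z.im / 2 : ℝ) * I))
        * (2 * sinh (z - (x + (z.im / 2 : ℝ) * I)))) • W (x + (z.im / 2 : ℝ) * I)) z := by
  set θ := z.im / 2 with hθ
  have h1 : |θ| < Real.pi / 2 := by rw [hθ, abs_div, abs_two]; linarith
  have h2 : z.im - θ = θ := by rw [hθ]; ring
  set δ := (Real.pi / 2 - |θ|) / 2 with hδ
  have hδ0 : 0 < δ := by rw [hδ]; linarith
  have hin : ∀ v ∈ Metric.ball z δ, |v.im - θ| ≤ Real.pi / 2 - δ := by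
    intro v hv
    rw [Metric.mem_ball, Complex.dist_eq] at hv
    have h3 := (abs_im_le_norm (v - z)).trans hv.le
    rw [sub_im] at h3
    have h4 := abs_add_le (v.im - z.im) (z.im - θ)
    rw [sub_add_sub_cancel, h2] at h4
    linarith
  obtain ⟨K, hK⟩ := hW.norm_coshKer_smul_le hα hδ0
  have key := (hasDerivAt_integral_of_holomorphic (μ := volume)
    (F := fun v (x : ℝ) ↦ coshKer α (v - (x + θ * I)) • W (x + θ * I)) (z₀ := z)
    (s := Metric.ball z δ) (g := fun x ↦ |K| * Real.exp (-1 * |x|)) (Metric.ball_mem_nhds _ hδ0)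
    ((integrable_exp_neg_mul_abs one_pos).const_mul _) ?_ ?_ ?_).2
  · have hev : coshConv α W =ᶠ[𝓝 z] fun v ↦ ∫ x : ℝ, coshKer α (v - (x + θ * I)) • W (x + θ * I) := by
      filter_upwards [Metric.ball_mem_nhds z hδ0] with v hv
      exact coshConv_eq_integral hW hα h1 ((hin v hv).trans_lt (by linarith))
    refine (key.congr_of_eventuallyEq hev).congr_deriv ?_
    refine integral_congr_ae (Eventually.of_forall fun x ↦ ?_)
    refine HasDerivAt.deriv ?_
    have h5 : |(z - (x + θ * I)).im| < Real.pi / 2 := by simpa [h2] using h1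
    have := (hasDerivAt_coshKer α h5).comp z ((hasDerivAt_id z).sub_const (x + θ * I : ℂ))
    rw [mul_one] at this
    exact this.smul_const _
  · intro v hv
    exact (coshConv_integrand_continuous hW α v h1
      ((hin v hv).trans_lt (by linarith))).aestronglyMeasurable
  · refine Eventually.of_forall fun x v hv ↦ ?_
    have h5 : |(v - (x + θ * I)).im| < Real.pi / 2 := by
      simpa using (hin v hv).trans_lt (by linarith)
    have := (hasDerivAt_coshKer α h5).comp v ((hasDerivAt_id v).sub_const (x + θ * I : ℂ))
    exact (this.smul_const _).differentiableAt.differentiableWithinAt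
  · refine Eventually.of_forall fun x v hv ↦ ?_
    have := hK v (x + θ * I) (by simp; linarith) (by simpa using hin v hv)
    refine this.trans ?_
    simp only [add_re, ofReal_re, mul_re, I_re, mul_zero, ofReal_im, I_im, mul_one, sub_self,
      add_zero]
    refine mul_le_mul_of_nonneg_right ?_ (Real.exp_pos _).le
    calc K * Real.exp (-α.re * |v.re|) ≤ |K| * 1 := by
          refine mul_le_mul (le_abs_self K) ?_ (Real.exp_pos _).le (abs_nonneg _)
          rw [Real.exp_le_one_iff]
          nlinarith [abs_nonneg v.re]
      _ = |K| := mul_one _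

omit [CompleteSpace E] in
lemma integrable_coshConv {W : ℂ → E} (hW : IsRapid W) {α : ℂ} (hα : 0 < α.re) {z : ℂ} {θ : ℝ}
    (hθ : |θ| < Real.pi / 2) (hz : |z.im - θ| < Real.pi / 2) :
    Integrable fun x : ℝ ↦ coshKer α (z - (x + θ * I)) • W (x + θ * I) := by
  obtain ⟨K, hK⟩ := hW.norm_coshKer_smul_le hα
    (δ := min (Real.pi / 2 - |θ|) (Real.pi / 2 - |z.im - θ|)) (lt_min (by linarith) (by linarith))
  refine ((integrable_exp_neg_mul_abs one_pos).const_mul (K * Real.exp (-α.re * |z.re|))).mono'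
    (coshConv_integrand_continuous hW α z hθ hz).aestronglyMeasurable
    (Eventually.of_forall fun x ↦ ?_)
  have h1 := min_le_left (Real.pi / 2 - |θ|) (Real.pi / 2 - |z.im - θ|)
  have h2 := min_le_right (Real.pi / 2 - |θ|) (Real.pi / 2 - |z.im - θ|)
  simpa using hK z (x + θ * I) (by simp; linarith) (by simp; linarith)

/-- The derivative of `coshConv`, in the form that matches the derivative of the kernel
`(ζ² + y²)^{-s}` with respect to `ζ`. -/
theorem hasDerivAt_coshConv {W : ℂ → E} (hW : IsRapid W) {α : ℂ} (hα : 0 < α.re) {z : ℂ}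
    (hz : |z.im| < Real.pi) :
    HasDerivAt (coshConv α W) (α • coshConv α W z
      - (2 * α * exp z) • coshConv (α + 1) (fun w ↦ exp (-w) • W w) z) z := by
  have h1 : |z.im / 2| < Real.pi / 2 := by rw [abs_div, abs_two]; linarith
  have h2 : |z.im - z.im / 2| < Real.pi / 2 := by rwa [sub_half]
  have hα1 : 0 < (α + 1).re := by simp; linarith
  have hW' : IsRapid fun w ↦ exp (-w) • W w := by simpa using hW.exp_smul (-1)
  refine (hasDerivAt_coshConv_integral hW hα hz).congr_deriv ?_
  rw [coshConv, coshConv, ← integral_smul, ← integral_smul,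
    ← integral_sub (by exact (integrable_coshConv hW hα h1 h2).smul α)
      (by exact (integrable_coshConv hW' hα1 h1 h2).smul (2 * α * exp z))]
  refine integral_congr_ae (Eventually.of_forall fun x ↦ ?_)
  simp only [smul_smul, ← sub_smul]
  congr 1
  set w : ℂ := x + (z.im / 2 : ℝ) * I with hw
  have h3 : |(z - w).im| < Real.pi / 2 := by simpa [hw] using h2
  rw [coshKer_eq_mul (α := α) h3]
  have e : exp z * exp (-w) = cosh (z - w) + sinh (z - w) := by
    rw [cosh_add_sinh, ← exp_add, sub_eq_add_neg]
  linear_combination (2 * α * coshKer (α + 1) (z - w)) * e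

omit [CompleteSpace E] in
/-- The decay of the kernel passes to the convolution, uniformly on closed substrips. -/
theorem norm_coshConv_le {W : ℂ → E} (hW : IsRapid W) {α : ℂ} (hα : 0 < α.re) {δ : ℝ}
    (hδ : 0 < δ) : ∃ K, 0 ≤ K ∧ ∀ z : ℂ, |z.im| ≤ Real.pi - δ →
      ‖coshConv α W z‖ ≤ K * Real.exp (-α.re * |z.re|) := by
  obtain ⟨K, hK⟩ := hW.norm_coshKer_smul_le hα (half_pos hδ)
  refine ⟨|K| * ∫ x : ℝ, Real.exp (-1 * |x|), by positivity, fun z hz ↦ ?_⟩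
  have hz2 : |z.im / 2| ≤ Real.pi / 2 - δ / 2 := by rw [abs_div, abs_two]; linarith
  calc ‖coshConv α W z‖ ≤ ∫ x : ℝ, |K| * Real.exp (-α.re * |z.re|) * Real.exp (-1 * |x|) := by
        refine norm_integral_le_of_norm_le
          ((integrable_exp_neg_mul_abs one_pos).const_mul _) (Eventually.of_forall fun x ↦ ?_)
        have := hK z (x + (z.im / 2 : ℝ) * I) (by simpa using hz2) (by simpa [sub_half] using hz2)
        refine this.trans ?_
        simp only [add_re, ofReal_re, mul_re, I_re, mul_zero, ofReal_im, I_im, mul_one, sub_self,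
          add_zero]
        refine mul_le_mul_of_nonneg_right ?_ (Real.exp_pos _).le
        exact mul_le_mul_of_nonneg_right (le_abs_self K) (Real.exp_pos _).le
    _ = _ := by rw [integral_const_mul]; ring

/-- The kernel is even, so the convolution inherits a transformation law under `w ↦ -w`. -/
theorem coshConv_neg {W : ℂ → E} (hW : IsRapid W) {α : ℂ} (hα : 0 < α.re) (A : E →L[ℂ] E)
    (hA : ∀ w : ℂ, |w.im| < Real.pi / 2 → W (-w) = A (W w)) {z : ℂ} (hz : |z.im| < Real.pi) :
    coshConv α W (-z) = A (coshConv α W z) := by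
  have h1 : |z.im / 2| < Real.pi / 2 := by rw [abs_div, abs_two]; linarith
  have h2 : |z.im - z.im / 2| < Real.pi / 2 := by rwa [sub_half]
  rw [coshConv, coshConv, ← A.integral_comp_comm (integrable_coshConv hW hα h1 h2),
    ← integral_neg_eq_self]
  refine integral_congr_ae (Eventually.of_forall fun x ↦ ?_)
  have e1 : ((-x : ℝ) : ℂ) + ((-z).im / 2 : ℝ) * I = -(x + (z.im / 2 : ℝ) * I) := by
    push_cast [neg_im]; ring
  have e2 : -z - -(x + (z.im / 2 : ℝ) * I) = -(z - (x + (z.im / 2 : ℝ) * I)) := by ring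
  simp only [e1, e2, map_smul]
  rw [hA _ (by simpa using h1), coshKer, cosh_neg, ← coshKer]

end Strip

/-! ### The Abel transform -/

section Abel

variable {E : Type*} [NormedAddCommGroup E] [NormedSpace ℂ E]

lemma mul_cpow_of_arg {a b : ℂ} (c : ℂ) (ha : a ≠ 0) (hb : b ≠ 0)
    (h : a.arg + b.arg ∈ Set.Ioc (-Real.pi) Real.pi) : (a * b) ^ c = a ^ c * b ^ c := by
  rw [cpow_def_of_ne_zero (mul_ne_zero ha hb), cpow_def_of_ne_zero ha, cpow_def_of_ne_zero hb,
    log_mul ha hb h, add_mul, exp_add]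

lemma rpow_le_mul_exp {x σ κ : ℝ} (hx : 0 < x) (hσ : 0 < σ) (hκ : 0 < κ) :
    x ^ σ ≤ (σ / κ) ^ σ * Real.exp (κ * x) := by
  have h1 : x * (κ / σ) ≤ Real.exp (x * (κ / σ)) := by
    linarith [Real.add_one_le_exp (x * (κ / σ))]
  have h2 : x ≤ (σ / κ) * Real.exp (x * (κ / σ)) := by
    calc x = (σ / κ) * (x * (κ / σ)) := by field_simp
      _ ≤ _ := by gcongr
  calc x ^ σ ≤ ((σ / κ) * Real.exp (x * (κ / σ))) ^ σ := Real.rpow_le_rpow hx.le h2 hσ.le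
    _ = (σ / κ) ^ σ * Real.exp (κ * x) := by
      rw [Real.mul_rpow (by positivity) (Real.exp_pos _).le, ← Real.exp_mul]
      congr 2; field_simp

lemma integrableOn_abelWeight {σ κ : ℝ} (hσ : 0 < σ) (hκ : 0 < κ) :
    IntegrableOn (fun p : ℝ ↦ (p * (p + 2)) ^ (σ - 1) * Real.exp (-κ * p)) (Set.Ioi 0) := by
  have h1 := integrableOn_rpow_mul_exp_neg_mul_rpow (p := 1) (s := σ - 1) (b := κ / 2)
    (by linarith) one_pos (by linarith)
  refine Integrable.mono' (h1.const_mul ((σ / (κ / 2)) ^ σ * Real.exp κ)) ?_ ?_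
  · refine ContinuousOn.aestronglyMeasurable ?_ measurableSet_Ioi
    refine ContinuousOn.mul (ContinuousOn.rpow_const (by fun_prop) fun p hp ↦ Or.inl ?_)
      (by fun_prop)
    have : (0 : ℝ) < p := hp
    positivity
  · filter_upwards [ae_restrict_mem measurableSet_Ioi] with p hp
    have hp : (0 : ℝ) < p := hp
    rw [Real.norm_of_nonneg (by positivity), Real.mul_rpow hp.le (by linarith), Real.rpow_one]
    have h2 : (p + 2) ^ (σ - 1) ≤ (σ / (κ / 2)) ^ σ * Real.exp (κ / 2 * (p + 2)) :=
      (Real.rpow_le_rpow_of_exponent_le (by linarith) (by linarith)).trans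
        (rpow_le_mul_exp (by linarith) hσ (by linarith))
    calc p ^ (σ - 1) * (p + 2) ^ (σ - 1) * Real.exp (-κ * p)
        ≤ p ^ (σ - 1) * ((σ / (κ / 2)) ^ σ * Real.exp (κ / 2 * (p + 2))) * Real.exp (-κ * p) := by
          gcongr
      _ = (σ / (κ / 2)) ^ σ * p ^ (σ - 1)
          * (Real.exp (κ / 2 * (p + 2)) * Real.exp (-κ * p)) := by ring
      _ = (σ / (κ / 2)) ^ σ * p ^ (σ - 1) * (Real.exp κ * Real.exp (-(κ / 2) * p)) := by
          rw [← Real.exp_add, ← Real.exp_add]; ring_nf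
      _ = _ := by ring

/-- Holomorphic functions on the right half plane with exponential decay at infinity. -/
structure IsExpDecay (F : ℂ → E) : Prop where
  diff : DifferentiableOn ℂ F {q | 0 < q.re}
  decay : ∃ c : ℝ, 0 < c ∧ ∀ δ : ℝ, 0 < δ → ∃ C, ∀ q : ℂ, δ ≤ q.re → ‖F q‖ ≤ C * Real.exp (-c * q.re)

/-- The weight `(r² - 1)^{s-1}` in the variable `p = r - 1`. -/
def abelWeight (s : ℂ) (p : ℝ) : ℂ := ((p * (p + 2) : ℝ) : ℂ) ^ (s - 1)

/-- The Abel transform `y^s ∫₁^∞ (r² - 1)^{s-1} F(y r) dr`. -/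
def abel (s : ℂ) (F : ℂ → E) (y : ℂ) : E :=
  y ^ s • ∫ p in Set.Ioi (0 : ℝ), abelWeight s p • F (y * (1 + p))

lemma norm_abelWeight (s : ℂ) {p : ℝ} (hp : 0 < p) :
    ‖abelWeight s p‖ = (p * (p + 2)) ^ (s.re - 1) := by
  rw [abelWeight, norm_cpow_eq_rpow_re_of_pos (by positivity)]; simp

lemma continuousOn_abelWeight (s : ℂ) : ContinuousOn (abelWeight s) (Set.Ioi 0) := by
  intro p hp
  have hp : (0 : ℝ) < p := hp
  refine ContinuousAt.continuousWithinAt ?_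
  refine ContinuousAt.cpow ?_ continuousAt_const (Or.inl ?_)
  · fun_prop
  · rw [ofReal_re]; positivity

lemma re_mul_one_add (y : ℂ) (p : ℝ) : (y * (1 + p)).re = y.re * (1 + p) := by
  have : (1 + p : ℂ) = ((1 + p : ℝ) : ℂ) := by push_cast; rfl
  rw [this, re_mul_ofReal]

lemma IsExpDecay.norm_abel_integrand_le {F : ℂ → E} (hF : IsExpDecay F) (s : ℂ) :
    ∃ c > 0, ∀ δ : ℝ, 0 < δ → ∃ C, 0 ≤ C ∧ ∀ (y : ℂ) (p : ℝ), δ ≤ y.re → 0 < p →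
      ‖abelWeight s p • F (y * (1 + p))‖
        ≤ C * Real.exp (-c * y.re) * ((p * (p + 2)) ^ (s.re - 1) * Real.exp (-(c * δ) * p)) := by
  obtain ⟨c, hc, h⟩ := hF.decay
  refine ⟨c, hc, fun δ hδ ↦ ?_⟩
  obtain ⟨C, hC⟩ := h δ hδ
  refine ⟨|C|, abs_nonneg _, fun y p hy hp ↦ ?_⟩
  rw [norm_smul, norm_abelWeight s hp]
  have h1 : δ ≤ (y * (1 + p)).re := by rw [re_mul_one_add]; nlinarith
  have h2 : ‖F (y * (1 + p))‖ ≤ |C| * (Real.exp (-c * y.re) * Real.exp (-(c * δ) * p)) := by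
    refine (hC _ h1).trans (mul_le_mul (le_abs_self _) ?_ (Real.exp_pos _).le (abs_nonneg _))
    rw [← Real.exp_add, re_mul_one_add]
    refine Real.exp_le_exp.2 ?_
    have : c * δ * p ≤ c * y.re * p := by gcongr
    linarith
  calc _ ≤ (p * (p + 2)) ^ (s.re - 1)
        * (|C| * (Real.exp (-c * y.re) * Real.exp (-(c * δ) * p))) := by gcongr
    _ = _ := by ring

lemma aestronglyMeasurable_abel_integrand {F : ℂ → E} (hF : IsExpDecay F) (s : ℂ) {y : ℂ}
    (hy : 0 < y.re) : AEStronglyMeasurable (fun p : ℝ ↦ abelWeight s p • F (y * (1 + p)))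
      (volume.restrict (Set.Ioi 0)) := by
  refine ContinuousOn.aestronglyMeasurable ?_ measurableSet_Ioi
  refine (continuousOn_abelWeight s).smul (hF.diff.continuousOn.comp (by fun_prop) fun p hp ↦ ?_)
  have hp : (0 : ℝ) < p := hp
  change 0 < (y * (1 + p)).re
  rw [re_mul_one_add]; positivity

/-- Abel transforms decay exponentially at infinity as well. -/
lemma IsExpDecay.norm_abel_le {F : ℂ → E} (hF : IsExpDecay F) {s : ℂ} (hs : 0 < s.re) :
    ∃ c > 0, ∀ δ : ℝ, 0 < δ → ∃ C, 0 ≤ C ∧ ∀ y : ℂ, δ ≤ y.re →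
      ‖abel s F y‖ ≤ C * (‖y‖ ^ s.re * Real.exp (-c * y.re)) := by
  obtain ⟨c, hc, h⟩ := hF.norm_abel_integrand_le s
  refine ⟨c, hc, fun δ hδ ↦ ?_⟩
  obtain ⟨C, hC0, hC⟩ := h δ hδ
  set J := ∫ p in Set.Ioi (0 : ℝ), (p * (p + 2)) ^ (s.re - 1) * Real.exp (-(c * δ) * p) with hJ
  have hJ0 : 0 ≤ J := setIntegral_nonneg measurableSet_Ioi fun p hp ↦ by
    have hp : (0 : ℝ) < p := hp
    positivity
  refine ⟨Real.exp (Real.pi * |s.im|) * (C * J), by positivity, fun y hy ↦ ?_⟩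
  have hy0 : 0 < y.re := hδ.trans_le hy
  rw [abel, norm_smul]
  have h1 : ‖y ^ s‖ ≤ ‖y‖ ^ s.re * Real.exp (Real.pi * |s.im|) := by
    refine (norm_cpow_le _ _).trans ?_
    rw [div_eq_mul_inv, ← Real.exp_neg]
    refine mul_le_mul_of_nonneg_left (Real.exp_le_exp.2 ?_) (by positivity)
    refine (neg_le_abs _).trans ?_
    rw [abs_mul]
    exact mul_le_mul_of_nonneg_right (abs_arg_le_pi _) (abs_nonneg _)
  have h2 : ‖∫ p in Set.Ioi (0 : ℝ), abelWeight s p • F (y * (1 + p))‖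
      ≤ C * Real.exp (-c * y.re) * J := by
    rw [hJ, ← integral_const_mul]
    refine norm_integral_le_of_norm_le
      ((integrableOn_abelWeight hs (mul_pos hc hδ)).const_mul _) ?_
    filter_upwards [ae_restrict_mem measurableSet_Ioi] with p hp using hC y p hy hp
  calc _ ≤ (‖y‖ ^ s.re * Real.exp (Real.pi * |s.im|)) * (C * Real.exp (-c * y.re) * J) := by gcongr
    _ = _ := by ring

lemma differentiableOn_abel [CompleteSpace E] {F : ℂ → E} (hF : IsExpDecay F) {s : ℂ}
    (hs : 0 < s.re) : DifferentiableOn ℂ (abel s F) {y | 0 < y.re} := by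
  intro y hy
  have hy : 0 < y.re := hy
  obtain ⟨c, hc, h⟩ := hF.norm_abel_integrand_le s
  obtain ⟨C, hC0, hC⟩ := h (y.re / 2) (by linarith)
  have hopen : {v : ℂ | y.re / 2 < v.re} ∈ 𝓝 y :=
    (isOpen_lt continuous_const continuous_re).mem_nhds (by simp; linarith)
  refine DifferentiableAt.differentiableWithinAt (DifferentiableAt.smul ?_ ?_)
  · exact differentiableAt_id.cpow_const (Or.inl hy)
  · refine (hasDerivAt_integral_of_holomorphic (s := {v : ℂ | y.re / 2 < v.re})
      (F := fun y (p : ℝ) ↦ abelWeight s p • F (y * (1 + p))) hopen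
      ((integrableOn_abelWeight hs (mul_pos hc (half_pos hy))).const_mul C) ?_ ?_ ?_).2.differentiableAt
    · intro v hv
      exact aestronglyMeasurable_abel_integrand hF s (lt_trans (half_pos hy) hv)
    · filter_upwards [ae_restrict_mem measurableSet_Ioi] with p hp v hv
      have hp : (0 : ℝ) < p := hp
      have hv : y.re / 2 < v.re := hv
      refine DifferentiableAt.differentiableWithinAt (DifferentiableAt.const_smul ?_ _)
      refine DifferentiableAt.comp (g := F) (f := fun v : ℂ ↦ v * (1 + p)) v ?_ (by fun_prop)
      refine hF.diff.differentiableAt ((isOpen_lt continuous_const continuous_re).mem_nhds ?_)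
      change 0 < (v * (1 + p)).re
      rw [re_mul_one_add]
      have : 0 < v.re := by linarith
      positivity
    · filter_upwards [ae_restrict_mem measurableSet_Ioi] with p hp v hv
      have hp : (0 : ℝ) < p := hp
      have hv : y.re / 2 < v.re := hv
      refine (hC v p hv.le hp).trans ?_
      refine mul_le_mul_of_nonneg_right ?_ (by positivity)
      refine mul_le_of_le_one_right hC0 (Real.exp_le_one_iff.2 ?_)
      nlinarith

/-- The Abel transform at a positive real number, with `q = y (1 + p)` as variable of
integration. -/
lemma abel_ofReal (s : ℂ) (F : ℂ → E) {y : ℝ} (hy : 0 < y) :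
    (y : ℂ) ^ s • abel s F y
      = (y : ℂ) • ∫ q in Set.Ioi y, ((q ^ 2 - y ^ 2 : ℝ) : ℂ) ^ (s - 1) • F q := by
  have hyc : (y : ℂ) ≠ 0 := by exact_mod_cast hy.ne'
  have h1 : ∫ q in Set.Ioi y, ((q ^ 2 - y ^ 2 : ℝ) : ℂ) ^ (s - 1) • F q
      = ∫ r in Set.Ioi (0 : ℝ), (((y + r) ^ 2 - y ^ 2 : ℝ) : ℂ) ^ (s - 1) • F ((y + r : ℝ) : ℂ) := by
    have := (measurePreserving_add_left volume y).setIntegral_preimage_emb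
      (measurableEmbedding_addLeft y)
      (fun q : ℝ ↦ ((q ^ 2 - y ^ 2 : ℝ) : ℂ) ^ (s - 1) • F q) (Set.Ioi y)
    rw [← this]
    congr 2
    ext r; simp
  have h2 := integral_comp_mul_left_Ioi' (fun r : ℝ ↦ (((y + r) ^ 2 - y ^ 2 : ℝ) : ℂ) ^ (s - 1)
    • F ((y + r : ℝ) : ℂ)) 0 hy
  rw [mul_zero] at h2
  rw [h1, ← h2, abel, ← Complex.coe_smul, smul_smul, smul_smul, ← integral_smul, ← integral_smul]
  refine setIntegral_congr_fun measurableSet_Ioi fun p hp ↦ ?_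
  have hp : (0 : ℝ) < p := hp
  have e1 : ((y + y * p : ℝ) : ℂ) = y * (1 + p) := by push_cast; ring
  have e2 : (y + y * p) ^ 2 - y ^ 2 = (y ^ 2) * (p * (p + 2)) := by ring
  simp only [e1, smul_smul, abelWeight, e2]
  congr 1
  rw [ofReal_mul (y ^ 2), mul_cpow_ofReal_nonneg (by positivity) (by positivity), ← mul_assoc]
  congr 1
  have e3 : ((y ^ 2 : ℝ) : ℂ) ^ (s - 1) = (y : ℂ) ^ (s - 1) * (y : ℂ) ^ (s - 1) := by
    rw [sq, ofReal_mul, mul_cpow_ofReal_nonneg hy.le hy.le]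
  rw [e3, cpow_sub _ _ hyc, cpow_one]
  field_simp

end Abel

/-! ### The transform of an Abel transform over the positive half line -/

section Jump

variable {E : Type*} [NormedAddCommGroup E] [NormedSpace ℂ E]

lemma norm_cpow_le_mul_exp (z s : ℂ) : ‖z ^ s‖ ≤ ‖z‖ ^ s.re * Real.exp (Real.pi * |s.im|) := by
  refine (norm_cpow_le _ _).trans ?_
  rw [div_eq_mul_inv, ← Real.exp_neg]
  refine mul_le_mul_of_nonneg_left (Real.exp_le_exp.2 ?_) (by positivity)
  refine (neg_le_abs _).trans ?_
  rw [abs_mul]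
  exact mul_le_mul_of_nonneg_right (abs_arg_le_pi _) (abs_nonneg _)

/-- The transform `2 s ∫₀^∞ ζ y^s (ζ² + y²)^{-s-1} U(y) dy`, continued from the right half plane
to the plane cut along the negative real axis, in terms of `W(w) = U(exp w)`. -/
def rayTransform (s : ℂ) (W : ℂ → E) (ζ : ℂ) : E :=
  (2 * s * ζ ^ (-s)) • coshConv (s + 1) W (log ζ)

lemma abs_log_im_lt {ζ : ℂ} (hζ : ζ ∈ slitPlane) : |(log ζ).im| < Real.pi := by
  rw [log_im, abs_lt]
  exact ⟨neg_pi_lt_arg ζ, (arg_le_pi ζ).lt_of_ne (mem_slitPlane_iff_arg.1 hζ).1⟩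

lemma differentiableOn_rayTransform [CompleteSpace E] {s : ℂ} (hs : 0 < s.re) {W : ℂ → E}
    (hW : IsRapid W) : DifferentiableOn ℂ (rayTransform s W) slitPlane := by
  intro ζ hζ
  refine DifferentiableAt.differentiableWithinAt (DifferentiableAt.smul ?_ ?_)
  · exact (differentiableAt_id.cpow_const hζ).const_mul _
  · exact (hasDerivAt_coshConv hW (by simp; linarith) (abs_log_im_lt hζ)).differentiableAt.comp ζ
      (differentiableAt_log hζ)

lemma sq_add_sq_mem_slitPlane {ζ : ℂ} (hζ : 0 < ζ.re) (y : ℝ) : ζ ^ 2 + (y : ℂ) ^ 2 ∈ slitPlane := by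
  rcases eq_or_ne ζ.im 0 with h | h
  · left
    simp only [sq, add_re, mul_re, h, ofReal_re, ofReal_im]
    nlinarith [mul_self_nonneg y, mul_pos hζ hζ]
  · right
    simp only [sq, add_im, mul_im, ofReal_re, ofReal_im]
    have := mul_ne_zero hζ.ne' h
    intro h2
    apply this
    linarith

lemma sq_re_le_norm {ζ : ℂ} (hζ : 0 < ζ.re) (y : ℝ) : ζ.re ^ 2 ≤ ‖ζ ^ 2 + (y : ℂ) ^ 2‖ := by
  have e : ζ ^ 2 + (y : ℂ) ^ 2 = (ζ + y * I) * (ζ - y * I) := by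
    linear_combination ((y : ℂ) ^ 2) * I_sq
  rw [e, norm_mul, sq]
  refine mul_le_mul ?_ ?_ hζ.le (norm_nonneg _)
  · simpa using re_le_norm (ζ + y * I)
  · simpa using re_le_norm (ζ - y * I)

/-- The kernel `coshKer` in the multiplicative coordinates `ζ` and `y = e^x`. -/
lemma kernel_eq {s ζ : ℂ} (hζ : 0 < ζ.re) (x : ℝ) :
    ζ ^ (-s) * coshKer (s + 1) (log ζ - x)
      = Real.exp x * (ζ * ((Real.exp x : ℝ) : ℂ) ^ s
        * (ζ ^ 2 + ((Real.exp x : ℝ) : ℂ) ^ 2) ^ (-s - 1)) := by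
  set y := Real.exp x with hy
  have hy0 : 0 < y := Real.exp_pos x
  have hyc : (y : ℂ) ≠ 0 := by exact_mod_cast hy0.ne'
  have hζ0 : ζ ≠ 0 := by rintro rfl; simp at hζ
  have harg : |ζ.arg| < Real.pi / 2 := abs_arg_lt_pi_div_two_iff.2 (Or.inl hζ)
  have him : |(log ζ - x).im| < Real.pi / 2 := by simpa [log_im] using harg
  set c := 2 * cosh (log ζ - x) with hc
  have hcre : 0 < c.re := by
    refine lt_of_lt_of_le ?_ (sin_mul_exp_le_re (δ := Real.pi / 2 - |(log ζ - x).im|)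
      (by linarith) (by linarith))
    refine mul_pos (Real.sin_pos_of_pos_of_lt_pi (by linarith) ?_) (Real.exp_pos _)
    linarith [abs_nonneg (log ζ - x).im, Real.pi_pos]
  have hc0 : c ≠ 0 := by rintro h; simp [h] at hcre
  have hcarg : |c.arg| < Real.pi / 2 := abs_arg_lt_pi_div_two_iff.2 (Or.inl hcre)
  have hc2 : c = ζ / y + y / ζ := by
    rw [hc, cosh, mul_div_cancel₀ _ two_ne_zero, neg_sub, exp_sub, exp_sub, exp_log hζ0, hy,
      ofReal_exp]
  have e : ζ ^ 2 + (y : ℂ) ^ 2 = ζ * (y * c) := by rw [hc2]; field_simp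
  have hyarg : (y : ℂ).arg = 0 := arg_ofReal_of_nonneg hy0.le
  rw [abs_lt] at harg hcarg
  have e1 : ((y : ℂ) * c) ^ (-s - 1) = (y : ℂ) ^ (-s - 1) * c ^ (-s - 1) :=
    mul_cpow_of_arg _ hyc hc0 (by rw [hyarg]; constructor <;> linarith)
  have e2 : (ζ * (y * c)) ^ (-s - 1) = ζ ^ (-s - 1) * (y * c) ^ (-s - 1) := by
    refine mul_cpow_of_arg _ hζ0 (mul_ne_zero hyc hc0) ?_
    rw [arg_real_mul _ hy0]; constructor <;> linarith
  rw [e, e2, e1, coshKer, ← hc, neg_add, ← sub_eq_add_neg, cpow_sub (-s) 1 hζ0,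
    cpow_sub (-s) 1 hyc, cpow_one, cpow_one, cpow_neg (y : ℂ)]
  have : (y : ℂ) ^ s ≠ 0 := by simp [cpow_eq_zero_iff, hyc]
  field_simp

lemma IsRapid.continuousOn_ofReal {U : ℂ → E} (hU : IsRapid fun w ↦ U (exp w)) :
    ContinuousOn (fun y : ℝ ↦ U y) (Set.Ioi 0) := by
  have h1 : Continuous fun x : ℝ ↦ U (exp x) :=
    hU.diff.continuousOn.comp_continuous (by fun_prop) fun x ↦ by simp [Real.pi_pos]
  have h2 : ContinuousOn (fun y : ℝ ↦ U (exp (Real.log y : ℝ))) (Set.Ioi 0) :=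
    h1.comp_continuousOn (Real.continuousOn_log.mono fun y hy ↦ ne_of_gt hy)
  refine h2.congr fun y hy ↦ ?_
  change U y = U (exp (Real.log y : ℝ))
  rw [← ofReal_exp, Real.exp_log hy]

/-- The kernel of `rayTransform` on the right half plane. -/
def rayKer (s ζ : ℂ) (y : ℝ) : ℂ := 2 * s * (ζ * (y : ℂ) ^ s * (ζ ^ 2 + (y : ℂ) ^ 2) ^ (-s - 1))

lemma continuousOn_rayKer {s ζ : ℂ} (hζ : 0 < ζ.re) : ContinuousOn (rayKer s ζ) (Set.Ioi 0) := by
  intro y hy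
  have hy : (0 : ℝ) < y := hy
  refine ContinuousAt.continuousWithinAt ?_
  refine continuousAt_const.mul ((continuousAt_const.mul ?_).mul ?_)
  · exact continuousAt_ofReal_cpow_const _ _ (Or.inr hy.ne')
  · exact ContinuousAt.cpow (by fun_prop) continuousAt_const (sq_add_sq_mem_slitPlane hζ y)

/-- On the right half plane the line of integration can be moved to the real axis. -/
theorem rayTransform_eq_integral [CompleteSpace E] {s : ℂ} (hs : 0 < s.re) {U : ℂ → E}
    (hU : IsRapid fun w ↦ U (exp w)) {ζ : ℂ} (hζ : 0 < ζ.re) :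
    IntegrableOn (fun y : ℝ ↦ rayKer s ζ y • U y) (Set.Ioi 0) ∧
    rayTransform s (fun w ↦ U (exp w)) ζ = ∫ y in Set.Ioi (0 : ℝ), rayKer s ζ y • U y := by
  have harg : |ζ.arg| < Real.pi / 2 := abs_arg_lt_pi_div_two_iff.2 (Or.inl hζ)
  have hs1 : 0 < (s + 1).re := by simp; linarith
  have h1 := integrable_coshConv hU hs1 (z := log ζ) (θ := 0) (by simp [Real.pi_pos])
    (by simpa [log_im] using harg)
  have h2 := coshConv_eq_integral hU hs1 (z := log ζ) (θ := 0) (by simp [Real.pi_pos])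
    (by simpa [log_im] using harg)
  simp only [ofReal_zero, zero_mul, add_zero] at h1 h2
  have hpt : ∀ x : ℝ, (2 * s * ζ ^ (-s)) • coshKer (s + 1) (log ζ - x) • U (exp x)
      = |Real.exp x| • (rayKer s ζ (Real.exp x) • U (Real.exp x : ℝ)) := by
    intro x
    rw [abs_of_pos (Real.exp_pos x), smul_smul, ← Complex.coe_smul, smul_smul, ofReal_exp, mul_assoc,
      kernel_eq hζ, rayKer]
    congr 1
    push_cast; ring
  have himg : Real.exp '' Set.univ = Set.Ioi 0 := by rw [Set.image_univ, Real.range_exp]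
  constructor
  · rw [← himg, integrableOn_image_iff_integrableOn_abs_deriv_smul MeasurableSet.univ
      (fun x _ ↦ (Real.hasDerivAt_exp x).hasDerivWithinAt) (Real.exp_injective.injOn)]
    rw [integrableOn_univ]
    refine (h1.smul (2 * s * ζ ^ (-s))).congr (Eventually.of_forall fun x ↦ hpt x)
  · rw [← himg, integral_image_eq_integral_abs_deriv_smul MeasurableSet.univ
      (fun x _ ↦ (Real.hasDerivAt_exp x).hasDerivWithinAt) (Real.exp_injective.injOn),
      setIntegral_univ, rayTransform, h2, ← integral_smul]
    exact integral_congr_ae (Eventually.of_forall fun x ↦ hpt x)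

lemma IsExpDecay.norm_sq_sub_one_rpow_mul_le {F : ℂ → E} (hF : IsExpDecay F) {σ : ℝ} (hσ : 0 < σ) :
    ∃ c > 0, ∃ C, 0 ≤ C ∧ ∀ q : ℝ, 1 < q → (q ^ 2 - 1) ^ σ * ‖F q‖ ≤ C * Real.exp (-c * q) := by
  obtain ⟨c, hc, h⟩ := hF.decay
  obtain ⟨C, hC⟩ := h 1 one_pos
  refine ⟨c / 2, by linarith, (2 * σ / (c / 2)) ^ (2 * σ) * |C|, by positivity, fun q hq ↦ ?_⟩
  have h1 : (q ^ 2 - 1) ^ σ ≤ (2 * σ / (c / 2)) ^ (2 * σ) * Real.exp (c / 2 * q) := by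
    refine le_trans ?_ (rpow_le_mul_exp (by linarith) (by linarith) (by linarith))
    rw [Real.rpow_mul (by linarith), Real.rpow_two]
    exact Real.rpow_le_rpow (by nlinarith) (by linarith) hσ.le
  have h2 : ‖F q‖ ≤ |C| * Real.exp (-c * q) := by
    refine (hC q (by simpa using hq.le)).trans ?_
    rw [ofReal_re]
    exact mul_le_mul_of_nonneg_right (le_abs_self _) (Real.exp_pos _).le
  calc _ ≤ ((2 * σ / (c / 2)) ^ (2 * σ) * Real.exp (c / 2 * q)) * (|C| * Real.exp (-c * q)) :=
        mul_le_mul h1 h2 (norm_nonneg _) (by positivity)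
    _ = (2 * σ / (c / 2)) ^ (2 * σ) * |C| * (Real.exp (c / 2 * q) * Real.exp (-c * q)) := by ring
    _ = _ := by rw [← Real.exp_add]; ring_nf

/-- The inner integral in the computation of the transform of an Abel transform. The integrand has
an elementary antiderivative, which is what turns the kernel into a Cauchy kernel. -/
lemma integral_Ioc_rayKer_mul_abelKer {s ζ : ℂ} (hs : 0 < s.re) (hζ : 0 < ζ.re) {q : ℝ} (hq : 1 < q) :
    (∫ y in (1 : ℝ)..q, y * (q ^ 2 - y ^ 2) ^ (s.re - 1) = (q ^ 2 - 1) ^ s.re / (2 * s.re) ∧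
      IntervalIntegrable (fun y : ℝ ↦ y * (q ^ 2 - y ^ 2) ^ (s.re - 1)) volume 1 q) ∧
    IntervalIntegrable (fun y : ℝ ↦ 2 * s * y * (ζ ^ 2 + (y : ℂ) ^ 2) ^ (-s - 1)
      * ((q ^ 2 - y ^ 2 : ℝ) : ℂ) ^ (s - 1)) volume 1 q ∧
    ∫ y in (1 : ℝ)..q, 2 * s * y * (ζ ^ 2 + (y : ℂ) ^ 2) ^ (-s - 1)
      * ((q ^ 2 - y ^ 2 : ℝ) : ℂ) ^ (s - 1)
      = ((q ^ 2 - 1 : ℝ) : ℂ) ^ s * (ζ ^ 2 + 1) ^ (-s) / (ζ ^ 2 + (q : ℂ) ^ 2) := by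
  have hpos : ∀ y ∈ Set.Ioo 1 q, 0 < q ^ 2 - y ^ 2 := fun y hy ↦ by nlinarith [hy.1, hy.2]
  have hs0 : s.re ≠ 0 := hs.ne'
  have hs0' : s ≠ 0 := by rintro rfl; simp at hs
  have hcontR : ContinuousOn (fun y : ℝ ↦ -((q ^ 2 - y ^ 2) ^ s.re / (2 * s.re))) (Set.Icc 1 q) := by
    refine ((ContinuousOn.rpow_const (by fun_prop) fun y _ ↦ Or.inr hs.le).div_const _).neg
  have hderR : ∀ y ∈ Set.Ioo 1 q, HasDerivAt (fun y : ℝ ↦ -((q ^ 2 - y ^ 2) ^ s.re / (2 * s.re)))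
      (y * (q ^ 2 - y ^ 2) ^ (s.re - 1)) y := by
    intro y hy
    have h1 : HasDerivAt (fun y : ℝ ↦ q ^ 2 - y ^ 2) (-(2 * y)) y := by
      simpa using (hasDerivAt_pow 2 y).const_sub (q ^ 2)
    have := ((h1.rpow_const (p := s.re) (Or.inl (hpos y hy).ne')).div_const (2 * s.re)).neg
    refine this.congr_deriv ?_
    field_simp
  have hintR : IntervalIntegrable (fun y : ℝ ↦ y * (q ^ 2 - y ^ 2) ^ (s.re - 1)) volume 1 q := by
    refine intervalIntegral.intervalIntegrable_deriv_of_nonneg (by rwa [Set.uIcc_of_le hq.le])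
      (by rwa [min_eq_left hq.le, max_eq_right hq.le]) ?_
    rw [min_eq_left hq.le, max_eq_right hq.le]
    intro y hy
    have := (hpos y hy).le
    have := hy.1
    positivity
  refine ⟨⟨?_, hintR⟩, ?_⟩
  · rw [intervalIntegral.integral_eq_sub_of_hasDerivAt_of_le hq.le hcontR hderR hintR]
    simp [Real.zero_rpow hs0]
  have hslit : ∀ y : ℝ, ζ ^ 2 + (y : ℂ) ^ 2 ∈ slitPlane := sq_add_sq_mem_slitPlane hζ
  have hintC : IntervalIntegrable (fun y : ℝ ↦ 2 * s * y * (ζ ^ 2 + (y : ℂ) ^ 2) ^ (-s - 1)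
      * ((q ^ 2 - y ^ 2 : ℝ) : ℂ) ^ (s - 1)) volume 1 q := by
    have hc1 : Continuous fun y : ℝ ↦ 2 * s * (ζ ^ 2 + (y : ℂ) ^ 2) ^ (-s - 1) :=
      continuous_const.mul (Continuous.cpow (by fun_prop) continuous_const fun y ↦ hslit y)
    have h2 : IntervalIntegrable (fun y : ℝ ↦ ((y : ℝ) : ℂ)
        * ((q ^ 2 - y ^ 2 : ℝ) : ℂ) ^ (s - 1)) volume 1 q := by
      rw [intervalIntegrable_iff_integrableOn_Ioo_of_le hq.le] at hintR ⊢
      refine Integrable.mono' hintR ?_ ?_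
      · refine ContinuousOn.aestronglyMeasurable (fun y hy ↦ ContinuousAt.continuousWithinAt ?_)
          measurableSet_Ioo
        exact ContinuousAt.mul (by fun_prop) (ContinuousAt.cpow (by fun_prop) continuousAt_const
          (Or.inl (by rw [ofReal_re]; exact hpos y hy)))
      · filter_upwards [ae_restrict_mem measurableSet_Ioo] with y hy
        rw [norm_mul, norm_cpow_eq_rpow_re_of_pos (hpos y hy), norm_real,
          Real.norm_of_nonneg (by linarith [hy.1])]
        simp
    refine (h2.continuousOn_mul hc1.continuousOn).congr ?_
    intro y _
    simp only; ring
  refine ⟨hintC, ?_⟩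
  have hne : ∀ y : ℝ, ζ ^ 2 + (y : ℂ) ^ 2 ≠ 0 := fun y ↦ slitPlane_ne_zero (hslit y)
  have key := intervalIntegral.integral_eq_sub_of_hasDerivAt_of_le hq.le
    (f := fun y : ℝ ↦ -(((q ^ 2 - y ^ 2 : ℝ) : ℂ) ^ s * (ζ ^ 2 + (y : ℂ) ^ 2) ^ (-s)
      / (ζ ^ 2 + (q : ℂ) ^ 2))) ?_ ?_ hintC
  · rw [key]
    simp [zero_cpow hs0']
  · refine ((ContinuousOn.mul ?_ ?_).div_const _).neg
    · refine ContinuousOn.comp (t := Set.univ) (g := fun x : ℝ ↦ (x : ℂ) ^ s)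
        (f := fun y : ℝ ↦ q ^ 2 - y ^ 2) (Continuous.continuousOn ?_) (by fun_prop)
        (Set.mapsTo_univ _ _)
      exact continuous_iff_continuousAt.2 fun x ↦ continuousAt_ofReal_cpow_const _ _ (Or.inl hs)
    · exact (Continuous.cpow (by fun_prop) continuous_const fun y ↦ hslit y).continuousOn
  · intro y hy
    have h1 : HasDerivAt (fun y : ℝ ↦ ((q ^ 2 - y ^ 2 : ℝ) : ℂ)) (-(2 * y)) y := by
      have := ((hasDerivAt_pow 2 y).const_sub (q ^ 2)).ofReal_comp
      simpa using this
    have h2 : HasDerivAt (fun y : ℝ ↦ ζ ^ 2 + (y : ℂ) ^ 2) (2 * y) y := by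
      have := ((hasDerivAt_pow 2 y).ofReal_comp).const_add (ζ ^ 2)
      simpa using this
    have hp : ((q ^ 2 - y ^ 2 : ℝ) : ℂ) ≠ 0 := by exact_mod_cast (hpos y hy).ne'
    have h3 := ((hasDerivAt_id ((q ^ 2 - y ^ 2 : ℝ) : ℂ)).cpow_const (c := s)
      (Or.inl (by rw [id_eq, ofReal_re]; exact hpos y hy))).scomp y h1
    have h4 := ((hasDerivAt_id (ζ ^ 2 + (y : ℂ) ^ 2)).cpow_const (c := -s) (hslit y)).scomp y h2
    have h5 := ((h3.mul h4).div_const (ζ ^ 2 + (q : ℂ) ^ 2)).neg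
    refine h5.congr_deriv ?_
    have e1 : ((q ^ 2 - y ^ 2 : ℝ) : ℂ) ^ s
        = ((q ^ 2 - y ^ 2 : ℝ) : ℂ) ^ (s - 1) * ((q ^ 2 - y ^ 2 : ℝ) : ℂ) := by
      rw [cpow_sub _ _ hp, cpow_one, div_mul_cancel₀ _ hp]
    have e2 : (ζ ^ 2 + (y : ℂ) ^ 2) ^ (-s)
        = (ζ ^ 2 + (y : ℂ) ^ 2) ^ (-s - 1) * (ζ ^ 2 + (y : ℂ) ^ 2) := by
      rw [cpow_sub _ _ (hne y), cpow_one, div_mul_cancel₀ _ (hne y)]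
    simp only [Function.comp_apply, id_eq, smul_eq_mul]
    rw [e1, e2]
    have := hne q
    field_simp
    push_cast
    ring

end Jump

/-! ### Boundary values on the imaginary axis -/

section JumpFormula

variable {E : Type*} [NormedAddCommGroup E] [NormedSpace ℂ E] [CompleteSpace E]

/-- The transform of an Abel transform over `(1, ∞)` is a Cauchy integral. -/
theorem integral_Ioi_rayKer_smul_abel {s ζ : ℂ} (hs : 0 < s.re) (hζ : 0 < ζ.re) {F : ℂ → E} (hF : IsExpDecay F) :
    ∫ y in Set.Ioi (1 : ℝ), rayKer s ζ y • abel s F y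
      = (ζ * (ζ ^ 2 + 1) ^ (-s)) • ∫ q in Set.Ioi (1 : ℝ),
        (((q ^ 2 - 1 : ℝ) : ℂ) ^ s / (ζ ^ 2 + (q : ℂ) ^ 2)) • F q := by
  set k : ℝ → ℝ → ℂ := fun y q ↦ 2 * s * y * (ζ ^ 2 + (y : ℂ) ^ 2) ^ (-s - 1)
      * ((q ^ 2 - y ^ 2 : ℝ) : ℂ) ^ (s - 1) with hk
  set T : Set (ℝ × ℝ) := {x | 1 < x.1 ∧ x.1 < x.2} with hT
  have hTo : IsOpen T := (isOpen_lt continuous_const continuous_fst).inter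
    (isOpen_lt continuous_fst continuous_snd)
  set f : ℝ × ℝ → E := T.indicator fun x ↦ k x.1 x.2 • F x.2 with hf
  have hσ0 : s.re ≠ 0 := hs.ne'
  -- Fubini on the domain `1 < y < q`; the integral over `y` is elementary.
  have hfm : AEStronglyMeasurable f (volume.prod volume) := by
    rw [hf, aestronglyMeasurable_indicator_iff hTo.measurableSet]
    refine ContinuousOn.aestronglyMeasurable (fun x hx ↦ ContinuousAt.continuousWithinAt ?_)
      hTo.measurableSet
    have hx2 : 0 < x.2 := by linarith [hx.1, hx.2]
    refine ContinuousAt.smul ?_ ?_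
    · refine ContinuousAt.mul (ContinuousAt.mul (by fun_prop) ?_) ?_
      · exact ContinuousAt.cpow (by fun_prop) continuousAt_const (sq_add_sq_mem_slitPlane hζ _)
      · refine ContinuousAt.cpow (by fun_prop) continuousAt_const (Or.inl ?_)
        rw [ofReal_re]
        nlinarith [hx.1, hx.2]
    · refine ContinuousAt.comp (g := F) (f := fun x : ℝ × ℝ ↦ (x.2 : ℂ)) ?_ (by fun_prop)
      exact (hF.diff.differentiableAt ((isOpen_lt continuous_const continuous_re).mem_nhds
        (by simpa using hx2))).continuousAt
  have hslice : ∀ y q : ℝ, f (y, q) = if 1 < y ∧ y < q then k y q • F q else 0 := fun y q ↦ by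
    simp only [hf, hT, Set.indicator_apply, Set.mem_ofPred_eq]
  have hq1 : ∀ q : ℝ, q ≤ 1 → ∀ y, f (y, q) = 0 := fun q hq y ↦ by
    rw [hslice, if_neg]; rintro ⟨h1, h2⟩; linarith
  have hfy : ∀ q : ℝ, 1 < q → (fun y ↦ f (y, q)) = (Set.Ioo 1 q).indicator fun y ↦ k y q • F q := by
    intro q hq; ext y
    rw [hslice, Set.indicator_apply]; rfl
  have hfq : ∀ y : ℝ, (fun q ↦ f (y, q)) = if 1 < y then (Set.Ioi y).indicator fun q ↦ k y q • F q
      else 0 := by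
    intro y; ext q
    rw [hslice]
    by_cases h : 1 < y
    · simp [h, Set.indicator_apply]
    · simp [h]
  obtain ⟨M, hM0, hM⟩ : ∃ M, 0 ≤ M ∧ ∀ y q : ℝ, 1 < y → y < q →
      ‖k y q‖ ≤ M * (y * (q ^ 2 - y ^ 2) ^ (s.re - 1)) := by
    refine ⟨‖2 * s‖ * ((ζ.re ^ 2) ^ (-s - 1).re * Real.exp (Real.pi * |(-s - 1).im|)),
      by positivity, fun y q hy hyq ↦ ?_⟩
    have hy0 : 0 < q ^ 2 - y ^ 2 := by nlinarith
    have h1 : ‖(ζ ^ 2 + (y : ℂ) ^ 2) ^ (-s - 1)‖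
        ≤ (ζ.re ^ 2) ^ (-s - 1).re * Real.exp (Real.pi * |(-s - 1).im|) := by
      refine (norm_cpow_le_mul_exp _ _).trans (mul_le_mul_of_nonneg_right ?_ (Real.exp_pos _).le)
      exact Real.rpow_le_rpow_of_nonpos (by positivity) (sq_re_le_norm hζ y) (by simp; linarith)
    simp only [hk, norm_mul (2 * s * (y : ℂ) * _), norm_mul (2 * s * (y : ℂ)), norm_mul (2 * s)]
    rw [norm_real, Real.norm_of_nonneg (by linarith), norm_cpow_eq_rpow_re_of_pos hy0, sub_re,
      one_re]
    calc _ ≤ ‖2 * s‖ * y * ((ζ.re ^ 2) ^ (-s - 1).re * Real.exp (Real.pi * |(-s - 1).im|))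
          * (q ^ 2 - y ^ 2) ^ (s.re - 1) := by gcongr
      _ = _ := by ring
  have hint : Integrable f (volume.prod volume) := by
    rw [integrable_prod_iff' hfm]
    obtain ⟨c, hc, C, hC0, hC⟩ := hF.norm_sq_sub_one_rpow_mul_le hs
    constructor
    · refine Eventually.of_forall fun q ↦ ?_
      rcases le_or_gt q 1 with hq | hq
      · simp only [hq1 q hq]; exact integrable_zero _ _ _
      · have := (integral_Ioc_rayKer_mul_abelKer hs hζ hq).2.1
        rw [intervalIntegrable_iff_integrableOn_Ioo_of_le hq.le] at this
        rw [hfy q hq, integrable_indicator_iff measurableSet_Ioo]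
        exact this.smul_const _
    · have hbd : Integrable ((Set.Ioi (1 : ℝ)).indicator fun q ↦ M / (2 * s.re)
          * (C * Real.exp (-c * q))) := by
        rw [integrable_indicator_iff measurableSet_Ioi]
        exact ((exp_neg_integrableOn_Ioi 1 hc).const_mul C).const_mul _
      refine hbd.mono' ?_ (Eventually.of_forall fun q ↦ ?_)
      · exact hfm.norm.prod_swap.integral_prod_right'
      · rw [Real.norm_of_nonneg (integral_nonneg fun _ ↦ norm_nonneg _)]
        rcases le_or_gt q 1 with hq | hq
        · simp [hq1 q hq, Set.indicator_of_notMem (show q ∉ Set.Ioi (1 : ℝ) from not_lt.2 hq)]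
        rw [Set.indicator_of_mem (show q ∈ Set.Ioi (1 : ℝ) from hq)]
        obtain ⟨⟨h1, h2⟩, -⟩ := integral_Ioc_rayKer_mul_abelKer hs hζ hq
        have e : (fun y ↦ ‖f (y, q)‖) = (Set.Ioo 1 q).indicator fun y ↦ ‖k y q • F q‖ := by
          ext y
          rw [congrFun (hfy q hq) y, _root_.norm_indicator_eq_indicator_norm]
        rw [e, integral_indicator measurableSet_Ioo]
        have h3 : ∫ y in Set.Ioo 1 q, ‖k y q • F q‖
            ≤ ∫ y in Set.Ioo 1 q, M * (y * (q ^ 2 - y ^ 2) ^ (s.re - 1)) * ‖F q‖ := by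
          refine integral_mono_of_nonneg (Eventually.of_forall fun _ ↦ norm_nonneg _) ?_ ?_
          · rw [intervalIntegrable_iff_integrableOn_Ioo_of_le hq.le] at h2
            exact (h2.const_mul M).mul_const _
          · filter_upwards [ae_restrict_mem measurableSet_Ioo] with y hy
            rw [norm_smul]
            exact mul_le_mul_of_nonneg_right (hM y q hy.1 hy.2) (norm_nonneg _)
        refine h3.trans ?_
        rw [integral_mul_const, integral_const_mul, ← integral_Ioc_eq_integral_Ioo,
          ← intervalIntegral.integral_of_le hq.le, h1]
        calc _ = M / (2 * s.re) * ((q ^ 2 - 1) ^ s.re * ‖F q‖) := by field_simp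
          _ ≤ _ := mul_le_mul_of_nonneg_left (hC q hq) (by positivity)
  have hswap := integral_integral_swap (f := fun y q ↦ f (y, q)) hint
  have hL : ζ • ∫ y : ℝ, ∫ q : ℝ, f (y, q) = ∫ y in Set.Ioi (1 : ℝ), rayKer s ζ y • abel s F y := by
    rw [← integral_indicator measurableSet_Ioi, ← integral_smul]
    refine integral_congr_ae (Eventually.of_forall fun y ↦ ?_)
    simp only [hfq y]
    by_cases hy : 1 < y
    · rw [if_pos hy, Set.indicator_of_mem (show y ∈ Set.Ioi (1 : ℝ) from hy),
        integral_indicator measurableSet_Ioi]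
      have h1 := abel_ofReal s F (show 0 < y by linarith)
      have h2 : rayKer s ζ y • abel s F y = (2 * s * ζ * (ζ ^ 2 + (y : ℂ) ^ 2) ^ (-s - 1)) •
          ((y : ℂ) ^ s • abel s F y) := by
        rw [smul_smul, rayKer]; congr 1; ring
      rw [h2, h1, smul_smul, ← integral_smul, ← integral_smul]
      refine integral_congr_ae (Eventually.of_forall fun q ↦ ?_)
      simp only [smul_smul, hk]
      congr 1
      ring
    · rw [if_neg hy, Set.indicator_of_notMem (show y ∉ Set.Ioi (1 : ℝ) from hy)]
      simp
  have hR : ∫ q : ℝ, ∫ y : ℝ, f (y, q) = (ζ ^ 2 + 1) ^ (-s) • ∫ q in Set.Ioi (1 : ℝ),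
        (((q ^ 2 - 1 : ℝ) : ℂ) ^ s / (ζ ^ 2 + (q : ℂ) ^ 2)) • F q := by
    rw [← integral_smul, ← integral_indicator measurableSet_Ioi]
    refine integral_congr_ae (Eventually.of_forall fun q ↦ ?_)
    rcases le_or_gt q 1 with hq | hq
    · simp [hq1 q hq, Set.indicator_of_notMem (show q ∉ Set.Ioi (1 : ℝ) from not_lt.2 hq)]
    rw [Set.indicator_of_mem (show q ∈ Set.Ioi (1 : ℝ) from hq)]
    simp only [hfy q hq]
    rw [integral_indicator measurableSet_Ioo, integral_smul_const, ← integral_Ioc_eq_integral_Ioo,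
      ← intervalIntegral.integral_of_le hq.le, (integral_Ioc_rayKer_mul_abelKer hs hζ hq).2.2, smul_smul]
    congr 1
    ring
  rw [← hL, hswap, hR, smul_smul]

omit [CompleteSpace E] in
lemma cpow_mul_cpow_neg_of_im {a b : ℂ} (s : ℂ) (h : 0 < a.im ∧ 0 < b.im ∨ a.im < 0 ∧ b.im < 0) :
    a ^ s * b ^ (-s) = (a / b) ^ s := by
  have ha : a ≠ 0 := by rintro rfl; simp at h
  have hb : b ≠ 0 := by rintro rfl; simp at h
  have hbarg : b.arg ≠ Real.pi := by
    rw [Ne, arg_eq_pi_iff]; rintro ⟨-, h2⟩; rcases h with h | h <;> linarith [h.2]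
  rw [cpow_neg, ← inv_cpow _ _ hbarg, div_eq_mul_inv]
  refine (mul_cpow_of_arg s ha (inv_ne_zero hb) ?_).symm
  rw [arg_inv, if_neg hbarg]
  rcases h with ⟨h1, h2⟩ | ⟨h1, h2⟩
  · have e1 := arg_nonneg_iff.2 h1.le
    have e2 := arg_nonneg_iff.2 h2.le
    have e3 := arg_le_pi a
    have e4 := (arg_le_pi b).lt_of_ne hbarg
    constructor <;> linarith
  · have e1 := arg_neg_iff.2 h1
    have e2 := arg_neg_iff.2 h2
    have e3 := neg_pi_lt_arg a
    have e4 := neg_pi_lt_arg b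
    constructor <;> linarith

omit [CompleteSpace E] in
lemma cpow_eq_neg_of_im_pos {a : ℂ} (s : ℂ) (h : 0 < a.im) :
    a ^ s = exp (Real.pi * I * s) * (-a) ^ s := by
  have ha : a ≠ 0 := by rintro rfl; simp at h
  rw [cpow_def_of_ne_zero ha, cpow_def_of_ne_zero (neg_ne_zero.2 ha), ← exp_add]
  congr 1
  have : log a = log (-a) + Real.pi * I := by
    simp only [log, norm_neg, arg_neg_eq_arg_sub_pi_of_im_pos h]; push_cast; ring
  rw [this]; ring

omit [CompleteSpace E] in
lemma cpow_eq_neg_of_im_neg {a : ℂ} (s : ℂ) (h : a.im < 0) :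
    a ^ s = exp (-(Real.pi * I * s)) * (-a) ^ s := by
  have ha : a ≠ 0 := by rintro rfl; simp at h
  rw [cpow_def_of_ne_zero ha, cpow_def_of_ne_zero (neg_ne_zero.2 ha), ← exp_add]
  congr 1
  have : log a = log (-a) - Real.pi * I := by
    simp only [log, norm_neg, arg_neg_eq_arg_add_pi_of_im_neg h]; push_cast; ring
  rw [this]; ring

omit [CompleteSpace E] in
lemma rayKer_mul {s ζ : ℂ} (h : ζ.re * ζ.im ≠ 0) (y : ℝ) :
    (ζ ^ 2 + 1) ^ s * rayKer s ζ y
      = ζ * (2 * s * (y : ℂ) ^ s * ((ζ ^ 2 + 1) / (ζ ^ 2 + (y : ℂ) ^ 2)) ^ s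
        / (ζ ^ 2 + (y : ℂ) ^ 2)) := by
  have h1 : (ζ ^ 2 + 1).im = 2 * (ζ.re * ζ.im) := by simp [sq]; ring
  have h2 : (ζ ^ 2 + (y : ℂ) ^ 2).im = 2 * (ζ.re * ζ.im) := by
    simp [sq]; ring
  have h0 : ζ ^ 2 + (y : ℂ) ^ 2 ≠ 0 := by
    intro h3; rw [h3] at h2; simp at h2; exact h (by rcases h2 with h2 | h2 <;> simp [h2])
  rw [← cpow_mul_cpow_neg_of_im s, rayKer, cpow_sub _ _ h0, cpow_one]
  · ring
  · rw [h1, h2]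
    rcases lt_or_gt_of_ne h with h | h
    · right; constructor <;> linarith
    · left; constructor <;> linarith

omit [CompleteSpace E] in
/-- The part of the transform near the origin in the limit on the imaginary axis; it is an odd
function of `τ`. -/
lemma tendsto_integral_Ioc_rayKer_smul {s : ℂ} (hs : 0 < s.re) {U : ℂ → E} (hU : IsRapid fun w ↦ U (exp w)) {τ : ℝ}
    (hτ : 1 < τ ^ 2) :
    Tendsto (fun η : ℝ ↦ (((η : ℂ) + τ * I) ^ 2 + 1) ^ s •
        ∫ y in Set.Ioc (0 : ℝ) 1, rayKer s (η + τ * I) y • U y) (𝓝[>] 0)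
      (𝓝 ((τ * I : ℂ) • ∫ y in Set.Ioc (0 : ℝ) 1, (2 * s * (y : ℂ) ^ s *
        (((1 - τ ^ 2) / (y ^ 2 - τ ^ 2) : ℝ) : ℂ) ^ s / ((y ^ 2 - τ ^ 2 : ℝ) : ℂ)) • U y)) := by
  have hτ0 : τ ≠ 0 := by rintro rfl; simp at hτ; linarith
  obtain ⟨C, hC⟩ := hU.decay 0 (Real.pi / 2) (by positivity)
  have hUb : ∀ y : ℝ, 0 < y → ‖U y‖ ≤ |C| := by
    intro y hy
    have := hC (Real.log y) (by simp)
    rw [← ofReal_exp, Real.exp_log hy] at this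
    simp only [neg_zero, zero_mul, Real.exp_zero, mul_one] at this
    exact this.trans (le_abs_self _)
  set ζ : ℝ → ℂ := fun η ↦ η + τ * I with hζ
  have hζre : ∀ η, (ζ η).re = η := fun η ↦ by simp [hζ]
  have hζim : ∀ η, (ζ η).im = τ := fun η ↦ by simp [hζ]
  have hζc : Continuous ζ := by fun_prop
  have hζ0 : ζ 0 = τ * I := by simp [hζ]
  have hsq0 : ζ 0 ^ 2 = ((-τ ^ 2 : ℝ) : ℂ) := by rw [hζ0, mul_pow, I_sq]; push_cast; ring
  -- the integrand after multiplication by the power of `ζ ^ 2 + 1`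
  set G : ℝ → ℝ → ℂ := fun η y ↦ 2 * s * (y : ℂ) ^ s *
    ((ζ η ^ 2 + 1) / (ζ η ^ 2 + (y : ℂ) ^ 2)) ^ s / (ζ η ^ 2 + (y : ℂ) ^ 2) with hG
  set m : ℝ := (τ ^ 2 - 1) / 2 with hm
  have hm0 : 0 < m := by rw [hm]; linarith
  have hsmall : ∀ᶠ η : ℝ in 𝓝[>] 0, 0 < η ∧ η ^ 2 ≤ m := by
    filter_upwards [Ioo_mem_nhdsGT (show (0 : ℝ) < min 1 m from lt_min one_pos hm0)] with η hη
    refine ⟨hη.1, ?_⟩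
    have h1 := hη.2.trans_le (min_le_left _ _)
    have h2 := hη.2.trans_le (min_le_right _ _)
    nlinarith [hη.1]
  have hden : ∀ η y : ℝ, η ^ 2 ≤ m → 0 < y → y ≤ 1 → m ≤ ‖ζ η ^ 2 + (y : ℂ) ^ 2‖ := by
    intro η y hη hy0 hy
    refine le_trans ?_ (abs_re_le_norm _)
    have : (ζ η ^ 2 + (y : ℂ) ^ 2).re = η ^ 2 - τ ^ 2 + y ^ 2 := by
      simp only [sq, add_re, mul_re, hζre, hζim, ofReal_re, ofReal_im]; ring
    rw [this]
    refine le_trans ?_ (neg_le_abs _)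
    have : y ^ 2 ≤ 1 := by nlinarith
    rw [hm] at hη ⊢
    linarith
  have hnum : ∀ η : ℝ, η ^ 2 ≤ m → ‖ζ η ^ 2 + 1‖ ≤ m + τ ^ 2 + 1 := by
    intro η hη
    refine (norm_add_le _ _).trans ?_
    rw [norm_one, norm_pow]
    have : ‖ζ η‖ ^ 2 = η ^ 2 + τ ^ 2 := by
      rw [Complex.sq_norm, normSq_apply, hζre, hζim]; ring
    rw [this]; linarith
  have hlim : Tendsto (fun η ↦ ∫ y in Set.Ioc (0 : ℝ) 1, G η y • U y) (𝓝[>] 0)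
      (𝓝 (∫ y in Set.Ioc (0 : ℝ) 1, (2 * s * (y : ℂ) ^ s *
        (((1 - τ ^ 2) / (y ^ 2 - τ ^ 2) : ℝ) : ℂ) ^ s / ((y ^ 2 - τ ^ 2 : ℝ) : ℂ)) • U y)) := by
    refine tendsto_integral_filter_of_dominated_convergence
      (fun _ ↦ ‖2 * s‖ * 1 * ((((m + τ ^ 2 + 1) / m) ^ s.re * Real.exp (Real.pi * |s.im|)) / m)
        * |C|) ?_ ?_ ?_ ?_
    · filter_upwards [hsmall] with η hη
      refine ContinuousOn.aestronglyMeasurable ?_ measurableSet_Ioc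
      refine ContinuousOn.smul ?_ (hU.continuousOn_ofReal.mono Set.Ioc_subset_Ioi_self)
      have h1 : Set.EqOn (G η) (fun y ↦ (ζ η ^ 2 + 1) ^ s * rayKer s (ζ η) y / ζ η)
          (Set.Ioc 0 1) := by
        intro y hy
        have hne : ζ η ≠ 0 := by
          intro h; have := hζim η; rw [h] at this; exact hτ0 this.symm
        simp only
        rw [rayKer_mul (by rw [hζre, hζim]; exact mul_ne_zero hη.1.ne' hτ0),
          mul_div_cancel_left₀ _ hne]
      refine ContinuousOn.congr ?_ h1
      refine (continuousOn_const.mul ((continuousOn_rayKer ?_).mono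
        Set.Ioc_subset_Ioi_self)).div_const _
      rw [hζre]; exact hη.1
    · filter_upwards [hsmall] with η hη
      filter_upwards [ae_restrict_mem measurableSet_Ioc] with y hy
      have hd := hden η y hη.2 hy.1 hy.2
      rw [norm_smul]
      refine mul_le_mul ?_ (hUb y hy.1) (norm_nonneg _) (by positivity)
      rw [hG]
      simp only
      rw [mul_div_assoc, norm_mul, norm_mul, norm_div]
      refine mul_le_mul (mul_le_mul_of_nonneg_left ?_ (norm_nonneg _)) ?_ (by positivity)
        (by positivity)
      · rw [norm_cpow_eq_rpow_re_of_pos hy.1]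
        exact Real.rpow_le_one hy.1.le hy.2 hs.le
      · refine div_le_div₀ (by positivity) ?_ hm0 hd
        refine (norm_cpow_le_mul_exp _ _).trans
          (mul_le_mul_of_nonneg_right ?_ (Real.exp_pos _).le)
        refine Real.rpow_le_rpow (norm_nonneg _) ?_ hs.le
        rw [norm_div]
        exact div_le_div₀ (by positivity) (hnum η hη.2) hm0 hd
    · exact integrableOn_const (by simp)
    · filter_upwards [ae_restrict_mem measurableSet_Ioc] with y hy
      refine Tendsto.smul_const ?_ _
      have hne : y ^ 2 - τ ^ 2 < 0 := by nlinarith [hy.1, hy.2]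
      have e0 : ζ 0 ^ 2 + (y : ℂ) ^ 2 = ((y ^ 2 - τ ^ 2 : ℝ) : ℂ) := by
        rw [hsq0]; push_cast; ring
      have e1 : ζ 0 ^ 2 + 1 = ((1 - τ ^ 2 : ℝ) : ℂ) := by rw [hsq0]; push_cast; ring
      have hne' : ((y ^ 2 - τ ^ 2 : ℝ) : ℂ) ≠ 0 := by exact_mod_cast hne.ne
      have hpos : 0 < (1 - τ ^ 2) / (y ^ 2 - τ ^ 2) := div_pos_of_neg_of_neg (by linarith) hne
      have e2 : (2 * s * (y : ℂ) ^ s * (((1 - τ ^ 2) / (y ^ 2 - τ ^ 2) : ℝ) : ℂ) ^ s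
          / ((y ^ 2 - τ ^ 2 : ℝ) : ℂ)) = G 0 y := by
        rw [hG]; simp only; rw [e0, e1, ofReal_div]
      rw [e2]
      have hcont : ContinuousAt (fun η ↦ G η y) 0 := by
        have hd : ContinuousAt (fun η ↦ ζ η ^ 2 + (y : ℂ) ^ 2) 0 := by fun_prop
        refine ContinuousAt.div (ContinuousAt.mul continuousAt_const ?_) hd (by rw [e0]; exact hne')
        refine ContinuousAt.cpow (ContinuousAt.div (by fun_prop) hd (by rw [e0]; exact hne'))
          continuousAt_const ?_
        rw [e0, e1, ← ofReal_div]
        exact Or.inl (by rw [ofReal_re]; exact hpos)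
      exact hcont.tendsto.mono_left nhdsWithin_le_nhds
  have hζlim : Tendsto ζ (𝓝[>] 0) (𝓝 (τ * I)) := by
    rw [← hζ0]; exact (hζc.tendsto 0).mono_left nhdsWithin_le_nhds
  refine (hζlim.smul hlim).congr' ?_
  filter_upwards [self_mem_nhdsWithin] with η hη
  rw [← integral_smul, ← integral_smul]
  refine integral_congr_ae (Eventually.of_forall fun y ↦ ?_)
  simp only [smul_smul]
  congr 1
  exact (rayKer_mul (by rw [hζre, hζim]; exact mul_ne_zero (ne_of_gt hη) hτ0) y).symm

omit [CompleteSpace E] in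
lemma poisson_eq {η t : ℝ} (hη : 0 < η) (q : ℝ) :
    ((η : ℂ) + t * I) / ((η + t * I) ^ 2 + (q : ℂ) ^ 2)
      + ((η : ℂ) + (-t : ℝ) * I) / ((η + (-t : ℝ) * I) ^ 2 + (q : ℂ) ^ 2)
      = ((η / (η ^ 2 + (q - t) ^ 2) : ℝ) : ℂ) + ((η / (η ^ 2 + (q - -t) ^ 2) : ℝ) : ℂ) := by
  have h1 : ∀ τ : ℝ, ((η : ℂ) + τ * I) ^ 2 + (q : ℂ) ^ 2 ≠ 0 := fun τ ↦
    slitPlane_ne_zero (sq_add_sq_mem_slitPlane (by simpa using hη) q)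
  have h2 : ∀ τ : ℝ, ((η : ℂ) ^ 2 + ((q : ℂ) - τ) ^ 2) ≠ 0 := by
    intro τ
    have : (0 : ℝ) < η ^ 2 + (q - τ) ^ 2 := by positivity
    exact_mod_cast this.ne'
  push_cast
  have a1 := h1 t
  have a2 := h1 (-t)
  have b1 := h2 t
  have b2 := h2 (-t)
  push_cast at a1 a2 b1 b2
  rw [div_add_div _ _ a1 a2, div_add_div _ _ b1 b2, div_eq_div_iff (mul_ne_zero a1 a2)
    (mul_ne_zero b1 b2)]
  have e : (((η : ℂ) + t * I) ^ 2 + (q : ℂ) ^ 2) * (((η : ℂ) + -t * I) ^ 2 + (q : ℂ) ^ 2)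
      = ((η : ℂ) ^ 2 + ((q : ℂ) - t) ^ 2) * ((η : ℂ) ^ 2 + ((q : ℂ) - -t) ^ 2) := by
    linear_combination ((t : ℂ) ^ 4 * (I ^ 2 - 1) - 2 * η ^ 2 * t ^ 2 + 2 * q ^ 2 * t ^ 2) * I_sq
  have e' : ((η : ℂ) + t * I) * (((η : ℂ) + -t * I) ^ 2 + (q : ℂ) ^ 2)
      + (((η : ℂ) + t * I) ^ 2 + (q : ℂ) ^ 2) * ((η : ℂ) + -t * I)
      = η * ((η : ℂ) ^ 2 + ((q : ℂ) - -t) ^ 2) + ((η : ℂ) ^ 2 + ((q : ℂ) - t) ^ 2) * η := by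
    linear_combination (-2 * (η : ℂ) * t ^ 2) * I_sq
  rw [e, e']

/-- The parts of the transform near infinity on both sides of the imaginary axis add up to a
Poisson integral. -/
lemma tendsto_cauchy_integral_add {s : ℂ} (hs : 0 < s.re) {F : ℂ → E} (hF : IsExpDecay F) {t : ℝ} (ht : 1 < t) :
    Tendsto (fun η : ℝ ↦
      ((η : ℂ) + t * I) • (∫ q in Set.Ioi (1 : ℝ),
        (((q ^ 2 - 1 : ℝ) : ℂ) ^ s / (((η : ℂ) + t * I) ^ 2 + (q : ℂ) ^ 2)) • F q)
      + ((η : ℂ) + (-t : ℝ) * I) • (∫ q in Set.Ioi (1 : ℝ),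
        (((q ^ 2 - 1 : ℝ) : ℂ) ^ s / (((η : ℂ) + (-t : ℝ) * I) ^ 2 + (q : ℂ) ^ 2)) • F q))
      (𝓝[>] 0) (𝓝 ((Real.pi : ℂ) • ((t ^ 2 - 1 : ℝ) : ℂ) ^ s • F t)) := by
  obtain ⟨c, hc, C, hC0, hC⟩ := hF.norm_sq_sub_one_rpow_mul_le hs
  set g : ℝ → E := (Set.Ioi (1 : ℝ)).indicator fun q ↦ ((q ^ 2 - 1 : ℝ) : ℂ) ^ s • F q with hg
  have hcont : ∀ q : ℝ, 1 < q → ContinuousAt (fun q : ℝ ↦ ((q ^ 2 - 1 : ℝ) : ℂ) ^ s • F q) q := by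
    intro q hq
    refine ContinuousAt.smul ?_ ?_
    · refine ContinuousAt.cpow (by fun_prop) continuousAt_const (Or.inl ?_)
      rw [ofReal_re]; nlinarith
    · refine ContinuousAt.comp (g := F) (f := fun x : ℝ ↦ (x : ℂ)) ?_ (by fun_prop)
      exact (hF.diff.differentiableAt ((isOpen_lt continuous_const continuous_re).mem_nhds
        (by simp; linarith))).continuousAt
  have hgm : AEStronglyMeasurable g := by
    rw [hg, aestronglyMeasurable_indicator_iff measurableSet_Ioi]
    exact ContinuousOn.aestronglyMeasurable (fun q hq ↦ (hcont q hq).continuousWithinAt)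
      measurableSet_Ioi
  have hgnorm : ∀ q, ‖g q‖ ≤ (Set.Ioi (1 : ℝ)).indicator (fun q ↦ C * Real.exp (-c * q)) q := by
    intro q
    by_cases hq : q ∈ Set.Ioi (1 : ℝ)
    · have hq' : 1 < q := hq
      rw [hg, Set.indicator_of_mem hq, Set.indicator_of_mem hq, norm_smul,
        norm_cpow_eq_rpow_re_of_pos (by nlinarith)]
      exact hC q hq
    · rw [hg, Set.indicator_of_notMem hq, Set.indicator_of_notMem hq, norm_zero]
  have hgint : Integrable g := by
    refine Integrable.mono' ?_ hgm (Eventually.of_forall hgnorm)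
    rw [integrable_indicator_iff measurableSet_Ioi]
    exact (exp_neg_integrableOn_Ioi 1 hc).const_mul C
  have hgb : ∀ q, ‖g q‖ ≤ C := by
    intro q
    refine (hgnorm q).trans (Set.indicator_apply_le' (fun hq ↦ ?_) fun _ ↦ hC0)
    refine mul_le_of_le_one_right hC0 (Real.exp_le_one_iff.2 ?_)
    have hq' : (1 : ℝ) < q := hq
    nlinarith
  have hgt : ContinuousAt g t := by
    refine (hcont t ht).congr ?_
    filter_upwards [Ioi_mem_nhds ht] with q hq
    rw [hg, Set.indicator_of_mem hq]
  have hgmt : ContinuousAt g (-t) := by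
    refine (continuousAt_const (y := (0 : E))).congr ?_
    filter_upwards [Iio_mem_nhds (show -t < 1 by linarith)] with q hq
    have hq' : q < 1 := hq
    rw [hg, Set.indicator_of_notMem (show q ∉ Set.Ioi (1 : ℝ) from not_lt.2 hq'.le)]
  have hg1 : g t = ((t ^ 2 - 1 : ℝ) : ℂ) ^ s • F t := by
    rw [hg, Set.indicator_of_mem (show t ∈ Set.Ioi (1 : ℝ) from ht)]
  have hg2 : g (-t) = 0 := by
    rw [hg, Set.indicator_of_notMem (Set.notMem_Ioi.2 (show -t ≤ 1 by linarith))]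
  have key := (tendsto_integral_poisson_kernel hgm hgb hgt).add
    (tendsto_integral_poisson_kernel hgm hgb hgmt)
  rw [hg1, hg2, smul_zero, add_zero] at key
  refine key.congr' ?_
  filter_upwards [self_mem_nhdsWithin] with η hη
  have hη : 0 < η := hη
  have hker : ∀ τ : ℝ, Integrable fun q : ℝ ↦ (((η : ℂ) + τ * I) /
      (((η : ℂ) + τ * I) ^ 2 + (q : ℂ) ^ 2)) • g q := by
    intro τ
    have hre : 0 < ((η : ℂ) + τ * I).re := by simpa using hη
    refine hgint.bdd_smul (‖(η : ℂ) + τ * I‖ / ((η : ℂ) + τ * I).re ^ 2) ?_ ?_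
    · refine (Continuous.div (by fun_prop) (by fun_prop) fun q ↦ ?_).aestronglyMeasurable
      exact slitPlane_ne_zero (sq_add_sq_mem_slitPlane hre q)
    · refine Eventually.of_forall fun q ↦ ?_
      rw [norm_div]
      exact div_le_div_of_nonneg_left (norm_nonneg _) (by positivity) (sq_re_le_norm hre q)
  have hone : ∀ τ : ℝ, ((η : ℂ) + τ * I) • (∫ q in Set.Ioi (1 : ℝ),
        (((q ^ 2 - 1 : ℝ) : ℂ) ^ s / (((η : ℂ) + τ * I) ^ 2 + (q : ℂ) ^ 2)) • F q)
      = ∫ q : ℝ, (((η : ℂ) + τ * I) / (((η : ℂ) + τ * I) ^ 2 + (q : ℂ) ^ 2)) • g q := by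
    intro τ
    rw [← integral_indicator measurableSet_Ioi, ← integral_smul]
    refine integral_congr_ae (Eventually.of_forall fun q ↦ ?_)
    by_cases hq : q ∈ Set.Ioi (1 : ℝ)
    · simp only [hg, Set.indicator_of_mem hq, smul_smul]
      congr 1; ring
    · simp only [hg, Set.indicator_of_notMem hq, smul_zero]
  have hP : ∀ τ : ℝ, Integrable fun q : ℝ ↦ ((η / (η ^ 2 + (q - τ) ^ 2) : ℝ) : ℂ) • g q := by
    intro τ
    refine hgint.bdd_smul (η / η ^ 2) ?_ (Eventually.of_forall fun q ↦ ?_)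
    · refine Continuous.aestronglyMeasurable (continuous_ofReal.comp ?_)
      exact Continuous.div (by fun_prop) (by fun_prop) fun q ↦ by positivity
    · rw [norm_real, Real.norm_of_nonneg (by positivity)]
      exact div_le_div_of_nonneg_left hη.le (by positivity) (by nlinarith [sq_nonneg (q - τ)])
  rw [hone, hone, ← integral_add (hP t) (hP (-t)), ← integral_add (hker t) (hker (-t))]
  refine integral_congr_ae (Eventually.of_forall fun q ↦ ?_)
  simp only [← add_smul]
  rw [poisson_eq hη]

/-- The boundary values of the transform of an Abel transform on the imaginary axis recover the
original function. -/
theorem rayTransform_jump {s : ℂ} (hs : 0 < s.re) {F : ℂ → E} (hF : IsExpDecay F)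
    (hU : IsRapid fun w ↦ abel s F (exp w)) {t : ℝ} (ht : 1 < t) :
    exp (Real.pi * I * s) • rayTransform s (fun w ↦ abel s F (exp w)) (t * I)
      + exp (-(Real.pi * I * s)) • rayTransform s (fun w ↦ abel s F (exp w)) (-(t * I))
      = (Real.pi : ℂ) • F t := by
  set R := rayTransform s (fun w ↦ abel s F (exp w)) with hR
  have hRd := differentiableOn_rayTransform hs hU
  have ht2 : 1 < t ^ 2 := by nlinarith
  -- Split the integral at `y = 1` and multiply by the power of `ζ² + 1` that makes the outer part a
  -- Cauchy integral. The inner part is odd in the limit, so it cancels between `it` and `-it`.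
  have hsplit : ∀ η τ : ℝ, 0 < η → (((η : ℂ) + τ * I) ^ 2 + 1) ^ s • R (η + τ * I)
      = (((η : ℂ) + τ * I) ^ 2 + 1) ^ s • (∫ y in Set.Ioc (0 : ℝ) 1,
          rayKer s (η + τ * I) y • abel s F y)
        + ((η : ℂ) + τ * I) • (∫ q in Set.Ioi (1 : ℝ),
        (((q ^ 2 - 1 : ℝ) : ℂ) ^ s / (((η : ℂ) + τ * I) ^ 2 + (q : ℂ) ^ 2)) • F q) := by
    intro η τ hη
    have hre : 0 < ((η : ℂ) + τ * I).re := by simpa using hη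
    obtain ⟨h1, h2⟩ := rayTransform_eq_integral hs hU hre
    have hne : ((η : ℂ) + τ * I) ^ 2 + 1 ≠ 0 := by
      have := slitPlane_ne_zero (sq_add_sq_mem_slitPlane hre 1)
      simpa using this
    rw [hR, h2, ← Set.Ioc_union_Ioi_eq_Ioi (zero_le_one (α := ℝ)), setIntegral_union
      Set.Ioc_disjoint_Ioi_same measurableSet_Ioi
      (h1.mono_set Set.Ioc_subset_Ioi_self) (h1.mono_set (Set.Ioi_subset_Ioi zero_le_one)),
      smul_add, integral_Ioi_rayKer_smul_abel hs hre hF, smul_smul _ (_ * _)]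
    congr 2
    rw [cpow_neg]
    have : (((η : ℂ) + τ * I) ^ 2 + 1) ^ s ≠ 0 := by simp [cpow_eq_zero_iff, hne]
    field_simp
  have hpow : ∀ τ : ℝ, τ ^ 2 = t ^ 2 → Tendsto (fun η : ℝ ↦ (-(((η : ℂ) + τ * I) ^ 2 + 1)) ^ s)
      (𝓝[>] 0) (𝓝 (((t ^ 2 - 1 : ℝ) : ℂ) ^ s)) := by
    intro τ hτ
    have e : ((t ^ 2 - 1 : ℝ) : ℂ) = -((((0 : ℝ) : ℂ) + τ * I) ^ 2 + 1) := by
      rw [← hτ]; push_cast; linear_combination (τ : ℂ) ^ 2 * I_sq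
    rw [e]
    have : ContinuousAt (fun η : ℝ ↦ (-(((η : ℂ) + τ * I) ^ 2 + 1)) ^ s) 0 := by
      refine ContinuousAt.cpow (by fun_prop) continuousAt_const ?_
      rw [← e]
      exact Or.inl (by rw [ofReal_re]; linarith)
    exact this.tendsto.mono_left nhdsWithin_le_nhds
  have hRlim : ∀ τ : ℝ, τ ≠ 0 → Tendsto (fun η : ℝ ↦ R (η + τ * I)) (𝓝[>] 0) (𝓝 (R (τ * I))) := by
    intro τ hτ
    have h1 : ContinuousAt R (((0 : ℝ) : ℂ) + τ * I) := by
      refine (hRd.differentiableAt (isOpen_slitPlane.mem_nhds (Or.inr ?_))).continuousAt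
      simpa using hτ
    have h2 : ContinuousAt (fun η : ℝ ↦ R (η + τ * I)) 0 :=
      ContinuousAt.comp (g := R) (f := fun η : ℝ ↦ (η : ℂ) + τ * I) h1 (by fun_prop)
    have h3 := h2.tendsto.mono_left (nhdsWithin_le_nhds (s := Set.Ioi 0))
    simpa using h3
  have himag : ∀ η τ : ℝ, ((((η : ℂ) + τ * I) ^ 2 + 1)).im = 2 * (η * τ) := by
    intro η τ; simp [sq]; ring
  have hL1 : Tendsto (fun η : ℝ ↦ (((η : ℂ) + t * I) ^ 2 + 1) ^ s • R (η + t * I)) (𝓝[>] 0)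
      (𝓝 ((exp (Real.pi * I * s) * ((t ^ 2 - 1 : ℝ) : ℂ) ^ s) • R (t * I))) := by
    refine (((hpow t rfl).const_mul _).smul (hRlim t (by linarith))).congr' ?_
    filter_upwards [self_mem_nhdsWithin] with η hη
    have hη : 0 < η := hη
    rw [← cpow_eq_neg_of_im_pos s]
    rw [himag]; positivity
  have hL2 : Tendsto (fun η : ℝ ↦ (((η : ℂ) + (-t : ℝ) * I) ^ 2 + 1) ^ s • R (η + (-t : ℝ) * I))
      (𝓝[>] 0)
      (𝓝 ((exp (-(Real.pi * I * s)) * ((t ^ 2 - 1 : ℝ) : ℂ) ^ s) • R ((-t : ℝ) * I))) := by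
    refine (((hpow (-t) (by ring)).const_mul _).smul (hRlim (-t) (by linarith))).congr' ?_
    filter_upwards [self_mem_nhdsWithin] with η hη
    have hη : 0 < η := hη
    rw [← cpow_eq_neg_of_im_neg s]
    rw [himag]; nlinarith
  have hR1 := ((tendsto_integral_Ioc_rayKer_smul hs hU ht2).add (tendsto_integral_Ioc_rayKer_smul hs hU (τ := -t) (by simpa using ht2))).add
    (tendsto_cauchy_integral_add hs hF ht)
  have heq := tendsto_nhds_unique (hL1.add hL2) (hR1.congr' (by
    filter_upwards [self_mem_nhdsWithin] with η hη
    rw [hsplit η t hη, hsplit η (-t) hη]; abel))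
  have hinner0 : ∀ x : E, ((t : ℂ) * I) • x + (((-t : ℝ) : ℂ) * I) • x = 0 := by
    intro x; rw [← add_smul]; push_cast; simp
  simp only [neg_sq] at heq
  rw [hinner0, zero_add] at heq
  have hne : ((t ^ 2 - 1 : ℝ) : ℂ) ^ s ≠ 0 := by
    have : ((t ^ 2 - 1 : ℝ) : ℂ) ≠ 0 := by exact_mod_cast (by linarith : t ^ 2 - 1 ≠ 0)
    rw [Ne, cpow_eq_zero_iff]; exact fun h ↦ this h.1
  have e3 : (((-t : ℝ) : ℂ) * I) = -(t * I) := by push_cast; ring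
  rw [e3] at heq
  refine smul_right_injective E hne ?_
  simp only
  rw [smul_add, smul_smul, smul_smul, mul_comm _ (exp (Real.pi * I * s)),
    mul_comm _ (exp (-(Real.pi * I * s))), heq, smul_comm]

end JumpFormula

/-! ### Holomorphic continuation of the period function -/

section Continuation

variable {E : Type*} [NormedAddCommGroup E] [NormedSpace ℂ E] [CompleteSpace E]

/-- The identity theorem for two functions that agree on an open end of a ray. -/
lemma eqOn_of_eq_on_ray {U : Set ℂ} (hU : IsOpen U) (hc : IsPreconnected U) {f g : ℂ → E}
    (hf : DifferentiableOn ℂ f U) (hg : DifferentiableOn ℂ g U) {c : ℂ} (hc0 : c ≠ 0) {a : ℝ}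
    (ha : a * c ∈ U) (h : ∀ t : ℝ, a < t → f (t * c) = g (t * c)) : Set.EqOn f g U := by
  refine (hf.analyticOnNhd hU).eqOn_of_preconnected_of_frequently_eq (hg.analyticOnNhd hU) hc ha ?_
  have ht : Tendsto (fun t : ℝ ↦ (t : ℂ) * c) (𝓝[>] a) (𝓝[≠] (a * c)) := by
    refine tendsto_nhdsWithin_iff.2 ⟨?_, ?_⟩
    · have : Continuous fun t : ℝ ↦ (t : ℂ) * c := by fun_prop
      exact (this.tendsto a).mono_left nhdsWithin_le_nhds
    · filter_upwards [self_mem_nhdsWithin] with t ht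
      have ht : a < t := ht
      intro h
      exact ht.ne' (by exact_mod_cast mul_right_cancel₀ hc0 h)
  refine ht.frequently (Eventually.frequently ?_)
  filter_upwards [self_mem_nhdsWithin] with t ht using h t ht

lemma isPreconnected_upper : IsPreconnected {z : ℂ | 0 < z.im} :=
  (convex_halfSpace_im_gt 0).isPreconnected

lemma neg_mem_slitPlane_of_im {z : ℂ} (hz : z.im ≠ 0) : -z ∈ slitPlane :=
  Or.inr (by simpa using hz)

/-- `rayTransform_jump` on the whole upper half plane. -/
theorem rayTransform_jump_upper {s : ℂ} (hs : 0 < s.re) {F : ℂ → E} (hF : IsExpDecay F)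
    (hU : IsRapid fun w ↦ abel s F (exp w)) {ζ : ℂ} (hζ : 0 < ζ.im) :
    exp (Real.pi * I * s) • rayTransform s (fun w ↦ abel s F (exp w)) ζ
      + exp (-(Real.pi * I * s)) • rayTransform s (fun w ↦ abel s F (exp w)) (-ζ)
      = (Real.pi : ℂ) • F (-I * ζ) := by
  have hR := differentiableOn_rayTransform hs hU
  refine eqOn_of_eq_on_ray (U := {z : ℂ | 0 < z.im}) (a := 2) (c := I)
    (f := fun ζ ↦ exp (Real.pi * I * s) • rayTransform s (fun w ↦ abel s F (exp w)) ζ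
      + exp (-(Real.pi * I * s)) • rayTransform s (fun w ↦ abel s F (exp w)) (-ζ))
    (g := fun ζ ↦ (Real.pi : ℂ) • F (-I * ζ))
    (isOpen_lt continuous_const continuous_im) isPreconnected_upper ?_ ?_ I_ne_zero (by simp)
    (fun t ht ↦ ?_) hζ
  · refine DifferentiableOn.add ?_ ?_
    · exact (hR.mono fun z hz ↦ Or.inr (ne_of_gt hz)).const_smul _
    · refine DifferentiableOn.const_smul (hR.comp (by fun_prop) fun z hz ↦ ?_) _
      exact neg_mem_slitPlane_of_im (ne_of_gt hz)
  · refine DifferentiableOn.const_smul (hF.diff.comp (by fun_prop) fun z hz ↦ ?_) _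
    simpa using hz
  · rw [rayTransform_jump hs hF hU (by linarith)]
    congr 2
    linear_combination (t : ℂ) * I_sq

/-- A primitive of `-rayTransform s W`, namely `ζ ↦ ∫ y^s (ζ² + y²)^{-s} U(y) dy` for
`W(w) = U(e^w)` and `Re ζ > 0`, continued to the slit plane. -/
def rayPrimitive (s : ℂ) (W : ℂ → E) (ζ : ℂ) : E :=
  ζ ^ (-s) • coshConv s (fun w ↦ exp w • W w) (log ζ)

lemma hasDerivAt_rayPrimitive {s : ℂ} (hs : 0 < s.re) {W : ℂ → E} (hW : IsRapid W) {ζ : ℂ}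
    (hζ : ζ ∈ slitPlane) : HasDerivAt (rayPrimitive s W) (-rayTransform s W ζ) ζ := by
  have hW' : IsRapid fun w ↦ exp w • W w := by simpa using hW.exp_smul 1
  have h0 := slitPlane_ne_zero hζ
  have h1 := (hasDerivAt_coshConv hW' hs (abs_log_im_lt hζ)).scomp ζ (hasDerivAt_log hζ)
  have h2 := ((hasDerivAt_id ζ).cpow_const (c := -s) hζ).smul h1
  refine h2.congr_deriv ?_
  have e : (fun w ↦ exp (-w) • exp w • W w) = W := by
    ext w; rw [smul_smul, ← exp_add, neg_add_cancel, exp_zero, one_smul]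
  simp only [id, e, exp_log h0, rayTransform, Function.comp_apply, mul_one]
  rw [smul_smul, smul_sub, smul_smul, smul_smul, cpow_sub _ _ h0, cpow_one, ← neg_smul]
  rw [sub_add_eq_add_sub, ← add_smul]
  have e2 : ζ ^ (-s) * ζ⁻¹ * s + -s * (ζ ^ (-s) / ζ) = 0 := by field_simp; ring
  rw [e2, zero_smul, zero_sub, ← neg_smul]
  congr 1
  field_simp

lemma differentiableOn_rayPrimitive {s : ℂ} (hs : 0 < s.re) {W : ℂ → E} (hW : IsRapid W) :
    DifferentiableOn ℂ (rayPrimitive s W) slitPlane :=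
  fun _ hζ ↦ (hasDerivAt_rayPrimitive hs hW hζ).differentiableAt.differentiableWithinAt

omit [CompleteSpace E] in
/-- With `ζ = e^z`, the factor `ζ^{-s}` turns the bound `e^{-Re s |Re z|}` of the convolution into
`min 1 |ζ|^{-2 Re s}`. -/
lemma norm_cpow_smul_coshConv_le {s α : ℂ} (hs : 0 < s.re) (hα : s.re ≤ α.re) {W : ℂ → E}
    (hW : IsRapid W) {δ : ℝ} (hδ : 0 < δ) :
    ∃ K, 0 ≤ K ∧ ∀ ζ : ℂ, ζ ≠ 0 → |arg ζ| ≤ Real.pi - δ →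
      ‖ζ ^ (-s) • coshConv α W (log ζ)‖ ≤ K * min 1 (‖ζ‖ ^ (-(2 * s.re))) := by
  obtain ⟨K, hK0, hK⟩ := norm_coshConv_le hW (hs.trans_le hα) hδ
  refine ⟨Real.exp (Real.pi * |s.im|) * K, by positivity, fun ζ hζ ha ↦ ?_⟩
  have hn : 0 < ‖ζ‖ := norm_pos_iff.2 hζ
  have h1 := norm_cpow_le_mul_exp ζ (-s)
  have h2 := hK (log ζ) (by rwa [log_im])
  rw [log_re] at h2
  rw [neg_im, abs_neg, neg_re] at h1
  have h3 : ‖ζ‖ ^ (-s.re) * Real.exp (-α.re * |Real.log ‖ζ‖|) ≤ min 1 (‖ζ‖ ^ (-(2 * s.re))) := by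
    have h4 : Real.exp (-α.re * |Real.log ‖ζ‖|) ≤ Real.exp (-s.re * |Real.log ‖ζ‖|) :=
      Real.exp_le_exp.2 (by nlinarith [abs_nonneg (Real.log ‖ζ‖)])
    refine (mul_le_mul_of_nonneg_left h4 (by positivity)).trans ?_
    rw [Real.rpow_def_of_pos hn, Real.rpow_def_of_pos hn, ← Real.exp_add, le_min_iff,
      Real.exp_le_one_iff, Real.exp_le_exp]
    constructor
    · nlinarith [neg_abs_le (Real.log ‖ζ‖)]
    · nlinarith [le_abs_self (Real.log ‖ζ‖)]
  rw [norm_smul]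
  calc _ ≤ (‖ζ‖ ^ (-s.re) * Real.exp (Real.pi * |s.im|))
        * (K * Real.exp (-α.re * |Real.log ‖ζ‖|)) := by gcongr
    _ = Real.exp (Real.pi * |s.im|) * K * (‖ζ‖ ^ (-s.re) * Real.exp (-α.re * |Real.log ‖ζ‖|)) := by
      ring
    _ ≤ _ := by gcongr

omit [CompleteSpace E] in
lemma norm_rayPrimitive_le {s : ℂ} (hs : 0 < s.re) {W : ℂ → E} (hW : IsRapid W) {δ : ℝ}
    (hδ : 0 < δ) : ∃ K, 0 ≤ K ∧ ∀ ζ : ℂ, ζ ≠ 0 → |arg ζ| ≤ Real.pi - δ →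
      ‖rayPrimitive s W ζ‖ ≤ K * min 1 (‖ζ‖ ^ (-(2 * s.re))) :=
  norm_cpow_smul_coshConv_le hs le_rfl (by simpa using hW.exp_smul 1) hδ

omit [CompleteSpace E] in
lemma norm_rayTransform_le {s : ℂ} (hs : 0 < s.re) {W : ℂ → E} (hW : IsRapid W) {δ : ℝ}
    (hδ : 0 < δ) : ∃ K, 0 ≤ K ∧ ∀ ζ : ℂ, ζ ≠ 0 → |arg ζ| ≤ Real.pi - δ →
      ‖rayTransform s W ζ‖ ≤ K * min 1 (‖ζ‖ ^ (-(2 * s.re))) := by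
  obtain ⟨K, hK0, hK⟩ := norm_cpow_smul_coshConv_le (α := s + 1) hs (by simp) hW hδ
  refine ⟨‖2 * s‖ * K, by positivity, fun ζ hζ ha ↦ ?_⟩
  rw [rayTransform, mul_smul, norm_smul, mul_assoc]
  exact mul_le_mul_of_nonneg_left (hK ζ hζ ha) (norm_nonneg _)

lemma inv_mem_slitPlane {z : ℂ} (hz : z ∈ slitPlane) : z⁻¹ ∈ slitPlane := by
  rw [mem_slitPlane_iff_arg, arg_inv] at *
  rw [if_neg hz.1]
  refine ⟨fun h ↦ ?_, inv_ne_zero hz.2⟩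
  linarith [neg_pi_lt_arg z]

lemma cpow_neg_smul_coshConv_inv {s α : ℂ} (hα : 0 < α.re) {W : ℂ → E} (hW : IsRapid W)
    (A : E →L[ℂ] E) (hA : ∀ w : ℂ, |w.im| < Real.pi / 2 → W (-w) = A (W w)) {ζ : ℂ}
    (hζ : ζ ∈ slitPlane) :
    A (ζ ^ (-s) • coshConv α W (log ζ)) = ζ ^ (-2 * s) • (ζ⁻¹ ^ (-s) • coshConv α W (log ζ⁻¹)) := by
  have ha : ζ.arg ≠ Real.pi := (mem_slitPlane_iff_arg.1 hζ).1
  have h0 := slitPlane_ne_zero hζ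
  rw [log_inv _ ha, coshConv_neg hW hα A hA (abs_log_im_lt hζ), map_smul, smul_smul]
  congr 1
  rw [inv_cpow _ _ ha, ← cpow_neg, ← cpow_add _ _ h0]
  congr 1; ring

/-- The law `U(1/y) = A U(y)` becomes a transformation law for the transform. -/
lemma rayTransform_inv {s : ℂ} (hs : 0 < s.re) {W : ℂ → E} (hW : IsRapid W)
    (A : E →L[ℂ] E) (hA : ∀ w : ℂ, |w.im| < Real.pi / 2 → W (-w) = A (W w)) {ζ : ℂ}
    (hζ : ζ ∈ slitPlane) :
    A (rayTransform s W ζ) = ζ ^ (-2 * s) • rayTransform s W ζ⁻¹ := by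
  rw [rayTransform, rayTransform, mul_smul (2 * s), map_smul,
    cpow_neg_smul_coshConv_inv (by simp; linarith) hW A hA hζ]
  module

/-- The law `y⁻¹ U(1/y) = -A (y U(y))` becomes a transformation law for the primitive; the sign is
opposite to that in `rayTransform_inv`. -/
lemma rayPrimitive_inv {s : ℂ} (hs : 0 < s.re) {W : ℂ → E} (hW : IsRapid W)
    (A : E →L[ℂ] E) (hA : ∀ w : ℂ, |w.im| < Real.pi / 2 → exp (-w) • W (-w) = -A (exp w • W w))
    {ζ : ℂ} (hζ : ζ ∈ slitPlane) :
    A (rayPrimitive s W ζ) = -(ζ ^ (-2 * s) • rayPrimitive s W ζ⁻¹) := by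
  have := cpow_neg_smul_coshConv_inv (s := s) hs (W := fun w ↦ exp w • W w)
    (by simpa using hW.exp_smul 1) (-A) (by simpa using hA) hζ
  rw [rayPrimitive, rayPrimitive, ← this]
  simp

/-- The integrated form of `rayTransform_jump_upper`. -/
theorem rayPrimitive_jump {s : ℂ} (hs : 0 < s.re) {F G : ℂ → E} (hF : IsExpDecay F)
    (hU : IsRapid fun w ↦ abel s F (exp w)) (hG : ∀ q : ℂ, 0 < q.re → HasDerivAt G (I • F q) q)
    (hG0 : Tendsto (fun t : ℝ ↦ G t) atTop (𝓝 0)) {ζ : ℂ} (hζ : 0 < ζ.im) :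
    exp (Real.pi * I * s) • rayPrimitive s (fun w ↦ abel s F (exp w)) ζ
      - exp (-(Real.pi * I * s)) • rayPrimitive s (fun w ↦ abel s F (exp w)) (-ζ)
      = -((Real.pi : ℂ) • G (-I * ζ)) := by
  set P := rayPrimitive s (fun w ↦ abel s F (exp w)) with hP
  have hd : ∀ z : ℂ, 0 < z.im → HasDerivAt (fun z ↦ exp (Real.pi * I * s) • P z
      - exp (-(Real.pi * I * s)) • P (-z) + (Real.pi : ℂ) • G (-I * z)) 0 z := by
    intro z hz
    have h1 := (hasDerivAt_rayPrimitive hs hU (Or.inr hz.ne')).const_smul (exp (Real.pi * I * s))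
    have h2 := ((hasDerivAt_rayPrimitive hs hU (neg_mem_slitPlane_of_im hz.ne')).scomp z
      (hasDerivAt_neg z)).const_smul (exp (-(Real.pi * I * s)))
    have h3 := ((hG (-I * z) (by simpa using hz)).scomp z
      ((hasDerivAt_id z).const_mul (-I))).const_smul (Real.pi : ℂ)
    refine ((h1.sub h2).add h3).congr_deriv ?_
    have := rayTransform_jump_upper hs hF hU hz
    rw [mul_one, smul_smul (-I), show -I * I = 1 by simp, one_smul, ← this]
    simp only [smul_neg, neg_smul, one_smul]
    abel
  have hconst : ∀ t : ℝ, 0 < t → exp (Real.pi * I * s) • P ζ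
      - exp (-(Real.pi * I * s)) • P (-ζ) + (Real.pi : ℂ) • G (-I * ζ)
      = exp (Real.pi * I * s) • P (t * I)
      - exp (-(Real.pi * I * s)) • P (-(t * I)) + (Real.pi : ℂ) • G t := by
    intro t ht
    have := (convex_halfSpace_im_gt 0).is_const_of_fderivWithin_eq_zero (𝕜 := ℂ)
      (f := fun z ↦ exp (Real.pi * I * s) • P z
        - exp (-(Real.pi * I * s)) • P (-z) + (Real.pi : ℂ) • G (-I * z))
      (fun z hz ↦ (hd z hz).differentiableAt.differentiableWithinAt) (fun z hz ↦ ?_)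
      (x := ζ) (y := t * I) hζ (by simpa using ht)
    · rw [this]
      congr 3
      linear_combination (-(t : ℂ)) * I_sq
    · rw [fderivWithin_of_isOpen (isOpen_lt continuous_const continuous_im) hz,
        (hd z hz).hasFDerivAt.fderiv]
      ext; simp
  have hP0 : ∀ c : ℂ, c = I ∨ c = -I → Tendsto (fun t : ℝ ↦ P (t * c)) atTop (𝓝 0) := by
    intro c hc
    obtain ⟨K, hK0, hK⟩ := norm_rayPrimitive_le hs hU (δ := Real.pi / 2) (by positivity)
    have hl : Tendsto (fun t : ℝ ↦ K * t ^ (-(2 * s.re))) atTop (𝓝 0) := by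
      simpa using (tendsto_rpow_neg_atTop (show 0 < 2 * s.re by linarith)).const_mul K
    refine squeeze_zero_norm' ?_ hl
    filter_upwards [eventually_gt_atTop 0] with t ht
    have hc1 : ‖(t : ℂ) * c‖ = t := by
      rcases hc with rfl | rfl <;> simp [abs_of_pos ht]
    have hne : (t : ℂ) * c ≠ 0 := by rw [← norm_pos_iff, hc1]; exact ht
    refine (hK _ hne ?_).trans ?_
    · rw [arg_real_mul _ ht, show Real.pi - Real.pi / 2 = Real.pi / 2 by ring]
      rcases hc with rfl | rfl
      · rw [arg_I, abs_of_pos (by positivity)]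
      · rw [arg_neg_I, abs_neg, abs_of_pos (by positivity)]
    · rw [hc1]
      exact mul_le_mul_of_nonneg_left (min_le_right _ _) hK0
  have hlim : Tendsto (fun t : ℝ ↦ exp (Real.pi * I * s) • P (t * I)
      - exp (-(Real.pi * I * s)) • P (-(t * I)) + (Real.pi : ℂ) • G t) atTop (𝓝 0) := by
    have h2 := hP0 (-I) (Or.inr rfl)
    simp only [mul_neg] at h2
    simpa using (((hP0 I (Or.inl rfl)).const_smul (exp (Real.pi * I * s))).sub
      (h2.const_smul (exp (-(Real.pi * I * s))))).add (hG0.const_smul (Real.pi : ℂ))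
  have := tendsto_nhds_unique (tendsto_const_nhds.congr' (by
    filter_upwards [eventually_gt_atTop 0] with t ht using hconst t ht)) hlim
  exact eq_neg_of_add_eq_zero_left this

omit [CompleteSpace E] in
/-- A functional equation under `w ↦ -w` carries rapid decay from one end of the strip to the
other. -/
lemma IsRapid.of_neg {W : ℂ → E} (hd : DifferentiableOn ℂ W {w | |w.im| < Real.pi / 2})
    (hb : ∀ n δ : ℝ, 0 < δ → ∃ C, ∀ w : ℂ, |w.im| ≤ Real.pi / 2 - δ → 0 ≤ w.re →
      ‖W w‖ ≤ C * Real.exp (-n * |w.re|)) {M k : ℝ} (hM : 0 ≤ M)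
    (hW : ∀ w : ℂ, |w.im| < Real.pi / 2 → ‖W (-w)‖ ≤ M * Real.exp (k * |w.re|) * ‖W w‖) :
    IsRapid W where
  diff := hd
  decay n δ hδ := by
    obtain ⟨C, hC⟩ := hb n δ hδ
    obtain ⟨D, hD⟩ := hb (n + k) δ hδ
    refine ⟨max C (M * D), fun w hw ↦ ?_⟩
    rcases le_total 0 w.re with h | h
    · exact (hC w hw h).trans (mul_le_mul_of_nonneg_right (le_max_left _ _) (Real.exp_pos _).le)
    · have h1 := hD (-w) (by simpa using hw) (by simpa using h)
      have h2 := hW (-w) (by simpa using hw.trans_lt (by linarith))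
      rw [neg_neg] at h2
      rw [neg_re, abs_neg] at h1 h2
      refine h2.trans ((mul_le_mul_of_nonneg_left h1 (by positivity)).trans ?_)
      calc M * Real.exp (k * |w.re|) * (D * Real.exp (-(n + k) * |w.re|))
          = M * D * (Real.exp (k * |w.re|) * Real.exp (-(n + k) * |w.re|)) := by ring
        _ = M * D * Real.exp (-n * |w.re|) := by rw [← Real.exp_add]; ring_nf
        _ ≤ _ := mul_le_mul_of_nonneg_right (le_max_right _ _) (Real.exp_pos _).le

lemma exp_re_pos_of_abs_im_lt {w : ℂ} (hw : |w.im| < Real.pi / 2) : 0 < (exp w).re := by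
  rw [exp_re]
  exact mul_pos (Real.exp_pos _) (Real.cos_pos_of_mem_Ioo (abs_lt.1 hw))

/-- An Abel transform that is controlled under `y ↦ 1/y` decays rapidly both at infinity and at the
origin. -/
lemma isRapid_abel {F : ℂ → E} (hF : IsExpDecay F) {s : ℂ} (hs : 0 < s.re) {M k : ℝ} (hM : 0 ≤ M)
    (h : ∀ w : ℂ, |w.im| < Real.pi / 2 →
      ‖abel s F (exp (-w))‖ ≤ M * Real.exp (k * |w.re|) * ‖abel s F (exp w)‖) :
    IsRapid fun w ↦ abel s F (exp w) := by
  refine IsRapid.of_neg ((differentiableOn_abel hF hs).comp differentiable_exp.differentiableOn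
    fun w hw ↦ exp_re_pos_of_abs_im_lt hw) (fun n δ hδ ↦ ?_) hM h
  obtain ⟨c, hc, hb⟩ := hF.norm_abel_le hs
  obtain ⟨δ, hδ, hδ2, hle⟩ : ∃ ε : ℝ, 0 < ε ∧ ε < Real.pi / 2 ∧ ε ≤ δ :=
    ⟨min δ (Real.pi / 4), lt_min hδ (by positivity),
      (min_le_right _ _).trans_lt (by linarith [Real.pi_pos]), min_le_left _ _⟩
  have hsin : 0 < Real.sin δ := Real.sin_pos_of_pos_of_lt_pi hδ (by linarith [Real.pi_pos])
  obtain ⟨C, hC0, hC⟩ := hb (Real.sin δ) hsin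
  have hm : 0 < s.re + |n| := by positivity
  refine ⟨C * ((s.re + |n|) / (c * Real.sin δ)) ^ (s.re + |n|), fun w hw hw0 ↦ ?_⟩
  have hcos : Real.sin δ ≤ Real.cos w.im := by
    rw [← Real.cos_pi_div_two_sub, ← Real.cos_abs w.im]
    exact Real.cos_le_cos_of_nonneg_of_le_pi (abs_nonneg _) (by linarith) (by linarith)
  have h1 : 1 ≤ Real.exp w.re := Real.one_le_exp hw0
  have hre : Real.sin δ * Real.exp w.re ≤ (exp w).re := by
    rw [exp_re, mul_comm]
    exact mul_le_mul_of_nonneg_left hcos (Real.exp_pos _).le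
  refine (hC (exp w) (by nlinarith)).trans ?_
  rw [norm_exp, mul_assoc]
  refine mul_le_mul_of_nonneg_left ?_ hC0
  have h2 := rpow_le_mul_exp (Real.exp_pos w.re) hm (mul_pos hc hsin)
  rw [Real.rpow_add (Real.exp_pos _)] at h2
  have h3 : Real.exp (-c * (exp w).re) ≤ Real.exp (-(c * Real.sin δ * Real.exp w.re)) :=
    Real.exp_le_exp.2 (by nlinarith)
  have h4 : Real.exp (|n| * w.re) = Real.exp w.re ^ |n| := by rw [← Real.exp_mul, mul_comm]
  have h5 : Real.exp (-|n| * w.re) ≤ Real.exp (-n * |w.re|) := by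
    rw [abs_of_nonneg hw0]
    exact Real.exp_le_exp.2 (by nlinarith [le_abs_self n])
  refine le_trans ?_ (mul_le_mul_of_nonneg_left h5 (by positivity))
  have h6 : Real.exp w.re ^ s.re ≤ ((s.re + |n|) / (c * Real.sin δ)) ^ (s.re + |n|)
      * Real.exp (c * Real.sin δ * Real.exp w.re) * Real.exp (-|n| * w.re) := by
    rw [← h4] at h2
    have h7 := mul_le_mul_of_nonneg_right h2 (Real.exp_pos (-|n| * w.re)).le
    rwa [mul_assoc, ← Real.exp_add, neg_mul, add_neg_cancel, Real.exp_zero, mul_one,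
      ← neg_mul] at h7
  calc _ ≤ (((s.re + |n|) / (c * Real.sin δ)) ^ (s.re + |n|)
      * Real.exp (c * Real.sin δ * Real.exp w.re) * Real.exp (-|n| * w.re))
        * Real.exp (-(c * Real.sin δ * Real.exp w.re)) := by gcongr
    _ = ((s.re + |n|) / (c * Real.sin δ)) ^ (s.re + |n|) * Real.exp (-|n| * w.re)
        * (Real.exp (c * Real.sin δ * Real.exp w.re)
          * Real.exp (-(c * Real.sin δ * Real.exp w.re))) := by ring
    _ = _ := by rw [← Real.exp_add, add_neg_cancel, Real.exp_zero, mul_one]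

/-- The holomorphic continuation of `f(z) - z^{-2s} A f(-1/z)` across the positive half line, for a
function `f` on `ℂ ∖ ℝ` built from `F₀` and `F₁`, whose Abel transforms `U₀` (of `F₀`) and `U₁`
(of `-i F₁'`) obey the transformation laws of the values and of the normal derivative of an
invariant function on the imaginary axis. The continuation is a multiple of `D - P`, where `D` is the
transform of `U₀` and `P` the primitive of the transform of `U₁`: the jump formulas express `f` in
terms of `D ± P`, and the inversion `z ↦ -1/z` recombines these. -/
theorem exists_period_extension {s : ℂ} (hs : 0 < s.re) {F₀ F₁ G₁ : ℂ → E} (A : E →L[ℂ] E)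
    (hF₀ : IsExpDecay F₀) (hG₁ : IsExpDecay G₁)
    (hF₁ : ∀ q : ℂ, 0 < q.re → HasDerivAt F₁ (I • G₁ q) q)
    (hF₁0 : Tendsto (fun t : ℝ ↦ F₁ t) atTop (𝓝 0))
    (h₀ : ∀ y : ℂ, 0 < y.re → abel s F₀ y⁻¹ = A (abel s F₀ y))
    (h₁ : ∀ y : ℂ, 0 < y.re → abel s G₁ y⁻¹ = -(y ^ 2 • A (abel s G₁ y)))
    {f : ℂ → E} (hfu : ∀ z : ℂ, 0 < z.im → f z = (1 / 2 : ℂ) • (F₁ (-I * z) + F₀ (-I * z)))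
    (hfl : ∀ z : ℂ, z.im < 0 → f z = (1 / 2 : ℂ) • (F₁ (I * z) - F₀ (I * z))) :
    ∃ ψ : ℂ → E, DifferentiableOn ℂ ψ slitPlane ∧
      (∀ δ : ℝ, 0 < δ → ∃ K, ∀ z ∈ slitPlane, |arg z| ≤ Real.pi - δ →
        ‖ψ z‖ ≤ K * min 1 (‖z‖ ^ (-(2 * s.re)))) ∧
      ∀ z : ℂ, z.im ≠ 0 → ψ z = f z - z ^ (-2 * s) • A (f (-1 / z)) := by
  have hU₀ : IsRapid fun w ↦ abel s F₀ (exp w) := by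
    refine isRapid_abel hF₀ hs (M := ‖A‖) (k := 0) (norm_nonneg _) fun w hw ↦ ?_
    rw [exp_neg, h₀ _ (exp_re_pos_of_abs_im_lt hw), zero_mul, Real.exp_zero, mul_one]
    exact A.le_opNorm _
  have hU₁ : IsRapid fun w ↦ abel s G₁ (exp w) := by
    refine isRapid_abel hG₁ hs (M := ‖A‖) (k := 2) (norm_nonneg _) fun w hw ↦ ?_
    rw [exp_neg, h₁ _ (exp_re_pos_of_abs_im_lt hw), norm_neg, norm_smul, norm_pow, norm_exp,
      mul_comm ‖A‖, mul_assoc, ← Real.exp_nat_mul]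
    refine mul_le_mul (Real.exp_le_exp.2 ?_) (A.le_opNorm _) (norm_nonneg _) (Real.exp_pos _).le
    push_cast
    linarith [le_abs_self w.re]
  set D := rayTransform s fun w ↦ abel s F₀ (exp w) with hD
  set P := rayPrimitive s fun w ↦ abel s G₁ (exp w) with hP
  set a := exp (Real.pi * I * s) with ha
  set b := exp (-(Real.pi * I * s)) with hb
  have hDi : ∀ z ∈ slitPlane, A (D z) = z ^ (-2 * s) • D z⁻¹ := fun z hz ↦
    rayTransform_inv hs hU₀ A (fun w hw ↦ by
      rw [exp_neg, h₀ _ (exp_re_pos_of_abs_im_lt hw)]) hz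
  have hPi : ∀ z ∈ slitPlane, A (P z) = -(z ^ (-2 * s) • P z⁻¹) := fun z hz ↦
    rayPrimitive_inv hs hU₁ A (fun w hw ↦ by
      rw [exp_neg, h₁ _ (exp_re_pos_of_abs_im_lt hw), smul_neg, smul_smul, map_smul]
      congr 2
      field_simp [exp_ne_zero w]) hz
  have hJ₀ : ∀ z : ℂ, 0 < z.im → a • D z + b • D (-z) = (Real.pi : ℂ) • F₀ (-I * z) := fun z hz ↦
    rayTransform_jump_upper hs hF₀ hU₀ hz
  have hJ₁ : ∀ z : ℂ, 0 < z.im → a • P z - b • P (-z) = -((Real.pi : ℂ) • F₁ (-I * z)) :=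
    fun z hz ↦ rayPrimitive_jump hs hG₁ hU₁ hF₁ hF₁0 hz
  have hpi : (Real.pi : ℂ) ≠ 0 := by exact_mod_cast Real.pi_ne_zero
  have hab : a * b = 1 := by rw [ha, hb, ← exp_add, add_neg_cancel, exp_zero]
  -- `f` in terms of the continued transforms at `z` and `-z`
  have hfu' : ∀ z : ℂ, 0 < z.im →
      f z = (1 / (2 * Real.pi) : ℂ) • (a • (D z - P z) + b • (D (-z) + P (-z))) := by
    intro z hz
    have e : a • (D z - P z) + b • (D (-z) + P (-z))
        = (Real.pi : ℂ) • (F₁ (-I * z) + F₀ (-I * z)) := by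
      rw [smul_add (Real.pi : ℂ), ← hJ₀ z hz, ← neg_neg ((Real.pi : ℂ) • F₁ (-I * z)), ← hJ₁ z hz]
      simp only [smul_add, smul_sub]; abel
    rw [hfu z hz, e, smul_smul]
    congr 1; field_simp
  have hfl' : ∀ z : ℂ, z.im < 0 →
      f z = -((1 / (2 * Real.pi) : ℂ) • (a • (D (-z) + P (-z)) + b • (D z - P z))) := by
    intro z hz
    have h1 := hJ₀ (-z) (by simpa using hz)
    have h2 := hJ₁ (-z) (by simpa using hz)
    rw [neg_neg, show -I * -z = I * z by ring] at h1 h2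
    have e : a • (D (-z) + P (-z)) + b • (D z - P z)
        = -((Real.pi : ℂ) • (F₁ (I * z) - F₀ (I * z))) := by
      rw [smul_sub (Real.pi : ℂ), ← h1, ← neg_neg ((Real.pi : ℂ) • F₁ (I * z)), ← h2]
      simp only [smul_add, smul_sub]; abel
    rw [hfl z hz, e, smul_neg, neg_neg, smul_smul]
    congr 1; field_simp
  -- The transformation law under `z ↦ 1/z` interchanges `D - P` and `D + P`.
  have hm : ∀ z ∈ slitPlane, A (D z - P z) = z ^ (-2 * s) • (D z⁻¹ + P z⁻¹) := fun z hz ↦ by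
    rw [map_sub, hDi z hz, hPi z hz, smul_add, sub_neg_eq_add]
  have hp : ∀ z ∈ slitPlane, A (D z + P z) = z ^ (-2 * s) • (D z⁻¹ - P z⁻¹) := fun z hz ↦ by
    rw [map_add, hDi z hz, hPi z hz, smul_sub, sub_eq_add_neg]
  refine ⟨fun z ↦ ((a - b) / (2 * Real.pi)) • (D z - P z), ?_, fun δ hδ ↦ ?_, fun z hz ↦ ?_⟩
  · exact ((differentiableOn_rayTransform hs hU₀).sub
      (differentiableOn_rayPrimitive hs hU₁)).const_smul _
  · obtain ⟨K, hK0, hK⟩ := norm_rayTransform_le hs hU₀ hδ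
    obtain ⟨L, hL0, hL⟩ := norm_rayPrimitive_le hs hU₁ hδ
    refine ⟨‖(a - b) / (2 * Real.pi)‖ * (K + L), fun z hz hzδ ↦ ?_⟩
    have h0 := slitPlane_ne_zero hz
    rw [norm_smul, mul_assoc]
    refine mul_le_mul_of_nonneg_left ?_ (norm_nonneg _)
    refine (norm_sub_le _ _).trans ?_
    rw [add_mul]
    exact add_le_add (hK z h0 hzδ) (hL z h0 hzδ)
  · have hzs : z ∈ slitPlane := Or.inr hz
    have h0 := slitPlane_ne_zero hzs
    have hnz := neg_mem_slitPlane_of_im hz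
    have hpow1 : z ^ (-2 * s) * z⁻¹ ^ (-2 * s) = 1 := by
      rw [inv_cpow _ _ (mem_slitPlane_iff_arg.1 hzs).1, mul_inv_cancel₀]
      simp [cpow_eq_zero_iff, h0]
    have hpow2 : (-z) ^ (-2 * s) * (-z)⁻¹ ^ (-2 * s) = 1 := by
      rw [inv_cpow _ _ (mem_slitPlane_iff_arg.1 hnz).1, mul_inv_cancel₀]
      simp [cpow_eq_zero_iff, h0]
    have e1 : -1 / z = (-z)⁻¹ := by rw [inv_neg, neg_div, one_div]
    have e2 : -(-1 / z) = z⁻¹ := by rw [neg_div, one_div, neg_neg]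
    have i1 := inv_mem_slitPlane hzs
    have i2 := inv_mem_slitPlane hnz
    have hN : 0 < normSq z := normSq_pos.2 h0
    have him : (-1 / z).im = z.im / normSq z := by rw [e1, inv_im, normSq_neg, neg_im, neg_neg]
    -- the contributions of `D + P` cancel because `z^{-2s} (-1/z)^{-2s}` is `a²` or `b²`
    rcases lt_or_gt_of_ne hz with hz | hz
    · have h3 : z ^ (-2 * s) * (-z)⁻¹ ^ (-2 * s) = a * a := by
        rw [cpow_eq_neg_of_im_neg _ hz, mul_assoc, hpow2, mul_one, ha, ← exp_add]
        congr 1; ring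
      rw [hfl' z hz, hfl' (-1 / z) (by rw [him]; exact div_neg_of_neg_of_pos hz hN)]
      rw [map_neg, map_smul, map_add, map_smul, map_smul, e2, e1, hm _ i2, hp _ i1, inv_inv,
        inv_inv]
      match_scalars
      · linear_combination (-(1 / (2 * Real.pi)) * a) * hpow1
      · linear_combination (1 / (2 * Real.pi) * a) * hpow1
      all_goals linear_combination (-(1 / (2 * Real.pi)) * b) * h3 - 1 / (2 * Real.pi) * a * hab
    · have h3 : z ^ (-2 * s) * (-z)⁻¹ ^ (-2 * s) = b * b := by
        rw [cpow_eq_neg_of_im_pos _ hz, mul_assoc, hpow2, mul_one, hb, ← exp_add]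
        congr 1; ring
      rw [hfu' z hz, hfu' (-1 / z) (by rw [him]; exact div_pos hz hN)]
      rw [map_smul, map_add, map_smul, map_smul, e2, e1, hm _ i2, hp _ i1, inv_inv, inv_inv]
      match_scalars
      · linear_combination (1 / (2 * Real.pi) * b) * hpow1
      · linear_combination (-(1 / (2 * Real.pi)) * b) * hpow1
      all_goals linear_combination (1 / (2 * Real.pi) * a) * h3 + 1 / (2 * Real.pi) * b * hab

end Continuation

/-! ### Bessel functions -/

section Bessel

/-- The data of a Laplace integral `∫ exp(-x c(a)) m(a) dμ(a)`, convergent for all `x > 0`, with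
exponents `c ≥ 1`. -/
structure LaplaceData {α : Type*} [MeasurableSpace α] (μ : Measure α) (c : α → ℝ) (m : α → ℂ) :
    Prop where
  one_le : ∀ᵐ a ∂μ, 1 ≤ c a
  meas : AEStronglyMeasurable c μ
  integrable : ∀ x : ℝ, 0 < x → Integrable (fun a ↦ exp (-(x * c a : ℝ)) * m a) μ

/-- The Laplace integral `∫ exp(-x c(a)) m(a) dμ(a)`. -/
def laplace {α : Type*} [MeasurableSpace α] (μ : Measure α) (c : α → ℝ) (m : α → ℂ) (x : ℝ) : ℂ :=
  ∫ a, exp (-(x * c a : ℝ)) * m a ∂μ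

variable {α : Type*} [MeasurableSpace α] {μ : Measure α} {c : α → ℝ} {m : α → ℂ}

lemma mul_exp_neg_le {x : ℝ} (hx : 0 < x) (t : ℝ) : t * Real.exp (-(x * t)) ≤ 1 / x := by
  have h1 := Real.add_one_le_exp (x * t)
  rw [Real.exp_neg, ← div_eq_mul_inv, div_le_div_iff₀ (Real.exp_pos _) hx]
  linarith

lemma LaplaceData.mul (h : LaplaceData μ c m) : LaplaceData μ c (fun a ↦ -(c a * m a)) where
  one_le := h.one_le
  meas := h.meas
  integrable x hx := by
    have h1 := (h.integrable (x / 2) (half_pos hx)).bdd_smul (1 / (x / 2))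
      (φ := fun a ↦ -((c a * Real.exp (-(x / 2 * c a)) : ℝ) : ℂ)) ?_ ?_
    · refine h1.congr (Eventually.of_forall fun a ↦ ?_)
      simp only [Pi.smul_apply', smul_eq_mul]
      have : exp (-(x * c a : ℝ)) = exp (-(x / 2 * c a : ℝ)) * exp (-(x / 2 * c a : ℝ)) := by
        rw [← exp_add]; congr 1; push_cast; ring
      rw [this, ofReal_mul, ofReal_exp, ofReal_neg]
      ring
    · refine (continuous_ofReal.comp_aestronglyMeasurable
        (h.meas.mul (Real.continuous_exp.comp_aestronglyMeasurable
          (h.meas.const_mul (x / 2)).neg))).neg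
    · filter_upwards [h.one_le] with a ha
      rw [norm_neg, norm_real, Real.norm_of_nonneg (by positivity)]
      exact mul_exp_neg_le (half_pos hx) _

lemma LaplaceData.hasDerivAt (h : LaplaceData μ c m) {x : ℝ} (hx : 0 < x) :
    HasDerivAt (laplace μ c m) (laplace μ c (fun a ↦ -(c a * m a)) x) x := by
  refine (hasDerivAt_integral_of_dominated_loc_of_deriv_le
    (F := fun x a ↦ exp (-(x * c a : ℝ)) * m a)
    (F' := fun x a ↦ exp (-(x * c a : ℝ)) * -(c a * m a))
    (bound := fun a ↦ ‖exp (-(x / 2 * c a : ℝ)) * -(c a * m a)‖)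
    (Ioi_mem_nhds (half_lt_self hx)) ?_ (h.integrable x hx)
    (h.mul.integrable x hx).aestronglyMeasurable ?_ (h.mul.integrable _ (half_pos hx)).norm ?_).2
  · filter_upwards [Ioi_mem_nhds hx] with y hy using (h.integrable y hy).aestronglyMeasurable
  · filter_upwards [h.one_le] with a ha y hy
    have hy : x / 2 < y := hy
    rw [norm_mul, norm_mul, norm_exp, norm_exp]
    refine mul_le_mul_of_nonneg_right (Real.exp_le_exp.2 ?_) (norm_nonneg _)
    simp only [neg_re, ofReal_re]
    nlinarith
  · refine Eventually.of_forall fun a y _ ↦ ?_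
    have h1 : HasDerivAt (fun y : ℝ ↦ -((y * c a : ℝ) : ℂ)) (-(c a : ℂ)) y := by
      simpa using ((hasDerivAt_id y).mul_const (c a)).ofReal_comp.fun_neg
    exact (h1.cexp.mul_const (m a)).congr_deriv (by ring)

lemma LaplaceData.norm_le (h : LaplaceData μ c m) :
    ∃ M, 0 ≤ M ∧ ∀ x : ℝ, 1 ≤ x → ‖laplace μ c m x‖ ≤ M * Real.exp (-x) := by
  refine ⟨Real.exp 1 * ∫ a, ‖exp (-(1 * c a : ℝ)) * m a‖ ∂μ, by positivity, fun x hx ↦ ?_⟩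
  rw [mul_right_comm, ← Real.exp_add, ← integral_const_mul]
  refine norm_integral_le_of_norm_le ((h.integrable 1 one_pos).norm.const_mul _) ?_
  filter_upwards [h.one_le] with a ha
  rw [norm_mul, norm_mul, norm_exp, norm_exp, ← mul_assoc, ← Real.exp_add]
  refine mul_le_mul_of_nonneg_right (Real.exp_le_exp.2 ?_) (norm_nonneg _)
  simp only [neg_re, ofReal_re]
  nlinarith

/-- A Laplace integral `L` that satisfies `x L'' + 2κ L' = (x + τ/x) L` yields the solution
`x^κ L` of an equation without first order term. -/
lemma LaplaceData.normal_form (h : LaplaceData μ c m) {κ τ ρ : ℂ} (hρ : ρ = τ + κ * (κ - 1))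
    (hL : ∀ x : ℝ, 0 < x → x * laplace μ c (fun a ↦ -(c a * -(c a * m a))) x
      + 2 * κ * laplace μ c (fun a ↦ -(c a * m a)) x = (x + τ / x) * laplace μ c m x) :
    ∃ b' : ℝ → ℂ, (∀ x : ℝ, 0 < x → HasDerivAt (fun x : ℝ ↦ (x : ℂ) ^ κ * laplace μ c m x) (b' x) x) ∧
      (∀ x : ℝ, 0 < x → HasDerivAt b' ((1 + ρ / x ^ 2) * ((x : ℂ) ^ κ * laplace μ c m x)) x) ∧
      ∃ C, 0 ≤ C ∧ ∀ x : ℝ, 1 ≤ x → ‖(x : ℂ) ^ κ * laplace μ c m x‖ ≤ C * Real.exp (-(x / 2)) ∧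
        ‖b' x‖ ≤ C * Real.exp (-(x / 2)) := by
  have hpow : ∀ (r : ℂ) (x : ℝ), 0 < x →
      HasDerivAt (fun x : ℝ ↦ (x : ℂ) ^ r) (r * (x : ℂ) ^ (r - 1)) x := by
    intro r x hx
    have := (hasDerivAt_id (x : ℂ)).cpow_const (c := r) (Or.inl (by simpa using hx))
    simpa using this.comp_ofReal
  refine ⟨fun x ↦ κ * (x : ℂ) ^ (κ - 1) * laplace μ c m x
    + (x : ℂ) ^ κ * laplace μ c (fun a ↦ -(c a * m a)) x,
    fun x hx ↦ (hpow κ x hx).mul (h.hasDerivAt hx), fun x hx ↦ ?_, ?_⟩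
  · have h1 := (((hpow (κ - 1) x hx).const_mul κ).mul (h.hasDerivAt hx)).add
      ((hpow κ x hx).mul (h.mul.hasDerivAt hx))
    refine h1.congr_deriv ?_
    have hx0 : (x : ℂ) ≠ 0 := by exact_mod_cast hx.ne'
    have e := hL x hx
    have e1 : (x : ℂ) ^ κ = (x : ℂ) ^ (κ - 1 - 1) * x ^ 2 := by
      rw [cpow_sub (κ - 1) _ hx0, cpow_sub κ _ hx0, cpow_one]; field_simp
    have e2 : (x : ℂ) ^ (κ - 1) = (x : ℂ) ^ (κ - 1 - 1) * x := by
      rw [cpow_sub (κ - 1) _ hx0, cpow_one]; field_simp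
    rw [e1, e2, hρ]
    set p := (x : ℂ) ^ (κ - 1 - 1)
    field_simp at e ⊢
    linear_combination p * e
  · obtain ⟨M, hM0, hM⟩ := h.norm_le
    obtain ⟨M', hM0', hM'⟩ := h.mul.norm_le
    set σ := |κ.re| + 1 with hσ
    have hσ0 : 0 < σ := by positivity
    set A := (σ / (1 / 2)) ^ σ with hA
    have hA0 : 0 ≤ A := by positivity
    have hx2 : ∀ (r : ℂ) (x : ℝ), r.re ≤ σ → 1 ≤ x → ‖(x : ℂ) ^ r‖ * Real.exp (-x)
        ≤ A * Real.exp (-(x / 2)) := by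
      intro r x hr hx
      have hx0 : 0 < x := by linarith
      rw [norm_cpow_eq_rpow_re_of_pos hx0]
      have h1 := (Real.rpow_le_rpow_of_exponent_le hx hr).trans
        (rpow_le_mul_exp hx0 hσ0 (κ := 1 / 2) (by norm_num))
      calc _ ≤ A * Real.exp (1 / 2 * x) * Real.exp (-x) := by gcongr
        _ = _ := by rw [mul_assoc, ← Real.exp_add]; ring_nf
    have hκ : κ.re ≤ σ := by linarith [le_abs_self κ.re]
    have hκ1 : (κ - 1).re ≤ σ := by simp only [sub_re, one_re]; linarith
    have hb : ∀ (r : ℂ) (x N : ℝ) (l : ℂ), r.re ≤ σ → 1 ≤ x → 0 ≤ N → ‖l‖ ≤ N * Real.exp (-x) →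
        ‖(x : ℂ) ^ r * l‖ ≤ N * A * Real.exp (-(x / 2)) := by
      intro r x N l hr hx hN hl
      rw [norm_mul]
      calc _ ≤ ‖(x : ℂ) ^ r‖ * (N * Real.exp (-x)) := by gcongr
        _ = N * (‖(x : ℂ) ^ r‖ * Real.exp (-x)) := by ring
        _ ≤ N * (A * Real.exp (-(x / 2))) := mul_le_mul_of_nonneg_left (hx2 r x hr hx) hN
        _ = _ := by ring
    refine ⟨M * A + (‖κ‖ * M * A + M' * A), by positivity, fun x hx ↦ ⟨?_, ?_⟩⟩
    · refine (hb κ x M _ hκ hx hM0 (hM x hx)).trans ?_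
      gcongr
      linarith [show 0 ≤ ‖κ‖ * M * A + M' * A by positivity]
    · refine (norm_add_le _ _).trans ?_
      have h1 := hb (κ - 1) x M _ hκ1 hx hM0 (hM x hx)
      have h2 := hb κ x M' _ hκ hx hM0' (hM' x hx)
      rw [mul_assoc, norm_mul]
      have h3 := mul_le_mul_of_nonneg_left h1 (norm_nonneg κ)
      have h4 : 0 ≤ M * A * Real.exp (-(x / 2)) := by positivity
      nlinarith

lemma one_add_sq_div_two_le_cosh (t : ℝ) : 1 + t ^ 2 / 2 ≤ Real.cosh t := by
  have h1 : Real.cosh t = 1 + 2 * Real.sinh (t / 2) ^ 2 := by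
    have h := Real.cosh_two_mul (t / 2)
    rw [Real.cosh_sq, show 2 * (t / 2) = t by ring] at h
    linarith
  have h2 : (t / 2) ^ 2 ≤ Real.sinh (t / 2) ^ 2 := by
    rw [sq_le_sq]
    rcases le_total 0 (t / 2) with h | h
    · rw [abs_of_nonneg h, abs_of_nonneg (Real.sinh_nonneg_iff.2 h)]
      exact Real.self_le_sinh_iff.2 h
    · rw [abs_of_nonpos h, abs_of_nonpos (Real.sinh_nonpos_iff.2 h)]
      exact neg_le_neg (Real.sinh_le_self_iff.2 h)
  linarith

lemma norm_cosh_le (z : ℂ) : ‖cosh z‖ ≤ Real.exp ‖z‖ := by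
  rw [cosh, norm_div, RCLike.norm_ofNat, div_le_iff₀ two_pos]
  refine (norm_add_le _ _).trans ?_
  rw [norm_exp, norm_exp, neg_re]
  have h1 := Real.exp_le_exp.2 (re_le_norm z)
  have h2 := Real.exp_le_exp.2 ((neg_le_abs _).trans (abs_re_le_norm z))
  linarith

lemma norm_sinh_le (z : ℂ) : ‖sinh z‖ ≤ Real.exp ‖z‖ := by
  rw [sinh, norm_div, RCLike.norm_ofNat, div_le_iff₀ two_pos]
  refine (norm_sub_le _ _).trans ?_
  rw [norm_exp, norm_exp, neg_re]
  have h1 := Real.exp_le_exp.2 (re_le_norm z)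
  have h2 := Real.exp_le_exp.2 ((neg_le_abs _).trans (abs_re_le_norm z))
  linarith

/-- A Gaussian factor absorbs exponentials. -/
lemma exp_quadratic_le {x : ℝ} (hx : 0 < x) (k t : ℝ) :
    Real.exp (-(x * (t ^ 2 / 2)) + k * t) ≤ Real.exp ((k + 1) ^ 2 / (2 * x)) * Real.exp (-1 * t) := by
  rw [← Real.exp_add, Real.exp_le_exp]
  have : x * (t ^ 2 / 2) - (k + 1) * t + (k + 1) ^ 2 / (2 * x) = (x * t - (k + 1)) ^ 2 / (2 * x) := by
    field_simp; ring
  have h2 : 0 ≤ (x * t - (k + 1)) ^ 2 / (2 * x) := by positivity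
  linarith

lemma norm_exp_neg_cosh_mul_le {x : ℝ} (hx : 0 < x) {t k : ℝ} {g : ℂ}
    (hg : ‖g‖ ≤ Real.exp (k * t)) :
    ‖exp (-(x * Real.cosh t : ℝ)) * g‖
      ≤ Real.exp ((k + 1) ^ 2 / (2 * x)) * Real.exp (-1 * t) := by
  refine le_trans ?_ (exp_quadratic_le hx k t)
  rw [norm_mul, norm_exp, Real.exp_add]
  refine mul_le_mul (Real.exp_le_exp.2 ?_) hg (norm_nonneg _) (Real.exp_pos _).le
  simp only [neg_re, ofReal_re]
  nlinarith [one_add_sq_div_two_le_cosh t]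

lemma laplaceData_besselK (ν : ℂ) : LaplaceData (volume.restrict (Set.Ioi (0 : ℝ))) Real.cosh
    fun t ↦ cosh (ν * t) where
  one_le := Eventually.of_forall fun t ↦ Real.one_le_cosh t
  meas := Real.continuous_cosh.aestronglyMeasurable
  integrable x hx := by
    refine Integrable.mono' ((exp_neg_integrableOn_Ioi 0 one_pos).const_mul
      (Real.exp ((‖ν‖ + 1) ^ 2 / (2 * x)))) (Continuous.aestronglyMeasurable ?_) ?_
    · have := Real.continuous_cosh
      fun_prop
    · filter_upwards [ae_restrict_mem measurableSet_Ioi] with t ht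
      have ht : (0 : ℝ) < t := ht
      refine norm_exp_neg_cosh_mul_le hx ((norm_cosh_le _).trans (Real.exp_le_exp.2 ?_))
      simp [abs_of_pos ht]

lemma besselK_eq_laplace (ν : ℂ) : besselK ν =
    laplace (volume.restrict (Set.Ioi (0 : ℝ))) Real.cosh fun t ↦ cosh (ν * t) := rfl

/-- Bessel's equation. -/
lemma besselK_ode (ν : ℂ) {x : ℝ} (hx : 0 < x) :
    x * laplace (volume.restrict (Set.Ioi (0 : ℝ))) Real.cosh
        (fun t ↦ -(Real.cosh t * -(Real.cosh t * cosh (ν * t)))) x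
      + 2 * (1 / 2) * laplace (volume.restrict (Set.Ioi (0 : ℝ))) Real.cosh
        (fun t ↦ -(Real.cosh t * cosh (ν * t))) x
      = (x + ν ^ 2 / x) * besselK ν x := by
  have hd := laplaceData_besselK ν
  have hx0 : (x : ℂ) ≠ 0 := by exact_mod_cast hx.ne'
  -- Integrate the derivative of `φ' g - φ g'`, where `φ = exp(-x cosh t)` and `g = cosh (ν t)`.
  have hderiv : ∀ t : ℝ, HasDerivAt (fun t : ℝ ↦ exp (-(x * Real.cosh t : ℝ)) *
      (-(x * sinh t) * cosh (ν * t) - ν * sinh (ν * t)))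
      (x * (x * (exp (-(x * Real.cosh t : ℝ)) * -(Real.cosh t * -(Real.cosh t * cosh (ν * t))))
      + exp (-(x * Real.cosh t : ℝ)) * -(Real.cosh t * cosh (ν * t))
      - (x + ν ^ 2 / x) * (exp (-(x * Real.cosh t : ℝ)) * cosh (ν * t)))) t := by
    intro t
    have h1 : HasDerivAt (fun t : ℝ ↦ -((x * Real.cosh t : ℝ) : ℂ)) (-(x * sinh t)) t := by
      simpa using ((Real.hasDerivAt_cosh t).const_mul x).ofReal_comp.fun_neg
    have h2 : HasDerivAt (fun t : ℝ ↦ cosh (ν * t)) (sinh (ν * t) * ν) t := by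
      have := ((hasDerivAt_id (t : ℂ)).const_mul ν).ccosh.comp_ofReal
      simpa using this
    have h3 : HasDerivAt (fun t : ℝ ↦ sinh (ν * t)) (cosh (ν * t) * ν) t := by
      have := ((hasDerivAt_id (t : ℂ)).const_mul ν).csinh.comp_ofReal
      simpa using this
    have h4 : HasDerivAt (fun t : ℝ ↦ -(x * sinh (t : ℂ))) (-(x * cosh t)) t :=
      ((hasDerivAt_sinh (t : ℂ)).const_mul (x : ℂ)).neg.comp_ofReal
    refine (h1.cexp.fun_mul ((h4.fun_mul h2).fun_sub (h3.const_mul ν))).congr_deriv ?_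
    have e := cosh_sq (t : ℂ)
    rw [ofReal_cosh]
    field_simp
    linear_combination (-(x : ℂ) ^ 2 * cosh (ν * t)) * e
  have i0 := hd.integrable x hx
  have i1 := hd.mul.integrable x hx
  have i2 := hd.mul.mul.integrable x hx
  have hlim : Tendsto (fun t : ℝ ↦ exp (-(x * Real.cosh t : ℝ)) *
      (-(x * sinh t) * cosh (ν * t) - ν * sinh (ν * t))) atTop (𝓝 0) := by
    set k := 1 + ‖ν‖ with hk
    have hb : Tendsto (fun t : ℝ ↦ (x + ‖ν‖) * (Real.exp ((k + 1) ^ 2 / (2 * x)) * Real.exp (-1 * t)))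
        atTop (𝓝 0) := by
      have := (Real.tendsto_exp_neg_atTop_nhds_zero.const_mul
        (Real.exp ((k + 1) ^ 2 / (2 * x)))).const_mul (x + ‖ν‖)
      simpa using this
    refine squeeze_zero_norm' ?_ hb
    filter_upwards [eventually_ge_atTop 0] with t ht
    have hn : ‖ν * t‖ = ‖ν‖ * t := by simp [abs_of_nonneg ht]
    have hn1 : ‖(t : ℂ)‖ = t := by simp [abs_of_nonneg ht]
    have h1 : ‖sinh (t : ℂ) * cosh (ν * t)‖ ≤ Real.exp (k * t) := by
      rw [norm_mul, hk, add_mul, Real.exp_add, one_mul]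
      have e1 := norm_sinh_le (t : ℂ)
      have e2 := norm_cosh_le (ν * t)
      rw [hn] at e2
      rw [hn1] at e1
      gcongr
    have h2 : ‖sinh (ν * t)‖ ≤ Real.exp (k * t) := by
      refine (norm_sinh_le _).trans (Real.exp_le_exp.2 ?_)
      rw [hn, hk]; linarith
    have e : exp (-(x * Real.cosh t : ℝ)) * (-(x * sinh t) * cosh (ν * t) - ν * sinh (ν * t))
        = -x * (exp (-(x * Real.cosh t : ℝ)) * (sinh t * cosh (ν * t)))
          - ν * (exp (-(x * Real.cosh t : ℝ)) * sinh (ν * t)) := by ring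
    rw [e, add_mul]
    refine (norm_sub_le _ _).trans (add_le_add ?_ ?_)
    · rw [norm_mul, norm_neg, norm_real, Real.norm_of_nonneg hx.le]
      exact mul_le_mul_of_nonneg_left (norm_exp_neg_cosh_mul_le hx h1) hx.le
    · rw [norm_mul]
      exact mul_le_mul_of_nonneg_left (norm_exp_neg_cosh_mul_le hx h2) (norm_nonneg _)
  have i3 := (((i2.const_mul (x : ℂ)).add i1).sub (i0.const_mul (x + ν ^ 2 / x))).const_mul (x : ℂ)
  have key := integral_Ioi_of_hasDerivAt_of_tendsto (a := (0 : ℝ))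
    (hderiv 0).continuousAt.continuousWithinAt (fun t _ ↦ hderiv t) i3 hlim
  rw [integral_const_mul, integral_sub (by exact (i2.const_mul (x : ℂ)).add i1)
    (by exact i0.const_mul (x + ν ^ 2 / x)), integral_add (by exact i2.const_mul (x : ℂ)) i1,
    integral_const_mul, integral_const_mul] at key
  have key2 := (mul_eq_zero.1 (key.trans (by simp))).resolve_left hx0
  rw [besselK_eq_laplace, laplace, laplace, laplace]
  linear_combination key2

end Bessel

/-! ### The Bessel function as an Abel transform -/

section BesselAbel

lemma norm_exp_neg_mul_one_add (x p : ℝ) :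
    ‖exp (-(x * (1 + p) : ℝ))‖ = Real.exp (-x) * Real.exp (-x * p) := by
  rw [norm_exp, ← Real.exp_add]; congr 1; simp only [neg_re, ofReal_re]; ring

lemma laplaceData_abelWeight {s : ℂ} (hs : 0 < s.re) :
    LaplaceData (volume.restrict (Set.Ioi (0 : ℝ))) (fun p ↦ 1 + p) (abelWeight s) where
  one_le := by
    filter_upwards [ae_restrict_mem measurableSet_Ioi] with p hp
    have hp : (0 : ℝ) < p := hp
    linarith
  meas := by fun_prop
  integrable x hx := by
    refine Integrable.mono' ((integrableOn_abelWeight hs hx).const_mul (Real.exp (-x))) ?_ ?_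
    · exact ContinuousOn.aestronglyMeasurable (ContinuousOn.mul (by fun_prop)
        (continuousOn_abelWeight s)) measurableSet_Ioi
    · filter_upwards [ae_restrict_mem measurableSet_Ioi] with p hp
      rw [norm_mul, norm_exp_neg_mul_one_add, norm_abelWeight s hp, mul_assoc]
      exact mul_le_mul_of_nonneg_left (mul_comm _ _).le (Real.exp_pos _).le

lemma abel_exp_neg (s : ℂ) (x : ℝ) : abel s (fun q ↦ exp (-q)) x
    = (x : ℂ) ^ s * laplace (volume.restrict (Set.Ioi (0 : ℝ))) (fun p ↦ 1 + p) (abelWeight s) x := by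
  rw [abel, smul_eq_mul, laplace]
  congr 2
  ext p
  rw [smul_eq_mul, mul_comm]
  push_cast
  rfl

/-- The differential equation of the Laplace integral of the Abel weight; after multiplication by
`x^s` it becomes that of `√x K_ν(x)`. -/
lemma abel_exp_neg_ode {s : ℂ} (hs : 0 < s.re) {x : ℝ} (hx : 0 < x) :
    x * laplace (volume.restrict (Set.Ioi (0 : ℝ))) (fun p ↦ 1 + p)
        (fun p ↦ -(((1 + p : ℝ) : ℂ) * -(((1 + p : ℝ) : ℂ) * abelWeight s p))) x
      + 2 * s * laplace (volume.restrict (Set.Ioi (0 : ℝ))) (fun p ↦ 1 + p)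
        (fun p ↦ -(((1 + p : ℝ) : ℂ) * abelWeight s p)) x
      = (x + 0 / x) * laplace (volume.restrict (Set.Ioi (0 : ℝ))) (fun p ↦ 1 + p)
        (abelWeight s) x := by
  have hd := laplaceData_abelWeight hs
  have i0 := hd.integrable x hx
  have i1 := hd.mul.integrable x hx
  have i2 := hd.mul.mul.integrable x hx
  have hs0 : s ≠ 0 := by rintro rfl; simp at hs
  have hderiv : ∀ p ∈ Set.Ioi (0 : ℝ), HasDerivAt (fun p : ℝ ↦ exp (-(x * (1 + p) : ℝ)) *
      ((p * (p + 2) : ℝ) : ℂ) ^ s)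
      (x * (exp (-(x * (1 + p) : ℝ)) * abelWeight s p)
        - (x * (exp (-(x * (1 + p) : ℝ)) * -(((1 + p : ℝ) : ℂ) * -(((1 + p : ℝ) : ℂ) * abelWeight s p)))
        + 2 * s * (exp (-(x * (1 + p) : ℝ)) * -(((1 + p : ℝ) : ℂ) * abelWeight s p)))) p := by
    intro p hp
    have hp : (0 : ℝ) < p := hp
    have hpp : 0 < p * (p + 2) := by positivity
    have hpc : ((p * (p + 2) : ℝ) : ℂ) ≠ 0 := by exact_mod_cast hpp.ne'
    have h1 : HasDerivAt (fun p : ℝ ↦ -((x * (1 + p) : ℝ) : ℂ)) (-x) p := by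
      simpa using (((hasDerivAt_id p).const_add 1).const_mul x).ofReal_comp.fun_neg
    have h2 : HasDerivAt (fun p : ℝ ↦ ((p * (p + 2) : ℝ) : ℂ)) ((p + 2 + p : ℝ) : ℂ) p := by
      simpa using ((hasDerivAt_id p).fun_mul ((hasDerivAt_id p).add_const 2)).ofReal_comp
    have h3 := ((hasDerivAt_id ((p * (p + 2) : ℝ) : ℂ)).cpow_const (c := s)
      (Or.inl (by simpa using hpp))).scomp p h2
    refine (h1.cexp.fun_mul h3).congr_deriv ?_
    have e : ((p * (p + 2) : ℝ) : ℂ) ^ s = abelWeight s p * (p * (p + 2) : ℝ) := by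
      rw [abelWeight, cpow_sub _ _ hpc, cpow_one]; field_simp
    simp only [Function.comp_apply, id, smul_eq_mul]
    rw [e, ← abelWeight]
    push_cast
    ring
  have hcont : ContinuousWithinAt (fun p : ℝ ↦ exp (-(x * (1 + p) : ℝ)) *
      ((p * (p + 2) : ℝ) : ℂ) ^ s) (Set.Ici 0) 0 := by
    refine ContinuousAt.continuousWithinAt (ContinuousAt.mul (by fun_prop) ?_)
    exact ContinuousAt.comp (g := fun r : ℝ ↦ (r : ℂ) ^ s) (f := fun p : ℝ ↦ p * (p + 2))
      (continuousAt_ofReal_cpow_const _ _ (Or.inl hs)) (by fun_prop)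
  have hlim : Tendsto (fun p : ℝ ↦ exp (-(x * (1 + p) : ℝ)) *
      ((p * (p + 2) : ℝ) : ℂ) ^ s) atTop (𝓝 0) := by
    set A := (2 * s.re / (x / 2)) ^ (2 * s.re)
    have hb : Tendsto (fun p : ℝ ↦ A * Real.exp (-(x / 2 * (1 + p)))) atTop (𝓝 0) := by
      rw [← mul_zero A]
      refine (Real.tendsto_exp_neg_atTop_nhds_zero.comp ?_).const_mul A
      exact (tendsto_atTop_add_const_left _ 1 tendsto_id).const_mul_atTop (half_pos hx)
    refine squeeze_zero_norm' ?_ hb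
    filter_upwards [eventually_gt_atTop 0] with p hp
    have h1 : (p * (p + 2)) ^ s.re ≤ (1 + p) ^ (2 * s.re) := by
      rw [Real.rpow_mul (by positivity)]
      refine Real.rpow_le_rpow (by positivity) ?_ hs.le
      norm_num; nlinarith
    have h2 := rpow_le_mul_exp (x := 1 + p) (by positivity) (show 0 < 2 * s.re by positivity)
      (half_pos hx)
    rw [norm_mul, norm_cpow_eq_rpow_re_of_pos (by positivity), norm_exp]
    calc _ ≤ Real.exp (-(x * (1 + p))) * (A * Real.exp (x / 2 * (1 + p))) := by
          refine mul_le_mul (by simp) (h1.trans h2) (by positivity) (Real.exp_pos _).le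
      _ = A * (Real.exp (-(x * (1 + p))) * Real.exp (x / 2 * (1 + p))) := by ring
      _ = _ := by rw [← Real.exp_add]; ring_nf
  have key := integral_Ioi_of_hasDerivAt_of_tendsto hcont hderiv
    ((i0.const_mul (x : ℂ)).sub ((i2.const_mul (x : ℂ)).add (i1.const_mul (2 * s)))) hlim
  rw [integral_sub (by exact i0.const_mul (x : ℂ))
    (by exact (i2.const_mul (x : ℂ)).add (i1.const_mul (2 * s))),
    integral_add (by exact i2.const_mul (x : ℂ)) (by exact i1.const_mul (2 * s)),
    integral_const_mul, integral_const_mul, integral_const_mul] at key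
  have key2 : ∀ z : ℂ, z = 0 - exp (-(x * (1 + 0) : ℝ)) * ((0 * (0 + 2) : ℝ) : ℂ) ^ s → z = 0 := by
    intro z hz; rw [hz]; simp [zero_cpow hs0]
  have key3 := key2 _ key
  rw [laplace, laplace, laplace]
  linear_combination -key3

/-- The Abel transform of `exp(-q)` is not identically zero: suitably normalized it tends to
`2^{s-1} Γ(s)` at infinity. -/
lemma exists_abel_exp_neg_ne_zero {s : ℂ} (hs : 0 < s.re) :
    ∃ x : ℝ, 0 < x ∧ abel s (fun q ↦ exp (-q)) x ≠ 0 := by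
  by_contra! h
  have hJ : ∀ k : ℝ, 0 < k → ∫ p in Set.Ioi (0 : ℝ),
      exp (-p) * ((p * (p * k + 2) : ℝ) : ℂ) ^ (s - 1) = 0 := by
    intro k hk
    have h1 := h k⁻¹ (inv_pos.2 hk)
    rw [abel_exp_neg, mul_eq_zero, or_iff_right (by simp [cpow_eq_zero_iff, hk.ne']), laplace,
      ← mul_zero k⁻¹] at h1
    have h2 := integral_comp_mul_left_Ioi (fun p : ℝ ↦ exp (-(k⁻¹ * (1 + p) : ℝ)) * abelWeight s p) 0 hk
    rw [mul_zero] at h1 h2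
    rw [h1, smul_zero] at h2
    have h3 : ∀ p ∈ Set.Ioi (0 : ℝ), exp (-p) * ((p * (p * k + 2) : ℝ) : ℂ) ^ (s - 1)
        = (exp (k⁻¹) * (k : ℂ) ^ (-(s - 1))) *
          (exp (-(k⁻¹ * (1 + k * p) : ℝ)) * abelWeight s (k * p)) := by
      intro p hp
      have hp : (0 : ℝ) < p := hp
      have hkc : (k : ℂ) ≠ 0 := by exact_mod_cast hk.ne'
      rw [abelWeight, show k * p * (k * p + 2) = k * (p * (p * k + 2)) by ring, ofReal_mul k,
        mul_cpow_ofReal_nonneg hk.le (by positivity), cpow_neg]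
      have e1 : exp (-(k⁻¹ * (1 + k * p) : ℝ)) = exp (-p) * exp (-(k : ℂ)⁻¹) := by
        rw [← exp_add]; congr 1; push_cast; field_simp; ring
      have e2 : exp ((k : ℂ)⁻¹) * exp (-(k : ℂ)⁻¹) = 1 := by rw [← exp_add]; simp
      have e3 : ((k : ℂ) ^ (s - 1))⁻¹ * (k : ℂ) ^ (s - 1) = 1 :=
        inv_mul_cancel₀ fun h ↦ hkc ((cpow_eq_zero_iff _ _).1 h).1
      rw [e1]
      set W := ((p * (p * k + 2) : ℝ) : ℂ) ^ (s - 1)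
      linear_combination (-(exp (-p) * W) * (((k : ℂ) ^ (s - 1))⁻¹ * (k : ℂ) ^ (s - 1))) * e2
        - exp (-p) * W * e3
    rw [setIntegral_congr_fun measurableSet_Ioi h3, integral_const_mul, h2, mul_zero]
  have hlim : Tendsto (fun k : ℝ ↦ ∫ p in Set.Ioi (0 : ℝ),
      exp (-p) * ((p * (p * k + 2) : ℝ) : ℂ) ^ (s - 1)) (𝓝[>] 0)
      (𝓝 (∫ p in Set.Ioi (0 : ℝ), exp (-p) * ((p * (p * 0 + 2) : ℝ) : ℂ) ^ (s - 1))) := by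
    refine tendsto_integral_filter_of_dominated_convergence
      (fun p ↦ (p * (p + 2)) ^ (s.re - 1) * Real.exp (-1 * p)
        + 2 ^ (s.re - 1) * (Real.exp (-p) * p ^ (s.re - 1))) ?_ ?_ ?_ ?_
    · filter_upwards [self_mem_nhdsWithin] with k hk
      have hk : 0 < k := hk
      refine ContinuousOn.aestronglyMeasurable (fun p hp ↦ ?_) measurableSet_Ioi
      have hp : (0 : ℝ) < p := hp
      refine (ContinuousAt.mul (by fun_prop) (ContinuousAt.cpow (by fun_prop) continuousAt_const
        (Or.inl ?_))).continuousWithinAt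
      rw [ofReal_re]; positivity
    · filter_upwards [self_mem_nhdsWithin, nhdsWithin_le_nhds (Iio_mem_nhds one_pos)] with k hk hk1
      have hk : 0 < k := hk
      have hk1 : k < 1 := hk1
      filter_upwards [ae_restrict_mem measurableSet_Ioi] with p hp
      have hp : (0 : ℝ) < p := hp
      rw [norm_mul, norm_cpow_eq_rpow_re_of_pos (by positivity), norm_exp]
      simp only [neg_re, ofReal_re, sub_re, one_re, neg_one_mul]
      rcases le_total 1 s.re with h1 | h1
      · have : (p * (p * k + 2)) ^ (s.re - 1) ≤ (p * (p + 2)) ^ (s.re - 1) :=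
          Real.rpow_le_rpow (by positivity) (by nlinarith [mul_pos hp hp]) (by linarith)
        rw [mul_comm]
        refine (mul_le_mul_of_nonneg_right this (Real.exp_pos _).le).trans ?_
        linarith [show 0 ≤ (2 : ℝ) ^ (s.re - 1) * (Real.exp (-p) * p ^ (s.re - 1)) by positivity]
      · have : (p * (p * k + 2)) ^ (s.re - 1) ≤ 2 ^ (s.re - 1) * p ^ (s.re - 1) := by
          rw [← Real.mul_rpow two_pos.le hp.le]
          exact Real.rpow_le_rpow_of_nonpos (by positivity)
            (by nlinarith [mul_pos (mul_pos hp hp) hk]) (by linarith)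
        have h2 := mul_le_mul_of_nonneg_left this (Real.exp_pos (-p)).le
        have h3 : 0 ≤ (p * (p + 2)) ^ (s.re - 1) * Real.exp (-p) := by positivity
        linarith
    · exact (integrableOn_abelWeight hs one_pos).add ((Real.GammaIntegral_convergent hs).const_mul _)
    · filter_upwards [ae_restrict_mem measurableSet_Ioi] with p hp
      have hp : (0 : ℝ) < p := hp
      have : ContinuousAt (fun k : ℝ ↦ exp (-p) * ((p * (p * k + 2) : ℝ) : ℂ) ^ (s - 1)) 0 := by
        refine ContinuousAt.mul (by fun_prop) (ContinuousAt.cpow (by fun_prop) continuousAt_const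
          (Or.inl ?_))
        rw [ofReal_re]; positivity
      exact this.tendsto.mono_left nhdsWithin_le_nhds
  have h0 := tendsto_nhds_unique (hlim.congr' (by
    filter_upwards [self_mem_nhdsWithin] with k hk using hJ k hk)) tendsto_const_nhds
  have h1 : ∀ p ∈ Set.Ioi (0 : ℝ), exp (-p) * ((p * (p * 0 + 2) : ℝ) : ℂ) ^ (s - 1)
      = (2 : ℂ) ^ (s - 1) * (((Real.exp (-p) : ℝ) : ℂ) * (p : ℂ) ^ (s - 1)) := by
    intro p hp
    have hp : (0 : ℝ) < p := hp
    rw [show p * (p * 0 + 2) = 2 * p by ring, ofReal_mul,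
      mul_cpow_ofReal_nonneg two_pos.le hp.le]
    push_cast; ring
  rw [setIntegral_congr_fun measurableSet_Ioi h1, integral_const_mul] at h0
  have h2 := Complex.Gamma_ne_zero_of_re_pos hs
  rw [Complex.Gamma_eq_integral hs, Complex.GammaIntegral] at h2
  refine (mul_ne_zero ?_ h2) h0
  rw [Ne, cpow_eq_zero_iff]; simp

lemma tendsto_cosh_sub_one_div_sq (r : ℝ) :
    Tendsto (fun k : ℝ ↦ (Real.cosh (r * k) - 1) / k ^ 2) (𝓝[>] 0) (𝓝 (r ^ 2 / 2)) := by
  have h1 : HasDerivAt (fun k : ℝ ↦ Real.sinh (r / 2 * k)) (r / 2) 0 := by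
    simpa using ((hasDerivAt_id (0 : ℝ)).const_mul (r / 2)).sinh
  have h2 := ((h1.tendsto_slope_zero_right).pow 2).const_mul 2
  have e : 2 * (r / 2) ^ 2 = r ^ 2 / 2 := by ring
  rw [e] at h2
  refine h2.congr' ?_
  filter_upwards [self_mem_nhdsWithin] with k hk
  have hk : 0 < k := hk
  have h3 := Real.cosh_two_mul (r / 2 * k)
  rw [Real.cosh_sq, show 2 * (r / 2 * k) = r * k by ring] at h3
  rw [h3, smul_eq_mul]
  simp only [zero_add, mul_zero, Real.sinh_zero, sub_zero]
  field_simp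
  ring

/-- The asymptotic behaviour of the Bessel function at infinity. -/
theorem tendsto_besselK (ν : ℂ) :
    Tendsto (fun x : ℝ ↦ ((Real.exp x * √x : ℝ) : ℂ) * besselK ν x) atTop
      (𝓝 ((√(Real.pi / (1 / 2)) / 2 : ℝ) : ℂ)) := by
  have hM : Tendsto (fun k : ℝ ↦ ∫ r in Set.Ioi (0 : ℝ),
      exp (-((Real.cosh (r * k) - 1) / k ^ 2 : ℝ)) * cosh (ν * (r * k : ℝ))) (𝓝[>] 0)
      (𝓝 (∫ r in Set.Ioi (0 : ℝ), ((Real.exp (-(1 / 2) * r ^ 2) : ℝ) : ℂ))) := by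
    refine tendsto_integral_filter_of_dominated_convergence
      (fun r ↦ Real.exp ((‖ν‖ + 1) ^ 2 / (2 * 1)) * Real.exp (-1 * r)) ?_ ?_
      ((exp_neg_integrableOn_Ioi 0 one_pos).const_mul _) ?_
    · refine Eventually.of_forall fun k ↦ Continuous.aestronglyMeasurable ?_
      have := Real.continuous_cosh
      fun_prop
    · filter_upwards [self_mem_nhdsWithin, nhdsWithin_le_nhds (Iio_mem_nhds one_pos)] with k hk hk1
      have hk : 0 < k := hk
      have hk1 : k < 1 := hk1
      filter_upwards [ae_restrict_mem measurableSet_Ioi] with r hr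
      have hr : (0 : ℝ) < r := hr
      refine le_trans ?_ (exp_quadratic_le one_pos ‖ν‖ r)
      rw [norm_mul, norm_exp, Real.exp_add, one_mul]
      refine mul_le_mul (Real.exp_le_exp.2 ?_) ((norm_cosh_le _).trans (Real.exp_le_exp.2 ?_))
        (norm_nonneg _) (Real.exp_pos _).le
      · simp only [neg_re, ofReal_re, neg_le_neg_iff]
        rw [le_div_iff₀ (by positivity)]
        nlinarith [one_add_sq_div_two_le_cosh (r * k)]
      · rw [norm_mul, norm_real, Real.norm_of_nonneg (by positivity)]
        exact mul_le_mul_of_nonneg_left (mul_le_of_le_one_right hr.le hk1.le) (norm_nonneg _)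
    · refine Eventually.of_forall fun r ↦ ?_
      have h1 := ((continuous_exp.tendsto _).comp
        ((continuous_ofReal.tendsto _).comp (tendsto_cosh_sub_one_div_sq r).neg))
      have h2 : Tendsto (fun k : ℝ ↦ cosh (ν * (r * k : ℝ))) (𝓝[>] 0) (𝓝 1) := by
        have : Continuous fun k : ℝ ↦ cosh (ν * (r * k : ℝ)) := by fun_prop
        have := this.tendsto 0
        simp only [mul_zero, ofReal_zero, cosh_zero] at this
        exact this.mono_left nhdsWithin_le_nhds
      have h3 := h1.mul h2
      rw [mul_one] at h3
      convert h3 using 2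
      · simp
      · push_cast; congr 1; ring
  rw [integral_complex_ofReal, integral_gaussian_Ioi] at hM
  have hx : Tendsto (fun x : ℝ ↦ (√x)⁻¹) atTop (𝓝[>] 0) :=
    tendsto_inv_atTop_nhdsGT_zero.comp Real.tendsto_sqrt_atTop
  refine (hM.comp hx).congr' ?_
  filter_upwards [eventually_gt_atTop 0] with x hx
  have hk : 0 < √x := Real.sqrt_pos.2 hx
  have h2 := integral_comp_mul_left_Ioi
    (fun t : ℝ ↦ exp (-(x * Real.cosh t : ℝ)) * cosh (ν * t)) 0 (inv_pos.2 hk)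
  rw [mul_zero, inv_inv] at h2
  simp only [Function.comp_apply]
  have h3 : ∀ r : ℝ, exp (-((Real.cosh (r * (√x)⁻¹) - 1) / (√x)⁻¹ ^ 2 : ℝ)) *
      cosh (ν * (r * (√x)⁻¹ : ℝ)) = (Real.exp x : ℝ) *
      (exp (-(x * Real.cosh ((√x)⁻¹ * r) : ℝ)) * cosh (ν * ((√x)⁻¹ * r : ℝ))) := by
    intro r
    rw [mul_comm (√x)⁻¹ r, ← mul_assoc, ofReal_exp, ← exp_add, inv_pow, Real.sq_sqrt hx.le]
    congr 2
    push_cast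
    field_simp
    ring
  simp only [h3]
  rw [integral_const_mul, h2, besselK, real_smul]
  push_cast
  ring

lemma eventually_besselK_ne_zero (ν : ℂ) : ∀ᶠ x : ℝ in atTop, besselK ν x ≠ 0 := by
  have hne : ((√(Real.pi / (1 / 2)) / 2 : ℝ) : ℂ) ≠ 0 := by
    have : 0 < √(Real.pi / (1 / 2)) / 2 := by positivity
    exact_mod_cast this.ne'
  filter_upwards [(tendsto_besselK ν).eventually_ne hne] with x hx h
  exact hx (by rw [h, mul_zero])

/-- A lower bound for the Bessel function. -/
lemma exists_le_norm_besselK (ν : ℂ) : ∃ c x₀ : ℝ, 0 < c ∧ 0 < x₀ ∧ ∀ x : ℝ, x₀ ≤ x →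
    c * Real.exp (-x) ≤ ‖(√x : ℂ) * besselK ν x‖ := by
  have hpos : 0 < √(Real.pi / (1 / 2)) / 2 := by positivity
  have h := (tendsto_besselK ν).norm
  rw [norm_real, Real.norm_of_nonneg hpos.le] at h
  obtain ⟨x₀, hx₀⟩ := eventually_atTop.1 (h.eventually_const_le (half_lt_self hpos))
  refine ⟨_, max x₀ 1, half_pos hpos, by positivity, fun x hx ↦ ?_⟩
  have h1 := hx₀ x ((le_max_left _ _).trans hx)
  rw [ofReal_mul, mul_assoc, norm_mul, norm_real, Real.norm_of_nonneg (Real.exp_pos _).le] at h1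
  rw [Real.exp_neg, ← div_eq_mul_inv, div_le_iff₀ (Real.exp_pos _), mul_comm ‖_‖]
  exact h1

lemma ofReal_sqrt_eq_cpow {x : ℝ} (hx : 0 ≤ x) : ((√x : ℝ) : ℂ) = (x : ℂ) ^ (1 / 2 : ℂ) := by
  rw [Real.sqrt_eq_rpow, ofReal_cpow hx]; simp

lemma besselK_normal_form (ν : ℂ) :
    ∃ b' : ℝ → ℂ, (∀ x : ℝ, 0 < x → HasDerivAt (fun x : ℝ ↦ (√x : ℂ) * besselK ν x) (b' x) x) ∧
      (∀ x : ℝ, 0 < x → HasDerivAt b' ((1 + (ν ^ 2 - 1 / 4) / x ^ 2) * ((√x : ℂ) * besselK ν x)) x) ∧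
      ∃ C, 0 ≤ C ∧ ∀ x : ℝ, 1 ≤ x → ‖(√x : ℂ) * besselK ν x‖ ≤ C * Real.exp (-(x / 2)) ∧
        ‖b' x‖ ≤ C * Real.exp (-(x / 2)) := by
  obtain ⟨b', h1, h2, C, hC, h3⟩ := (laplaceData_besselK ν).normal_form (κ := 1 / 2) (τ := ν ^ 2)
    (ρ := ν ^ 2 - 1 / 4) (by ring) fun x hx ↦ besselK_ode ν hx
  refine ⟨b', fun x hx ↦ ?_, fun x hx ↦ ?_, C, hC, fun x hx ↦ ?_⟩
  · refine (h1 x hx).congr_of_eventuallyEq ?_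
    filter_upwards [Ioi_mem_nhds hx] with y hy
    rw [ofReal_sqrt_eq_cpow (le_of_lt hy), besselK_eq_laplace]
  · rw [ofReal_sqrt_eq_cpow hx.le]
    exact h2 x hx
  · rw [ofReal_sqrt_eq_cpow (by linarith)]
    exact h3 x hx

/-- The Bessel function is a multiple of the Abel transform of `exp(-q)`: both satisfy the same
differential equation and decay. -/
theorem exists_abel_exp_neg_eq {ν s : ℂ} (hsν : s = ν + 1 / 2) (hs : 0 < s.re) :
    ∃ d : ℂ, d ≠ 0 ∧ ∀ x : ℝ, 0 < x →
      (√x : ℂ) * besselK ν x = d * abel s (fun q ↦ exp (-q)) x := by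
  obtain ⟨b', hb, hb', C, hC, hbC⟩ := besselK_normal_form ν
  obtain ⟨a', ha, ha', A, hA, haA⟩ := (laplaceData_abelWeight hs).normal_form (κ := s) (τ := 0)
    (ρ := ν ^ 2 - 1 / 4) (by rw [hsν]; ring) fun x hx ↦ abel_exp_neg_ode hs hx
  simp only [← abel_exp_neg] at ha ha' haA
  obtain ⟨x₀, hx₀, hne⟩ := exists_abel_exp_neg_ne_zero hs
  have hint : ∀ f g : ℝ → ℂ, ContinuousOn f (Set.Ioi 1) → ContinuousOn g (Set.Ioi 1) →
      (∀ x : ℝ, 1 ≤ x → ‖f x‖ ≤ A * Real.exp (-(x / 2))) →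
      (∀ x : ℝ, 1 ≤ x → ‖g x‖ ≤ C * Real.exp (-(x / 2))) →
      IntegrableOn (fun x ↦ f x • g x) (Set.Ioi 1) := by
    intro f g hf hg hfA hgC
    refine Integrable.mono' ((exp_neg_integrableOn_Ioi 1 one_pos).const_mul (A * C))
      ((hf.smul hg).aestronglyMeasurable measurableSet_Ioi) ?_
    filter_upwards [ae_restrict_mem measurableSet_Ioi] with x hx
    have hx : 1 < x := hx
    rw [norm_smul]
    refine (mul_le_mul (hfA x hx.le) (hgC x hx.le) (norm_nonneg _) (by positivity)).trans_eq ?_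
    rw [mul_mul_mul_comm, ← Real.exp_add]
    ring_nf
  have c1 : ContinuousOn (fun x : ℝ ↦ abel s (fun q ↦ exp (-q)) x) (Set.Ioi 1) := fun x hx ↦
    (ha x (one_pos.trans hx)).continuousAt.continuousWithinAt
  have c2 : ContinuousOn a' (Set.Ioi 1) := fun x hx ↦
    (ha' x (one_pos.trans hx)).continuousAt.continuousWithinAt
  have c3 : ContinuousOn (fun x : ℝ ↦ (√x : ℂ) * besselK ν x) (Set.Ioi 1) := fun x hx ↦
    (hb x (one_pos.trans hx)).continuousAt.continuousWithinAt
  have hW := wronskian_eq_zero (a := fun x : ℝ ↦ (√x : ℂ) * besselK ν x)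
    (b := fun x : ℝ ↦ abel s (fun q ↦ exp (-q)) x) (q := fun x ↦ 1 + (ν ^ 2 - 1 / 4) / (x : ℂ) ^ 2)
    hb hb' ha ha' (hint _ _ c1 c3 (fun x hx ↦ (haA x hx).1) fun x hx ↦ (hbC x hx).1)
    (hint _ _ c2 c3 (fun x hx ↦ (haA x hx).2) fun x hx ↦ (hbC x hx).1)
  have key := eq_smul_of_wronskian_eq_zero (q := fun x ↦ 1 + (ν ^ 2 - 1 / 4) / (x : ℂ) ^ 2)
    (fun x hx ↦ by
      have hx : (0 : ℝ) < x := hx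
      have hx0 : (x : ℂ) ^ 2 ≠ 0 := by exact_mod_cast (by positivity : x ^ 2 ≠ 0)
      exact ContinuousAt.continuousWithinAt (by fun_prop (disch := assumption)))
    hb hb' ha ha' hW hx₀ hne
  refine ⟨(abel s (fun q ↦ exp (-q)) x₀)⁻¹ * ((√x₀ : ℂ) * besselK ν x₀), fun h0 ↦ ?_,
    fun x hx ↦ ?_⟩
  · obtain ⟨x, hx, hx0⟩ := ((eventually_besselK_ne_zero ν).and (eventually_gt_atTop 0)).exists
    have := key x hx0
    simp only [smul_eq_mul] at this
    rw [h0, mul_zero] at this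
    refine mul_ne_zero ?_ hx this
    exact_mod_cast (Real.sqrt_pos.2 hx0).ne'
  · have := key x hx
    simp only [smul_eq_mul] at this
    rw [this]; ring

/-- The functions `y ↦ √y K_ν(a y)` of the Fourier expansion: their differential equation and
their decay. -/
theorem besselK_solution (ν : ℂ) {a : ℝ} (ha : 0 < a) :
    ∃ b' : ℝ → ℂ,
      (∀ y : ℝ, 0 < y → HasDerivAt (fun y : ℝ ↦ (√y : ℂ) * besselK ν (a * y)) (b' y) y) ∧
      (∀ y : ℝ, 0 < y → HasDerivAt b'
        ((a ^ 2 + (ν ^ 2 - 1 / 4) / y ^ 2) * ((√y : ℂ) * besselK ν (a * y))) y) ∧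
      ∃ C, 0 ≤ C ∧ ∀ y : ℝ, 1 ≤ y → ‖(√y : ℂ) * besselK ν (a * y)‖ ≤ C * Real.exp (-(a * y / 2)) ∧
        ‖b' y‖ ≤ C * Real.exp (-(a * y / 2)) := by
  obtain ⟨b', hb, hb', C, hC, hbC⟩ := besselK_normal_form ν
  have hsa : (√a : ℂ) ≠ 0 := by exact_mod_cast (Real.sqrt_pos.2 ha).ne'
  have hsq : (√a : ℂ) ^ 2 = a := by exact_mod_cast Real.sq_sqrt ha.le
  have hac : (a : ℂ) ≠ 0 := by exact_mod_cast ha.ne'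
  have hlin : ∀ y : ℝ, HasDerivAt (fun y : ℝ ↦ a * y) a y := fun y ↦ by
    simpa using (hasDerivAt_id y).const_mul a
  have hscale : ∀ y : ℝ, 0 ≤ y → (√y : ℂ) * besselK ν (a * y)
      = (√a : ℂ)⁻¹ * ((√(a * y) : ℂ) * besselK ν (a * y)) := by
    intro y hy
    rw [Real.sqrt_mul ha.le, ofReal_mul]; field_simp
  have h1 : ∀ y : ℝ, 0 < y → HasDerivAt (fun y : ℝ ↦ (√y : ℂ) * besselK ν (a * y))
      ((√a : ℂ) * b' (a * y)) y := by
    intro y hy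
    have := ((hb (a * y) (mul_pos ha hy)).scomp y (hlin y)).const_mul (√a : ℂ)⁻¹
    refine (this.congr_deriv ?_).congr_of_eventuallyEq ?_
    · rw [real_smul, ← hsq]; field_simp
    · filter_upwards [Ioi_mem_nhds hy] with x hx using hscale x (le_of_lt hx)
  have h2 : ∀ y : ℝ, 0 < y → HasDerivAt (fun y : ℝ ↦ (√a : ℂ) * b' (a * y))
        ((a ^ 2 + (ν ^ 2 - 1 / 4) / y ^ 2) * ((√y : ℂ) * besselK ν (a * y))) y := by
    intro y hy
    have := ((hb' (a * y) (mul_pos ha hy)).scomp y (hlin y)).const_mul (√a : ℂ)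
    refine this.congr_deriv ?_
    have hyc : (y : ℂ) ≠ 0 := by exact_mod_cast hy.ne'
    rw [hscale y hy.le, real_smul]
    push_cast
    field_simp
    rw [hsq]
  refine ⟨_, h1, h2, ?_⟩
  obtain ⟨M, hM⟩ := (isCompact_Icc (a := 1) (b := a⁻¹)).exists_bound_of_continuousOn
    (f := fun y : ℝ ↦ (√y : ℂ) * besselK ν (a * y))
    fun y hy ↦ (h1 y (one_pos.trans_le hy.1)).continuousAt.continuousWithinAt
  obtain ⟨M', hM'⟩ := (isCompact_Icc (a := 1) (b := a⁻¹)).exists_bound_of_continuousOn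
    (f := fun y : ℝ ↦ (√a : ℂ) * b' (a * y))
    fun y hy ↦ (h2 y (one_pos.trans_le hy.1)).continuousAt.continuousWithinAt
  set D := (|M| + |M'|) * Real.exp (1 / 2) + (‖(√a : ℂ)⁻¹‖ + ‖(√a : ℂ)‖) * C with hD
  refine ⟨D, by positivity, fun y hy ↦ ?_⟩
  have hE := Real.exp_pos (-(a * y / 2))
  rcases le_total y a⁻¹ with h | h
  · have h3 : 1 ≤ Real.exp (1 / 2) * Real.exp (-(a * y / 2)) := by
      rw [← Real.exp_add]
      refine Real.one_le_exp ?_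
      have := mul_le_mul_of_nonneg_left h ha.le
      rw [mul_inv_cancel₀ ha.ne'] at this
      linarith
    have h4 : |M| + |M'| ≤ D * Real.exp (-(a * y / 2)) := by
      have h5 : 0 ≤ (‖(√a : ℂ)⁻¹‖ + ‖(√a : ℂ)‖) * C * Real.exp (-(a * y / 2)) := by positivity
      have h6 := mul_le_mul_of_nonneg_left h3 (show 0 ≤ |M| + |M'| by positivity)
      rw [hD, add_mul]
      nlinarith
    exact ⟨(hM y ⟨hy, h⟩).trans (by linarith [le_abs_self M, abs_nonneg M']),
      (hM' y ⟨hy, h⟩).trans (by linarith [le_abs_self M', abs_nonneg M])⟩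
  · have h3 : 1 ≤ a * y := by
      have := mul_le_mul_of_nonneg_left h ha.le
      rwa [mul_inv_cancel₀ ha.ne'] at this
    obtain ⟨h4, h5⟩ := hbC (a * y) h3
    have h6 : 0 ≤ (|M| + |M'|) * Real.exp (1 / 2) * Real.exp (-(a * y / 2)) := by positivity
    have h7 : 0 ≤ ‖(√a : ℂ)⁻¹‖ * (C * Real.exp (-(a * y / 2))) := by positivity
    have h8 : 0 ≤ ‖(√a : ℂ)‖ * (C * Real.exp (-(a * y / 2))) := by positivity
    constructor
    · rw [hscale y (by linarith), norm_mul]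
      refine (mul_le_mul_of_nonneg_left h4 (norm_nonneg _)).trans ?_
      rw [hD]; nlinarith
    · rw [norm_mul]
      refine (mul_le_mul_of_nonneg_left h5 (norm_nonneg _)).trans ?_
      rw [hD]; nlinarith

end BesselAbel

/-! ### Exponential series -/

section ExpSeries

variable {E : Type*} [NormedAddCommGroup E] [NormedSpace ℂ E]

/-- The series `∑_{n ≥ 1} exp(-α n q) c_n`; the coefficient of index `n` is `c (n - 1)`. -/
def expSeries (α : ℝ) (c : ℕ → E) (q : ℂ) : E := ∑' n : ℕ, exp (-((α * (n + 1) : ℝ) * q)) • c n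

/-- Subexponential growth of a sequence of coefficients. -/
def IsSubExp (c : ℕ → E) : Prop :=
  ∀ ε : ℝ, 0 < ε → ∃ C, 0 ≤ C ∧ ∀ n : ℕ, ‖c n‖ ≤ C * Real.exp (ε * (n + 1))

lemma summable_exp_neg_mul_add_one {r : ℝ} (hr : 0 < r) :
    Summable fun n : ℕ ↦ Real.exp (-(r * (n + 1))) := by
  have := (Real.summable_exp_nat_mul_iff.2 (neg_lt_zero.2 hr)).mul_left (Real.exp (-r))
  refine this.congr fun n ↦ ?_
  rw [← Real.exp_add]; ring_nf

lemma IsSubExp.norm_term_le {c : ℕ → E} (hc : IsSubExp c) {α δ : ℝ} (hα : 0 < α) (hδ : 0 < δ) :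
    ∃ u : ℕ → ℝ, Summable u ∧ (∀ n, 0 ≤ u n) ∧ ∀ (n : ℕ) (q : ℂ), δ ≤ q.re →
      ‖exp (-((α * (n + 1) : ℝ) * q)) • c n‖ ≤ u n * Real.exp (-(α / 2) * q.re) := by
  obtain ⟨C, hC0, hC⟩ := hc (α * δ / 4) (by positivity)
  refine ⟨fun n ↦ C * Real.exp (-(α * δ / 4 * (n + 1))),
    (summable_exp_neg_mul_add_one (by positivity)).mul_left C, fun n ↦ by positivity,
    fun n q hq ↦ ?_⟩
  rw [norm_smul, norm_exp, neg_re, re_ofReal_mul]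
  calc _ ≤ Real.exp (-(α * (n + 1) * q.re)) * (C * Real.exp (α * δ / 4 * (n + 1))) := by
        gcongr; exact hC n
    _ = C * Real.exp (-(α * (n + 1) * q.re) + α * δ / 4 * (n + 1)) := by rw [Real.exp_add]; ring
    _ ≤ C * Real.exp (-(α * δ / 4 * (n + 1)) + -(α / 2) * q.re) := by
        refine mul_le_mul_of_nonneg_left (Real.exp_le_exp.2 ?_) hC0
        have h1 : α / 2 * (n + 1) * δ ≤ α / 2 * (n + 1) * q.re := by gcongr
        have h2 : 0 ≤ α / 2 * n * q.re := by have := hδ.le.trans hq; positivity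
        nlinarith
    _ = _ := by rw [Real.exp_add]; ring

lemma IsSubExp.mul_nat {c : ℕ → E} (hc : IsSubExp c) (a : ℂ) :
    IsSubExp fun n ↦ (a * ((n + 1 : ℕ) : ℂ)) • c n := by
  intro ε hε
  obtain ⟨C, hC0, hC⟩ := hc (ε / 2) (half_pos hε)
  refine ⟨‖a‖ * (2 / ε) * C, by positivity, fun n ↦ ?_⟩
  rw [norm_smul, norm_mul, norm_natCast]
  have h1 : ((n + 1 : ℕ) : ℝ) ≤ 2 / ε * Real.exp (ε / 2 * (n + 1)) := by
    have := Real.add_one_le_exp (ε / 2 * (n + 1))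
    rw [div_mul_eq_mul_div, le_div_iff₀ hε]
    push_cast
    nlinarith
  calc _ ≤ ‖a‖ * (2 / ε * Real.exp (ε / 2 * (n + 1))) * (C * Real.exp (ε / 2 * (n + 1))) := by
        gcongr; exact hC n
    _ = ‖a‖ * (2 / ε) * C * (Real.exp (ε / 2 * (n + 1)) * Real.exp (ε / 2 * (n + 1))) := by ring
    _ = _ := by rw [← Real.exp_add]; ring_nf

omit [NormedSpace ℂ E] in
lemma IsSubExp.add {c d : ℕ → E} (hc : IsSubExp c) (hd : IsSubExp d) :
    IsSubExp fun n ↦ c n + d n := by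
  intro ε hε
  obtain ⟨C, hC0, hC⟩ := hc ε hε
  obtain ⟨D, hD0, hD⟩ := hd ε hε
  refine ⟨C + D, by positivity, fun n ↦ (norm_add_le _ _).trans ?_⟩
  rw [add_mul]
  exact add_le_add (hC n) (hD n)

omit [NormedSpace ℂ E] in
lemma IsSubExp.neg {c : ℕ → E} (hc : IsSubExp c) : IsSubExp fun n ↦ -c n := by
  simpa [IsSubExp] using hc

variable [CompleteSpace E]

lemma hasSum_expSeries {c : ℕ → E} (hc : IsSubExp c) {α : ℝ} (hα : 0 < α) {q : ℂ} (hq : 0 < q.re) :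
    HasSum (fun n : ℕ ↦ exp (-((α * (n + 1) : ℝ) * q)) • c n) (expSeries α c q) := by
  obtain ⟨u, hu, -, h⟩ := hc.norm_term_le hα hq
  exact (Summable.of_norm_bounded (hu.mul_right _) fun n ↦ h n q le_rfl).hasSum

lemma isExpDecay_expSeries {c : ℕ → E} (hc : IsSubExp c) {α : ℝ} (hα : 0 < α) :
    IsExpDecay (expSeries α c) where
  diff q hq := by
    have hq : 0 < q.re := hq
    obtain ⟨u, hu, hu0, h⟩ := hc.norm_term_le hα (half_pos hq)
    have hopen : IsOpen {w : ℂ | q.re / 2 < w.re} := isOpen_lt continuous_const continuous_re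
    refine ((differentiableOn_tsum_of_summable_norm hu (fun n ↦ ?_) hopen
      (F := fun (n : ℕ) (q : ℂ) ↦ exp (-((α * (n + 1) : ℝ) * q)) • c n)
      fun n w hw ↦ ?_).differentiableAt (hopen.mem_nhds (half_lt_self hq))).differentiableWithinAt
    · exact DifferentiableOn.smul_const (by fun_prop) _
    · have hw : q.re / 2 < w.re := hw
      refine (h n w hw.le).trans (mul_le_of_le_one_right (hu0 n) (Real.exp_le_one_iff.2 ?_))
      nlinarith
  decay := by
    refine ⟨α / 2, half_pos hα, fun δ hδ ↦ ?_⟩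
    obtain ⟨u, hu, hu0, h⟩ := hc.norm_term_le hα hδ
    exact ⟨∑' n, u n, fun q hq ↦ tsum_of_norm_bounded (hu.hasSum.mul_right _) fun n ↦ h n q hq⟩

lemma hasDerivAt_expSeries {c : ℕ → E} (hc : IsSubExp c) {α : ℝ} (hα : 0 < α) {q : ℂ}
    (hq : 0 < q.re) :
    HasDerivAt (expSeries α c) (expSeries α (fun n ↦ (-α * ((n + 1 : ℕ) : ℂ)) • c n) q) q := by
  obtain ⟨u, hu, hu0, h⟩ := hc.norm_term_le hα (half_pos hq)
  have hopen : IsOpen {w : ℂ | q.re / 2 < w.re} := isOpen_lt continuous_const continuous_re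
  have hqm : q ∈ {w : ℂ | q.re / 2 < w.re} := by simp; linarith
  have h1 := hasSum_deriv_of_summable_norm hu (fun n ↦ ?_) hopen
    (F := fun (n : ℕ) (q : ℂ) ↦ exp (-((α * (n + 1) : ℝ) * q)) • c n) (fun n w hw ↦ ?_) hqm
  rotate_left
  · exact DifferentiableOn.smul_const (by fun_prop) _
  · have hw : q.re / 2 < w.re := hw
    refine (h n w hw.le).trans (mul_le_of_le_one_right (hu0 n) (Real.exp_le_one_iff.2 ?_))
    nlinarith
  have h2 := ((isExpDecay_expSeries hc hα).diff.differentiableAt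
    ((isOpen_lt continuous_const continuous_re).mem_nhds hq)).hasDerivAt
  refine h2.congr_deriv ?_
  refine h1.unique ?_
  have h3 := hasSum_expSeries (hc.mul_nat (-α)) hα hq
  refine h3.congr_fun fun n ↦ ?_
  have h4 : HasDerivAt (fun q : ℂ ↦ -(((α * (n + 1) : ℝ) : ℂ) * q)) (-((α * (n + 1) : ℝ) : ℂ)) q := by
    simpa using ((hasDerivAt_id q).const_mul ((α * (n + 1) : ℝ) : ℂ)).fun_neg
  rw [(h4.cexp.smul_const (c n)).deriv, smul_smul]
  congr 1
  push_cast; ring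

/-- The Abel transform of an exponential series can be computed term by term. -/
lemma hasSum_abel_expSeries {c : ℕ → E} (hc : IsSubExp c) {α : ℝ} (hα : 0 < α) {s : ℂ}
    (hs : 0 < s.re) {y : ℝ} (hy : 0 < y) :
    HasSum (fun n : ℕ ↦ abel s (fun q ↦ exp (-((α * (n + 1) : ℝ) * q))) y • c n)
      (abel s (expSeries α c) y) := by
  obtain ⟨u, hu, hu0, h⟩ := hc.norm_term_le hα hy
  set G : ℝ → ℝ := fun p ↦ (p * (p + 2)) ^ (s.re - 1) * Real.exp (-(α / 2 * y) * p) with hG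
  have hGi : IntegrableOn G (Set.Ioi 0) := integrableOn_abelWeight hs (by positivity)
  have hbound : ∀ n : ℕ, ∀ p ∈ Set.Ioi (0 : ℝ),
      ‖abelWeight s p • exp (-((α * (n + 1) : ℝ) * ((y : ℂ) * (1 + p)))) • c n‖ ≤ u n * G p := by
    intro n p hp
    have hp : (0 : ℝ) < p := hp
    have hre : ((y : ℂ) * (1 + p)).re = y * (1 + p) := by rw [re_mul_one_add, ofReal_re]
    rw [norm_smul, norm_abelWeight s hp]
    have h1 := h n ((y : ℂ) * (1 + p)) (by rw [hre]; nlinarith)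
    rw [hre] at h1
    have h2 : Real.exp (-(α / 2) * (y * (1 + p))) ≤ Real.exp (-(α / 2 * y) * p) :=
      Real.exp_le_exp.2 (by nlinarith [mul_pos hα hy])
    calc _ ≤ (p * (p + 2)) ^ (s.re - 1) * (u n * Real.exp (-(α / 2 * y) * p)) := by
          refine mul_le_mul_of_nonneg_left (h1.trans ?_) (by positivity)
          exact mul_le_mul_of_nonneg_left h2 (hu0 n)
      _ = _ := by rw [hG]; ring
  have hint : ∀ n : ℕ, IntegrableOn (fun p : ℝ ↦
      abelWeight s p • exp (-((α * (n + 1) : ℝ) * ((y : ℂ) * (1 + p)))) • c n) (Set.Ioi 0) := by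
    intro n
    refine Integrable.mono' (hGi.const_mul (u n)) (ContinuousOn.aestronglyMeasurable
      ((continuousOn_abelWeight s).smul (by fun_prop)) measurableSet_Ioi) ?_
    filter_upwards [ae_restrict_mem measurableSet_Ioi] with p hp using hbound n p hp
  have key := hasSum_integral_of_summable_integral_norm hint ?_
  · have h2 := key.const_smul ((y : ℂ) ^ s)
    rw [abel]
    convert h2 using 1
    · ext n
      rw [abel, smul_eq_mul, mul_smul, ← integral_smul_const]
      simp only [smul_smul, smul_eq_mul]
    · congr 1
      refine setIntegral_congr_fun measurableSet_Ioi fun p hp ↦ ?_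
      have hp : (0 : ℝ) < p := hp
      have hre : 0 < ((y : ℂ) * (1 + p)).re := by rw [re_mul_one_add, ofReal_re]; positivity
      exact (((hasSum_expSeries hc hα hre).const_smul (abelWeight s p)).tsum_eq).symm
  · refine Summable.of_nonneg_of_le (fun n ↦ integral_nonneg fun p ↦ norm_nonneg _) (fun n ↦ ?_)
      (hu.mul_right (∫ p in Set.Ioi (0 : ℝ), G p))
    rw [← integral_const_mul]
    exact setIntegral_mono_on (hint n).norm (hGi.const_mul _) measurableSet_Ioi (hbound n)

lemma abel_exp_neg_mul (s : ℂ) {a y : ℝ} (ha : 0 < a) (hy : 0 < y) :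
    abel s (fun q ↦ exp (-(a * q))) y = (a : ℂ) ^ (-s) * abel s (fun q ↦ exp (-q)) (a * y : ℝ) := by
  have hac : (a : ℂ) ≠ 0 := by exact_mod_cast ha.ne'
  rw [abel, abel, smul_eq_mul, smul_eq_mul, ofReal_mul, mul_cpow_ofReal_nonneg ha.le hy.le,
    ← mul_assoc, ← mul_assoc, ← cpow_add _ _ hac, neg_add_cancel, cpow_zero, one_mul]
  simp only [mul_assoc]

/-- The functions `y ↦ √y K_ν(a y)` as Abel transforms. -/
lemma exists_besselK_eq_abel {ν s : ℂ} (hsν : s = ν + 1 / 2) (hs : 0 < s.re) :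
    ∃ d : ℂ, d ≠ 0 ∧ ∀ a y : ℝ, 0 < a → 0 < y →
      (√y : ℂ) * besselK ν (a * y) = d * ((a : ℂ) ^ ν * abel s (fun q ↦ exp (-(a * q))) y) := by
  obtain ⟨d, hd, h⟩ := exists_abel_exp_neg_eq hsν hs
  refine ⟨d, hd, fun a y ha hy ↦ ?_⟩
  have hac : (a : ℂ) ≠ 0 := by exact_mod_cast ha.ne'
  have h1 := h (a * y) (mul_pos ha hy)
  rw [Real.sqrt_mul ha.le, ofReal_mul, ofReal_sqrt_eq_cpow ha.le] at h1
  have h2 : (a : ℂ) ^ (1 / 2 : ℂ) ≠ 0 := by rw [Ne, cpow_eq_zero_iff]; exact fun h ↦ hac h.1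
  rw [abel_exp_neg_mul s ha hy, ← mul_assoc ((a : ℂ) ^ ν), ← cpow_add _ _ hac,
    show ν + -s = -(1 / 2) by rw [hsν]; ring, cpow_neg]
  field_simp
  linear_combination h1

end ExpSeries

/-! ### Fourier series of vector valued functions -/

section FourierSeries

variable {E : Type*} [NormedAddCommGroup E] [NormedSpace ℂ E]

/-- The exponent `2πik/N` of the `k`-th character of `ℝ / Nℤ`. -/
def freq (N : ℕ) (k : ℤ) : ℂ := 2 * Real.pi * I * k / N

/-- The `k`-th Fourier coefficient of a function with period `N`. The interval of integration is
a union of translates of `[-1/2, 1/2]`, the range of `Re z` on the fundamental domain. -/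
def fourierInt (N : ℕ) (g : ℝ → E) (k : ℤ) : E :=
  (1 / (N : ℂ)) • ∫ x in (-(1 / 2) : ℝ)..(-(1 / 2) + N), exp (-(freq N k * x)) • g x

lemma norm_exp_freq_mul (N : ℕ) (k : ℤ) (x : ℝ) : ‖exp (freq N k * x)‖ = 1 := by
  have : freq N k * x = ((2 * Real.pi * k / N * x : ℝ) : ℂ) * I := by
    rw [freq]; push_cast; ring
  rw [this, norm_exp_ofReal_mul_I]

lemma norm_exp_neg_freq_mul (N : ℕ) (k : ℤ) (x : ℝ) : ‖exp (-(freq N k * x))‖ = 1 := by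
  rw [exp_neg, norm_inv, norm_exp_freq_mul, inv_one]

lemma exp_freq_mul_add {N : ℕ} (hN : 0 < N) (k : ℤ) (x : ℝ) :
    exp (freq N k * (x + N : ℝ)) = exp (freq N k * x) := by
  have hN0 : (N : ℂ) ≠ 0 := by exact_mod_cast hN.ne'
  have : freq N k * (x + N : ℝ) = freq N k * x + k * (2 * Real.pi * I) := by
    rw [freq]; push_cast; field_simp
  rw [this, exp_add, exp_int_mul_two_pi_mul_I, mul_one]

lemma exp_neg_freq_mul_add {N : ℕ} (hN : 0 < N) (k : ℤ) (x : ℝ) :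
    exp (-(freq N k * (x + N : ℝ))) = exp (-(freq N k * x)) := by
  rw [exp_neg, exp_freq_mul_add hN, exp_neg]

lemma clm_fourierInt [CompleteSpace E] {N : ℕ} {g : ℝ → E} (hg : Continuous g) (k : ℤ)
    {F : Type*} [NormedAddCommGroup F] [NormedSpace ℂ F] [CompleteSpace F] (φ : E →L[ℂ] F) :
    fourierInt N (fun x ↦ φ (g x)) k = φ (fourierInt N g k) := by
  rw [fourierInt, fourierInt, map_smul, ← φ.intervalIntegral_comp_comm]
  · simp only [map_smul]
  · exact Continuous.intervalIntegrable (by fun_prop) _ _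

/-- Fourier inversion for a continuous function with summable Fourier coefficients. -/
theorem hasSum_fourierInt [CompleteSpace E] {N : ℕ} (hN : 0 < N) {g : ℝ → E} (hg : Continuous g)
    (hp : ∀ x, g (x + N) = g x) (hs : Summable fun k ↦ ‖fourierInt N g k‖) (x : ℝ) :
    HasSum (fun k : ℤ ↦ exp (freq N k * x) • fourierInt N g k) (g x) := by
  have hsum : Summable fun k : ℤ ↦ exp (freq N k * x) • fourierInt N g k :=
    Summable.of_norm (by simpa only [norm_smul, norm_exp_freq_mul, one_mul] using hs)
  have hNR : (0 : ℝ) < N := by exact_mod_cast hN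
  have : Fact ((0 : ℝ) < N) := ⟨hNR⟩
  have key : ∑' k : ℤ, exp (freq N k * x) • fourierInt N g k = g x := by
    refine SeparatingDual.eq_iff_forall_dual_eq (R := ℂ).2 fun φ ↦ ?_
    have hper : Function.Periodic (fun x ↦ φ (g x)) (N : ℝ) := fun x ↦ by simp only [hp]
    let G : C(AddCircle (N : ℝ), ℂ) := ⟨hper.lift, by
      exact Continuous.quotient_lift (by fun_prop) _⟩
    have hG : ∀ x : ℝ, G (x : AddCircle (N : ℝ)) = φ (g x) := fun x ↦ hper.lift_coe x
    have hcoeff : ∀ k : ℤ, fourierCoeff G k = φ (fourierInt N g k) := by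
      intro k
      rw [fourierCoeff_eq_intervalIntegral _ k (-(1 / 2)), ← clm_fourierInt hg, fourierInt,
        ← Complex.coe_smul]
      congr 1
      · push_cast; rfl
      · refine intervalIntegral.integral_congr fun y _ ↦ ?_
        simp only [hG, fourier_coe_apply, freq]
        congr 2
        push_cast; ring
    have hcs : Summable (fourierCoeff G) := by
      refine Summable.of_norm_bounded (hs.mul_left ‖φ‖) fun k ↦ ?_
      rw [hcoeff]; exact φ.le_opNorm _
    have h1 := has_pointwise_sum_fourier_series_of_summable hcs (x : AddCircle (N : ℝ))
    rw [hG] at h1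
    refine HasSum.unique (φ.hasSum hsum.hasSum) (h1.congr_fun fun k ↦ ?_)
    rw [hcoeff, fourier_coe_apply, map_smul, smul_eq_mul, smul_eq_mul, mul_comm, freq]
    congr 2
    push_cast; ring
  rw [← key]
  exact hsum.hasSum

lemma integral_exp_freq {N : ℕ} (hN : 0 < N) (k m : ℤ) :
    ∫ x in (-(1 / 2) : ℝ)..(-(1 / 2) + N), exp (-(freq N m * x)) * exp (freq N k * x)
      = if k = m then (N : ℂ) else 0 := by
  have hN0 : (N : ℂ) ≠ 0 := by exact_mod_cast hN.ne'
  have h : ∀ x : ℝ, exp (-(freq N m * x)) * exp (freq N k * x) = exp (freq N (k - m) * x) := by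
    intro x
    rw [← exp_add, freq, freq, freq]; congr 1; push_cast; ring
  simp only [h]
  split_ifs with hkm
  · simp [hkm, freq]
  · have hc : freq N (k - m) ≠ 0 := by
      rw [freq]
      refine div_ne_zero (mul_ne_zero two_pi_I_ne_zero ?_) hN0
      exact_mod_cast sub_ne_zero.2 hkm
    rw [integral_exp_mul_complex hc, exp_freq_mul_add hN, sub_self, zero_div]

/-- The coefficients of a pointwise convergent Fourier series with absolutely summable
coefficients. -/
theorem fourierInt_of_hasSum [CompleteSpace E] {N : ℕ} (hN : 0 < N) {g : ℝ → E} {c : ℤ → E}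
    (hs : Summable fun k ↦ ‖c k‖)
    (hg : ∀ x : ℝ, HasSum (fun k : ℤ ↦ exp (freq N k * x) • c k) (g x)) (m : ℤ) :
    fourierInt N g m = c m := by
  have hN0 : (N : ℂ) ≠ 0 := by exact_mod_cast hN.ne'
  have key := intervalIntegral.hasSum_integral_of_dominated_convergence (μ := volume)
    (a := -(1 / 2)) (b := -(1 / 2) + N) (f := fun x : ℝ ↦ exp (-(freq N m * x)) • g x)
    (F := fun (k : ℤ) (x : ℝ) ↦ exp (-(freq N m * x)) • exp (freq N k * x) • c k)
    (fun k _ ↦ ‖c k‖) (fun k ↦ Continuous.aestronglyMeasurable (by fun_prop))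
    (fun k ↦ Eventually.of_forall fun x _ ↦ by
      rw [norm_smul, norm_smul, norm_exp_freq_mul, norm_exp_neg_freq_mul, one_mul, one_mul])
    (Eventually.of_forall fun x _ ↦ hs) (by simp)
    (Eventually.of_forall fun x _ ↦ (hg x).const_smul _)
  have h2 : ∀ k : ℤ, ∫ x in (-(1 / 2) : ℝ)..(-(1 / 2) + N),
      exp (-(freq N m * x)) • exp (freq N k * x) • c k = if k = m then (N : ℂ) • c m else 0 := by
    intro k
    simp only [smul_smul]
    rw [intervalIntegral.integral_smul_const, integral_exp_freq hN]
    split_ifs with h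
    · rw [h]
    · rw [zero_smul]
  simp only [h2] at key
  rw [fourierInt, key.unique (hasSum_ite_eq m ((N : ℂ) • c m)), smul_smul,
    one_div_mul_cancel hN0, one_smul]

/-- Differentiation of a Fourier coefficient by parts. -/
lemma fourierInt_deriv [CompleteSpace E] {N : ℕ} (hN : 0 < N) {g g' : ℝ → E}
    (hg : ∀ x, HasDerivAt g (g' x) x) (hg' : Continuous g') (hp : ∀ x, g (x + N) = g x) (k : ℤ) :
    fourierInt N g' k = freq N k • fourierInt N g k := by
  have he : ∀ x : ℝ, HasDerivAt (fun x : ℝ ↦ exp (-(freq N k * x)))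
      (-freq N k * exp (-(freq N k * x))) x := by
    intro x
    have := (((hasDerivAt_id (x : ℂ)).const_mul (freq N k)).fun_neg.cexp).comp_ofReal
    refine this.congr_deriv ?_
    simp; ring
  have hgc : Continuous g := continuous_iff_continuousAt.2 fun x ↦ (hg x).continuousAt
  have key := intervalIntegral.integral_smul_deriv_eq_deriv_smul (a := -(1 / 2))
    (b := -(1 / 2) + (N : ℝ)) (fun x _ ↦ he x) (fun x _ ↦ hg x)
    (Continuous.intervalIntegrable (by fun_prop) _ _) (hg'.intervalIntegrable _ _)
  rw [exp_neg_freq_mul_add hN, hp, sub_self, zero_sub] at key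
  rw [fourierInt, fourierInt, key]
  simp only [mul_smul]
  rw [intervalIntegral.integral_smul, neg_smul, neg_neg, smul_comm]

lemma norm_fourierInt_le {N : ℕ} {g : ℝ → E} (k : ℤ) :
    ‖fourierInt N g k‖ ≤ 1 / N * ∫ x in (-(1 / 2) : ℝ)..(-(1 / 2) + N), ‖g x‖ := by
  rw [fourierInt, norm_smul, norm_div, norm_one, norm_natCast]
  refine mul_le_mul_of_nonneg_left ?_ (by positivity)
  refine (intervalIntegral.norm_integral_le_integral_norm (by simp)).trans_eq ?_
  simp only [norm_smul, norm_exp_neg_freq_mul, one_mul]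

/-- The integral over a period is controlled by the integral over `[-1/2, 1/2]` if translation by
integers changes the norm by a bounded factor. -/
lemma norm_fourierInt_le_of_shift {N : ℕ} (hN : 0 < N) {g : ℝ → E} (hg : Continuous g) {M : ℝ}
    (hM : ∀ (j : ℕ) (x : ℝ), ‖g (x + j)‖ ≤ M * ‖g x‖) (k : ℤ) :
    ‖fourierInt N g k‖ ≤ M * ∫ x in (-(1 / 2) : ℝ)..1 / 2, ‖g x‖ := by
  have hNR : (0 : ℝ) < N := by exact_mod_cast hN
  refine (norm_fourierInt_le k).trans ?_
  have h1 := intervalIntegral.sum_integral_adjacent_intervals (f := fun x ↦ ‖g x‖) (μ := volume)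
    (a := fun j : ℕ ↦ -(1 / 2) + (j : ℝ)) (n := N) fun j _ ↦ hg.norm.intervalIntegrable _ _
  simp only [Nat.cast_zero, add_zero] at h1
  rw [← h1]
  have h2 : ∀ j ∈ Finset.range N, ∫ x in (-(1 / 2) + (j : ℝ))..(-(1 / 2) + ((j + 1 : ℕ) : ℝ)), ‖g x‖
      ≤ M * ∫ x in (-(1 / 2) : ℝ)..1 / 2, ‖g x‖ := by
    intro j _
    rw [← intervalIntegral.integral_const_mul]
    have h3 := intervalIntegral.integral_comp_add_right (a := -(1 / 2)) (b := 1 / 2)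
      (fun x ↦ ‖g x‖) (j : ℝ)
    rw [show -(1 / 2) + ((j + 1 : ℕ) : ℝ) = 1 / 2 + j by push_cast; ring, ← h3]
    exact intervalIntegral.integral_mono_on (by norm_num)
      (Continuous.intervalIntegrable (by fun_prop) _ _)
      (Continuous.intervalIntegrable (by fun_prop) _ _) fun x _ ↦ hM j x
  have h4 := Finset.sum_le_sum h2
  rw [Finset.sum_const, Finset.card_range, nsmul_eq_mul] at h4
  calc _ ≤ 1 / (N : ℝ) * (N * (M * ∫ x in (-(1 / 2) : ℝ)..1 / 2, ‖g x‖)) := by gcongr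
    _ = _ := by field_simp

end FourierSeries

/-! ### Fourier coefficients of eigenfunctions on the upper half plane -/

section Eigenfunction

variable {E : Type*} [NormedAddCommGroup E] [NormedSpace ℂ E]

/-- The absolute value `2π|k|/N` of the frequency, the scale of the Bessel function that belongs
to the `k`-th Fourier coefficient. -/
def absFreq (N : ℕ) (k : ℤ) : ℝ := 2 * Real.pi * |(k : ℝ)| / N

lemma absFreq_pos {N : ℕ} (hN : 0 < N) {k : ℤ} (hk : k ≠ 0) : 0 < absFreq N k := by
  have h1 : (0 : ℝ) < N := by exact_mod_cast hN
  have h2 : 0 < |(k : ℝ)| := abs_pos.2 (by exact_mod_cast hk)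
  have := Real.pi_pos
  rw [absFreq]; positivity

lemma freq_sq (N : ℕ) (k : ℤ) : freq N k ^ 2 = -(absFreq N k : ℂ) ^ 2 := by
  have h : (((|(k : ℝ)| : ℝ) : ℂ)) ^ 2 = (k : ℂ) ^ 2 := by
    rw [← ofReal_pow, sq_abs]; push_cast; rfl
  rw [freq, absFreq]
  push_cast
  rw [div_pow, div_pow, mul_pow, mul_pow, mul_pow, I_sq, mul_pow _ ((|(k : ℝ)| : ℝ) : ℂ), h]
  ring

lemma im_ofReal_add_mul_I (x y : ℝ) : ((x : ℂ) + y * I).im = y := by simp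

omit [NormedSpace ℂ E] in
lemma continuous_comp_horizontal {g : ℂ → E} (hg : ContinuousOn g {z : ℂ | 0 < z.im}) {y : ℝ}
    (hy : 0 < y) : Continuous fun x : ℝ ↦ g (x + y * I) :=
  hg.comp_continuous (by fun_prop) fun x ↦ by simpa using hy

lemma fourierInt_smul {N : ℕ} (c : ℂ) (g : ℝ → E) (k : ℤ) :
    fourierInt N (fun x ↦ c • g x) k = c • fourierInt N g k := by
  simp only [fourierInt]
  rw [smul_comm c (1 / (N : ℂ)), ← intervalIntegral.integral_smul c]
  congr 1
  exact intervalIntegral.integral_congr fun x _ ↦ smul_comm (exp (-(freq N k * x))) c (g x)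

lemma fourierInt_sub {N : ℕ} {f g : ℝ → E} (hf : Continuous f) (hg : Continuous g) (k : ℤ) :
    fourierInt N (fun x ↦ f x - g x) k = fourierInt N f k - fourierInt N g k := by
  simp only [fourierInt, smul_sub]
  rw [intervalIntegral.integral_sub, smul_sub]
  · exact Continuous.intervalIntegrable (by fun_prop) _ _
  · exact Continuous.intervalIntegrable (by fun_prop) _ _

lemma hasDerivAt_fourierInt {N : ℕ} {g g' : ℂ → E} (hg : ContinuousOn g {z : ℂ | 0 < z.im})
    (hg' : ContinuousOn g' {z : ℂ | 0 < z.im})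
    (hd : ∀ x y : ℝ, 0 < y → HasDerivAt (fun y : ℝ ↦ g (x + y * I)) (g' (x + y * I)) y) (k : ℤ)
    {y : ℝ} (hy : 0 < y) :
    HasDerivAt (fun y : ℝ ↦ fourierInt N (fun x ↦ g (x + y * I)) k)
      (fourierInt N (fun x ↦ g' (x + y * I)) k) y := by
  have hK : IsCompact (Set.uIcc (-(1 / 2) : ℝ) (-(1 / 2) + N) ×ˢ Set.Icc (y / 2) (2 * y)) :=
    isCompact_uIcc.prod isCompact_Icc
  have hc : ContinuousOn (fun p : ℝ × ℝ ↦ g' (p.1 + p.2 * I))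
      (Set.uIcc (-(1 / 2) : ℝ) (-(1 / 2) + N) ×ˢ Set.Icc (y / 2) (2 * y)) := by
    refine hg'.comp (by fun_prop) fun p hp ↦ ?_
    have h1 : y / 2 ≤ p.2 := hp.2.1
    change 0 < ((p.1 : ℂ) + p.2 * I).im
    rw [im_ofReal_add_mul_I]; linarith
  obtain ⟨B, hB⟩ := hK.exists_bound_of_continuousOn hc
  have hint : ∀ {h : ℂ → E}, ContinuousOn h {z : ℂ | 0 < z.im} → ∀ t : ℝ, 0 < t →
      Continuous fun x : ℝ ↦ exp (-(freq N k * x)) • h (x + t * I) := fun hh t ht ↦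
    Continuous.smul (by fun_prop) (continuous_comp_horizontal hh ht)
  refine HasDerivAt.const_smul (1 / (N : ℂ)) ?_
  refine (intervalIntegral.hasDerivAt_integral_of_dominated_loc_of_deriv_le (bound := fun _ ↦ B)
    (F := fun (t : ℝ) (x : ℝ) ↦ exp (-(freq N k * x)) • g (x + t * I))
    (F' := fun (t : ℝ) (x : ℝ) ↦ exp (-(freq N k * x)) • g' (x + t * I))
    (Icc_mem_nhds (half_lt_self hy) (by linarith : y < 2 * y)) ?_
    ((hint hg y hy).intervalIntegrable _ _) (hint hg' y hy).aestronglyMeasurable ?_ (by simp) ?_).2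
  · filter_upwards [Ioi_mem_nhds hy] with t ht using (hint hg t ht).aestronglyMeasurable
  · refine Eventually.of_forall fun x hx t ht ↦ ?_
    rw [norm_smul, norm_exp_neg_freq_mul, one_mul]
    exact hB (x, t) ⟨Set.uIoc_subset_uIcc hx, ht⟩
  · refine Eventually.of_forall fun x _ t ht ↦ ?_
    exact (hd x t ((half_pos hy).trans_le ht.1)).const_smul _

lemma hasDerivAt_vertical {F : Type*} [NormedAddCommGroup F] [NormedSpace ℝ F] {g : ℂ → F} {x y : ℝ}
    (hg : DifferentiableAt ℝ g (x + y * I)) :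
    HasDerivAt (fun y : ℝ ↦ g (x + y * I)) (fderiv ℝ g (x + y * I) I) y := by
  have h1 : HasDerivAt (fun y : ℝ ↦ (x : ℂ) + y * I) I y := by
    simpa using (((hasDerivAt_id y).ofReal_comp).mul_const I).const_add (x : ℂ)
  exact hg.hasFDerivAt.comp_hasDerivAt y h1

lemma hasDerivAt_horizontal {F : Type*} [NormedAddCommGroup F] [NormedSpace ℝ F] {g : ℂ → F}
    {x y : ℝ} (hg : DifferentiableAt ℝ g (x + y * I)) :
    HasDerivAt (fun x : ℝ ↦ g (x + y * I)) (fderiv ℝ g (x + y * I) 1) x := by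
  have h1 : HasDerivAt (fun x : ℝ ↦ (x : ℂ) + y * I) 1 x := by
    simpa using ((hasDerivAt_id x).ofReal_comp).add_const (y * I : ℂ)
  exact hg.hasFDerivAt.comp_hasDerivAt x h1

/-- A function of class `C²` on the upper half plane, of period `N` in `x`, that satisfies
`w_xx + w_yy = (ρ / y²) w`. -/
structure IsEigen (N : ℕ) (ρ : ℂ) (w : ℂ → E) : Prop where
  contDiffOn : ContDiffOn ℝ 2 w {z : ℂ | 0 < z.im}
  periodic : ∀ z : ℂ, 0 < z.im → w (z + N) = w z
  eigen : ∀ z : ℂ, 0 < z.im → fderiv ℝ (fderiv ℝ w) z 1 1 + fderiv ℝ (fderiv ℝ w) z I I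
    = (ρ / (z.im : ℂ) ^ 2) • w z

namespace IsEigen

variable {N : ℕ} {ρ : ℂ} {w : ℂ → E}

lemma continuousOn (h : IsEigen N ρ w) : ContinuousOn w {z : ℂ | 0 < z.im} :=
  h.contDiffOn.continuousOn

lemma differentiableAt (h : IsEigen N ρ w) {z : ℂ} (hz : 0 < z.im) : DifferentiableAt ℝ w z :=
  (h.contDiffOn.contDiffAt (isOpen_upper.mem_nhds hz)).differentiableAt (by norm_num)

lemma contDiffOn_fderiv (h : IsEigen N ρ w) : ContDiffOn ℝ 1 (fderiv ℝ w) {z : ℂ | 0 < z.im} :=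
  h.contDiffOn.fderiv_of_isOpen isOpen_upper (by norm_num)

lemma differentiableAt_fderiv (h : IsEigen N ρ w) {z : ℂ} (hz : 0 < z.im) :
    DifferentiableAt ℝ (fderiv ℝ w) z :=
  (h.contDiffOn_fderiv.contDiffAt (isOpen_upper.mem_nhds hz)).differentiableAt (by norm_num)

lemma continuousOn_fderiv (h : IsEigen N ρ w) (v : ℂ) :
    ContinuousOn (fun z ↦ fderiv ℝ w z v) {z : ℂ | 0 < z.im} :=
  h.contDiffOn_fderiv.continuousOn.clm_apply continuousOn_const

lemma continuousOn_fderiv_fderiv (h : IsEigen N ρ w) (v v' : ℂ) :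
    ContinuousOn (fun z ↦ fderiv ℝ (fderiv ℝ w) z v v') {z : ℂ | 0 < z.im} :=
  ((h.contDiffOn_fderiv.continuousOn_fderiv_of_isOpen isOpen_upper le_rfl).clm_apply
    continuousOn_const).clm_apply continuousOn_const

lemma fderiv_periodic (h : IsEigen N ρ w) {x y : ℝ} (hy : 0 < y) :
    fderiv ℝ w ((x + N : ℝ) + y * I) 1 = fderiv ℝ w (x + y * I) 1 := by
  have h1 := (hasDerivAt_horizontal (x := x + N) (y := y)
    (h.differentiableAt (by rwa [im_ofReal_add_mul_I]))).comp_add_const x (N : ℝ)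
  refine h1.unique ?_
  have h2 := hasDerivAt_horizontal (x := x) (y := y)
    (h.differentiableAt (by rwa [im_ofReal_add_mul_I]))
  refine h2.congr_of_eventuallyEq (Eventually.of_forall fun t ↦ ?_)
  have := h.periodic (t + y * I) (by rwa [im_ofReal_add_mul_I])
  change w ((t + N : ℝ) + y * I) = w (t + y * I)
  rw [← this]; push_cast; congr 1; ring

variable [CompleteSpace E]

lemma fourierInt_fderiv (h : IsEigen N ρ w) (hN : 0 < N) (k : ℤ) {y : ℝ} (hy : 0 < y) :
    fourierInt N (fun x ↦ fderiv ℝ w (x + y * I) 1) k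
      = freq N k • fourierInt N (fun x ↦ w (x + y * I)) k := by
  refine fourierInt_deriv hN (fun x ↦ hasDerivAt_horizontal (h.differentiableAt ?_))
    (continuous_comp_horizontal (h.continuousOn_fderiv 1) hy) (fun x ↦ ?_) k
  · rwa [im_ofReal_add_mul_I]
  · have := h.periodic (x + y * I) (by rwa [im_ofReal_add_mul_I])
    rw [← this]; push_cast; congr 1; ring

/-- The Fourier coefficients of an eigenfunction satisfy a Bessel type equation. -/
theorem fourierInt_ode (h : IsEigen N ρ w) (hN : 0 < N) (k : ℤ) {y : ℝ} (hy : 0 < y) :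
    HasDerivAt (fun y : ℝ ↦ fourierInt N (fun x ↦ w (x + y * I)) k)
      (fourierInt N (fun x ↦ fderiv ℝ w (x + y * I) I) k) y ∧
    HasDerivAt (fun y : ℝ ↦ fourierInt N (fun x ↦ fderiv ℝ w (x + y * I) I) k)
      (((absFreq N k : ℂ) ^ 2 + ρ / (y : ℂ) ^ 2) • fourierInt N (fun x ↦ w (x + y * I)) k) y := by
  refine ⟨hasDerivAt_fourierInt (g' := fun z ↦ fderiv ℝ w z I) h.continuousOn
    (h.continuousOn_fderiv I) (fun x y hy ↦
    hasDerivAt_vertical (h.differentiableAt (by rwa [im_ofReal_add_mul_I]))) k hy, ?_⟩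
  have h1 := hasDerivAt_fourierInt (N := N) (g := fun z ↦ fderiv ℝ w z I)
    (g' := fun z ↦ fderiv ℝ (fderiv ℝ w) z I I) (h.continuousOn_fderiv I)
    (h.continuousOn_fderiv_fderiv I I) (fun x y hy ↦ by
      have := hasDerivAt_vertical (h.differentiableAt_fderiv (z := x + y * I)
        (by rwa [im_ofReal_add_mul_I]))
      simpa using this.clm_apply (hasDerivAt_const y I)) k hy
  refine h1.congr_deriv ?_
  have h2 : fourierInt N (fun x ↦ fderiv ℝ (fderiv ℝ w) (x + y * I) 1 1) k
      = freq N k • fourierInt N (fun x ↦ fderiv ℝ w (x + y * I) 1) k := by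
    refine fourierInt_deriv hN (fun x ↦ ?_)
      (continuous_comp_horizontal (h.continuousOn_fderiv_fderiv 1 1) hy)
      (fun x ↦ h.fderiv_periodic hy) k
    have := hasDerivAt_horizontal (h.differentiableAt_fderiv (z := x + y * I)
      (by rwa [im_ofReal_add_mul_I]))
    simpa using this.clm_apply (hasDerivAt_const x (1 : ℂ))
  rw [h.fourierInt_fderiv hN k hy, smul_smul, ← sq, freq_sq] at h2
  have h3 : ∀ x : ℝ, fderiv ℝ (fderiv ℝ w) (x + y * I) I I
      = (ρ / (y : ℂ) ^ 2) • w (x + y * I) - fderiv ℝ (fderiv ℝ w) (x + y * I) 1 1 := by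
    intro x
    have := h.eigen (x + y * I) (by rwa [im_ofReal_add_mul_I])
    rw [im_ofReal_add_mul_I] at this
    rw [← this]; abel
  have i1 := (continuous_comp_horizontal h.continuousOn hy)
  have i2 := (continuous_comp_horizontal (h.continuousOn_fderiv_fderiv 1 1) hy)
  have h4 : fourierInt N (fun x ↦ fderiv ℝ (fderiv ℝ w) (x + y * I) I I) k
      = (ρ / (y : ℂ) ^ 2) • fourierInt N (fun x ↦ w (x + y * I)) k
        - fourierInt N (fun x ↦ fderiv ℝ (fderiv ℝ w) (x + y * I) 1 1) k := by
    simp only [h3]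
    rw [fourierInt_sub (by exact i1.const_smul _) i2, fourierInt_smul]
  rw [h4, h2, neg_smul, sub_neg_eq_add, add_smul, add_comm]

/-- Square integrability on the cusp, paired with an exponentially decaying function. -/
lemma integrableOn_smul_fourierInt (h : IsEigen N ρ w) (hN : 0 < N) (k : ℤ) {M : ℝ}
    (hM : ∀ (j : ℕ) (z : ℂ), 0 < z.im → ‖w (z + j)‖ ≤ M * ‖w z‖)
    (hL2 : IntegrableOn (fun p : ℝ × ℝ ↦ ‖w (p.1 + p.2 * I)‖ ^ 2 / p.2 ^ 2)
      (Set.Icc (-(1 / 2)) (1 / 2) ×ˢ Set.Ioi 1)) {b : ℝ → ℂ} (hb : ContinuousOn b (Set.Ioi 1))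
    {C c : ℝ} (hc : 0 < c) (hC0 : 0 ≤ C)
    (hC : ∀ y : ℝ, 1 ≤ y → ‖b y‖ ≤ C * Real.exp (-(c * y))) :
    IntegrableOn (fun y ↦ b y • fourierInt N (fun x ↦ w (x + y * I)) k) (Set.Ioi 1) := by
  rw [IntegrableOn, Measure.volume_eq_prod, ← Measure.prod_restrict] at hL2
  have h1 := hL2.integral_prod_right
  have h2 : IntegrableOn (fun y : ℝ ↦ (C * (1 / (c / 2))) ^ 2 * Real.exp (-c * y)) (Set.Ioi 1) :=
    (exp_neg_integrableOn_Ioi 1 hc).const_mul _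
  have hM0 : 0 ≤ |M| := abs_nonneg M
  refine Integrable.mono' ((h1.add h2).const_mul |M|) (ContinuousOn.aestronglyMeasurable
    (hb.smul fun y hy ↦ (h.fourierInt_ode hN k
      (one_pos.trans hy)).1.continuousAt.continuousWithinAt) measurableSet_Ioi) ?_
  filter_upwards [ae_restrict_mem measurableSet_Ioi] with y hy
  have hy : 1 < y := hy
  have hy0 : 0 < y := by linarith
  have hwc := continuous_comp_horizontal h.continuousOn hy0
  have h3 := norm_fourierInt_le_of_shift hN hwc (M := |M|) (fun j x ↦ by
    have := hM j (x + y * I) (by rwa [im_ofReal_add_mul_I])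
    rw [add_right_comm] at this
    push_cast
    exact this.trans (mul_le_mul_of_nonneg_right (le_abs_self M) (norm_nonneg _))) k
  have h4 : ‖b y‖ * ∫ x in (-(1 / 2) : ℝ)..1 / 2, ‖w (x + y * I)‖
      ≤ (∫ x in (-(1 / 2) : ℝ)..1 / 2, ‖w (x + y * I)‖ ^ 2 / y ^ 2) + y ^ 2 * ‖b y‖ ^ 2 := by
    have h5 : ∫ x in (-(1 / 2) : ℝ)..1 / 2, y ^ 2 * ‖b y‖ ^ 2 = y ^ 2 * ‖b y‖ ^ 2 := by
      rw [intervalIntegral.integral_const]; norm_num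
    have h6 : Continuous fun x : ℝ ↦ ‖w (x + y * I)‖ ^ 2 / y ^ 2 := (hwc.norm.pow 2).div_const _
    rw [← h5, ← intervalIntegral.integral_add (h6.intervalIntegrable _ _) (by simp),
      ← intervalIntegral.integral_const_mul]
    refine intervalIntegral.integral_mono_on (by norm_num)
      ((continuous_const.mul hwc.norm).intervalIntegrable _ _)
      ((h6.add continuous_const).intervalIntegrable _ _) fun x _ ↦ ?_
    have h6 : ‖b y‖ * ‖w (x + y * I)‖ = (‖w (x + y * I)‖ / y) * (y * ‖b y‖) := by field_simp
    rw [h6, ← div_pow, ← mul_pow]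
    nlinarith [sq_nonneg (‖w (x + y * I)‖ / y - y * ‖b y‖), sq_nonneg (‖w (x + y * I)‖ / y),
      sq_nonneg (y * ‖b y‖)]
  have h7 : y ^ 2 * ‖b y‖ ^ 2 ≤ (C * (1 / (c / 2))) ^ 2 * Real.exp (-c * y) := by
    have h8 := mul_exp_neg_le (half_pos hc) y
    have h9 : y * ‖b y‖ ≤ C * (1 / (c / 2)) * Real.exp (-(c / 2 * y)) := by
      calc y * ‖b y‖ ≤ y * (C * Real.exp (-(c * y))) := by gcongr; exact hC y hy.le
        _ = C * (y * Real.exp (-(c / 2 * y))) * Real.exp (-(c / 2 * y)) := by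
          rw [show -(c * y) = -(c / 2 * y) + -(c / 2 * y) by ring, Real.exp_add]; ring
        _ ≤ _ := by gcongr
    have h10 := pow_le_pow_left₀ (by positivity) h9 2
    rw [mul_pow, mul_pow _ (Real.exp _), ← Real.exp_nat_mul] at h10
    refine h10.trans_eq ?_
    congr 2; push_cast; ring
  rw [norm_smul]
  have h11 := mul_le_mul_of_nonneg_left h3 (norm_nonneg (b y))
  rw [mul_left_comm] at h11
  refine h11.trans (mul_le_mul_of_nonneg_left ?_ hM0)
  simp only [Pi.add_apply]
  rw [integral_Icc_eq_integral_Ioc, ← intervalIntegral.integral_of_le (by norm_num)]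
  linarith

/-- The nonzero Fourier coefficients of a square integrable eigenfunction are multiples of Bessel
functions. -/
theorem exists_fourierInt_eq {ν : ℂ} (h : IsEigen N (ν ^ 2 - 1 / 4) w) (hN : 0 < N) {k : ℤ}
    (hk : k ≠ 0) {M : ℝ} (hM : ∀ (j : ℕ) (z : ℂ), 0 < z.im → ‖w (z + j)‖ ≤ M * ‖w z‖)
    (hL2 : IntegrableOn (fun p : ℝ × ℝ ↦ ‖w (p.1 + p.2 * I)‖ ^ 2 / p.2 ^ 2)
      (Set.Icc (-(1 / 2)) (1 / 2) ×ˢ Set.Ioi 1)) :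
    ∃ v : E, ∀ y : ℝ, 0 < y → fourierInt N (fun x ↦ w (x + y * I)) k
      = ((√y : ℂ) * besselK ν (absFreq N k * y)) • v := by
  have ha := absFreq_pos hN hk
  obtain ⟨b', hb, hb', C, hC0, hC⟩ := besselK_solution ν ha
  have c1 : ContinuousOn (fun y : ℝ ↦ (√y : ℂ) * besselK ν (absFreq N k * y)) (Set.Ioi 1) :=
    fun y hy ↦ (hb y (one_pos.trans hy)).continuousAt.continuousWithinAt
  have c2 : ContinuousOn b' (Set.Ioi 1) :=
    fun y hy ↦ (hb' y (one_pos.trans hy)).continuousAt.continuousWithinAt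
  have hq : ContinuousOn (fun y : ℝ ↦ (absFreq N k : ℂ) ^ 2 + (ν ^ 2 - 1 / 4) / (y : ℂ) ^ 2)
      (Set.Ioi 0) := fun y hy ↦ by
    have hy : (0 : ℝ) < y := hy
    have hy0 : (y : ℂ) ^ 2 ≠ 0 := by exact_mod_cast (by positivity : y ^ 2 ≠ 0)
    exact ContinuousAt.continuousWithinAt (by fun_prop (disch := assumption))
  have hW := wronskian_eq_zero (fun y hy ↦ (h.fourierInt_ode hN k hy).1)
    (fun y hy ↦ (h.fourierInt_ode hN k hy).2) hb hb'
    (h.integrableOn_smul_fourierInt hN k hM hL2 c1 (half_pos ha) hC0 fun y hy ↦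
      (hC y hy).1.trans_eq (by ring_nf))
    (h.integrableOn_smul_fourierInt hN k hM hL2 c2 (half_pos ha) hC0 fun y hy ↦
      (hC y hy).2.trans_eq (by ring_nf))
  have hev := (tendsto_id.const_mul_atTop ha).eventually (eventually_besselK_ne_zero ν)
  obtain ⟨y₀, hne, hy₀⟩ := (hev.and (eventually_gt_atTop 0)).exists
  refine ⟨_, eq_smul_of_wronskian_eq_zero hq (fun y hy ↦ (h.fourierInt_ode hN k hy).1)
    (fun y hy ↦ (h.fourierInt_ode hN k hy).2) hb hb' hW hy₀ (mul_ne_zero ?_ hne)⟩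
  exact_mod_cast (Real.sqrt_pos.2 hy₀).ne'

end IsEigen

/-- Vectors `c_n` for which `√y K_ν(α (n+1) y) c_n` stays bounded for every `y` grow
subexponentially. -/
lemma isSubExp_of_besselK {ν : ℂ} {α : ℝ} (hα : 0 < α) {c : ℕ → E}
    (h : ∀ y : ℝ, 0 < y → ∃ D, ∀ n : ℕ, ‖((√y : ℂ) * besselK ν (α * (n + 1) * y)) • c n‖ ≤ D) :
    IsSubExp c := by
  intro ε hε
  obtain ⟨c₀, x₀, hc₀, hx₀, hlow⟩ := exists_le_norm_besselK ν
  set y := ε / (2 * α) with hy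
  have hy0 : 0 < y := by positivity
  obtain ⟨D, hD⟩ := h y hy0
  have hD0 : 0 ≤ D := (norm_nonneg _).trans (hD 0)
  obtain ⟨n₀, hn₀⟩ := exists_nat_ge (x₀ / (α * y))
  refine ⟨D / c₀ * (1 + 2 * α / ε) + ∑ i ∈ Finset.range n₀, ‖c i‖, by positivity, fun n ↦ ?_⟩
  have hexp : 1 ≤ Real.exp (ε * (n + 1)) := Real.one_le_exp (by positivity)
  rw [add_mul]
  rcases lt_or_ge n n₀ with hn | hn
  · have h1 := Finset.single_le_sum (f := fun i ↦ ‖c i‖) (fun i _ ↦ norm_nonneg (c i))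
      (Finset.mem_range.2 hn)
    have h2 : 0 ≤ D / c₀ * (1 + 2 * α / ε) * Real.exp (ε * (n + 1)) := by positivity
    have h3 : 0 ≤ ∑ i ∈ Finset.range n₀, ‖c i‖ := by positivity
    nlinarith
  · have h3 : 0 ≤ (∑ i ∈ Finset.range n₀, ‖c i‖) * Real.exp (ε * (n + 1)) := by positivity
    refine le_trans ?_ (le_add_of_nonneg_right h3)
    set r := α * (n + 1) with hr
    have hr0 : 0 < r := by positivity
    have hx : x₀ ≤ r * y := by
      have h4 : (n₀ : ℝ) ≤ n := by exact_mod_cast hn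
      rw [div_le_iff₀ (by positivity)] at hn₀
      have : n₀ * (α * y) ≤ n * (α * y) := by gcongr
      rw [hr]; nlinarith [mul_pos hα hy0]
    have h5 := hlow (r * y) hx
    rw [Real.sqrt_mul hr0.le, ofReal_mul, mul_assoc (√r : ℂ), norm_mul, norm_real,
      Real.norm_of_nonneg (Real.sqrt_nonneg _)] at h5
    have h6 := hD n
    rw [norm_smul] at h6
    have hry : r * y = ε / 2 * (n + 1) := by rw [hr, hy]; field_simp
    have h7 : √r ≤ (1 + 2 * α / ε) * Real.exp (ε / 2 * (n + 1)) := by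
      have e1 : 1 ≤ Real.exp (ε / 2 * (n + 1)) := Real.one_le_exp (by positivity)
      have e2 := Real.add_one_le_exp (ε / 2 * (n + 1))
      have e3 : √r ≤ 1 + r := by
        rw [Real.sqrt_le_left (by positivity)]; nlinarith
      have e4 : r = 2 * α / ε * (ε / 2 * (n + 1)) := by rw [hr]; field_simp
      have e5 : 2 * α / ε * (ε / 2 * (n + 1)) ≤ 2 * α / ε * Real.exp (ε / 2 * (n + 1)) := by
        gcongr; linarith
      rw [add_mul, one_mul]
      linarith
    have h8 : c₀ * Real.exp (-(r * y)) * ‖c n‖ ≤ √r * D := by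
      calc _ ≤ √r * ‖(√y : ℂ) * besselK ν (r * y)‖ * ‖c n‖ := by gcongr
        _ = √r * (‖(√y : ℂ) * besselK ν (r * y)‖ * ‖c n‖) := by ring
        _ ≤ √r * D := by gcongr
    have h9 : Real.exp (r * y) * Real.exp (-(r * y)) = 1 := by rw [← Real.exp_add]; simp
    calc ‖c n‖ = (Real.exp (r * y) / c₀) * (c₀ * Real.exp (-(r * y)) * ‖c n‖) := by
          rw [show (Real.exp (r * y) / c₀) * (c₀ * Real.exp (-(r * y)) * ‖c n‖)
            = (Real.exp (r * y) * Real.exp (-(r * y))) * ‖c n‖ * (c₀ / c₀) by ring, h9,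
            div_self hc₀.ne']; ring
      _ ≤ (Real.exp (r * y) / c₀) * (((1 + 2 * α / ε) * Real.exp (ε / 2 * (n + 1))) * D) := by
          refine mul_le_mul_of_nonneg_left ?_ (by positivity)
          exact h8.trans (mul_le_mul_of_nonneg_right h7 hD0)
      _ = D / c₀ * (1 + 2 * α / ε) * (Real.exp (r * y) * Real.exp (ε / 2 * (n + 1))) := by ring
      _ = _ := by rw [← Real.exp_add, hry]; ring_nf

end Eigenfunction

/-! ### The Fourier coefficients of a cusp form -/

section CuspForm

lemma IsSubExp.of_norm_le {E F : Type*} [NormedAddCommGroup E] [NormedAddCommGroup F] {c : ℕ → E}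
    {c' : ℕ → F} (hc : IsSubExp c) (h : ∀ n, ‖c' n‖ ≤ ‖c n‖) : IsSubExp c' := by
  intro ε hε
  obtain ⟨C, hC0, hC⟩ := hc ε hε
  exact ⟨C, hC0, fun n ↦ (h n).trans (hC n)⟩

lemma IsSubExp.mul_cpow {E : Type*} [NormedAddCommGroup E] [NormedSpace ℂ E] {c : ℕ → E}
    (hc : IsSubExp c) (ν : ℂ) : IsSubExp fun n ↦ (((n + 1 : ℕ) : ℂ) ^ ν) • c n := by
  have h : ∀ m : ℕ, IsSubExp fun n ↦ (((n + 1 : ℕ) : ℂ) ^ m) • c n := by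
    intro m
    induction m with
    | zero => simpa using hc
    | succ m ih =>
      have := ih.mul_nat 1
      simp only [one_mul, smul_smul] at this
      simpa only [pow_succ'] using this
  obtain ⟨m, hm⟩ := exists_nat_ge ν.re
  refine (h m).of_norm_le fun n ↦ ?_
  rw [norm_smul, norm_smul]
  refine mul_le_mul_of_nonneg_right ?_ (norm_nonneg _)
  rw [norm_natCast_cpow_of_pos (Nat.succ_pos n), norm_pow, norm_natCast, ← Real.rpow_natCast]
  refine Real.rpow_le_rpow_of_exponent_le ?_ hm
  exact_mod_cast Nat.succ_le_succ (Nat.zero_le n)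

/-- The pointwise form of `exists_besselK_eq_abel` for integral multiples of a frequency. -/
lemma exists_besselK_nat_eq_abel {ν s : ℂ} (hsν : s = ν + 1 / 2) (hs : 0 < s.re) {α : ℝ}
    (hα : 0 < α) :
    ∃ d : ℂ, d ≠ 0 ∧ ∀ (n : ℕ) (y : ℝ), 0 < y → (√y : ℂ) * besselK ν (α * (n + 1) * y)
      = d * (((n + 1 : ℕ) : ℂ) ^ ν * abel s (fun q ↦ exp (-((α * (n + 1) : ℝ) * q))) y) := by
  obtain ⟨d, hd, h⟩ := exists_besselK_eq_abel hsν hs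
  have hα' : (α : ℂ) ≠ 0 := by exact_mod_cast hα.ne'
  refine ⟨d * (α : ℂ) ^ ν, mul_ne_zero hd (by simp [cpow_eq_zero_iff, hα']), fun n y hy ↦ ?_⟩
  rw [h (α * (n + 1)) y (by positivity) hy, ofReal_mul, ← mul_assoc, ← mul_assoc]
  have : ((α : ℂ) * ((n + 1 : ℝ) : ℂ)) ^ ν = (α : ℂ) ^ ν * ((n + 1 : ℕ) : ℂ) ^ ν := by
    rw [mul_cpow_ofReal_nonneg hα.le (by positivity)]
    push_cast; rfl
  rw [this]
  ring

lemma summable_norm_besselK_smul {E : Type*} [NormedAddCommGroup E] [NormedSpace ℂ E] {ν : ℂ}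
    (hν : -1 / 2 < ν.re) {c : ℕ → E} (hc : IsSubExp c) {α y : ℝ} (hα : 0 < α) (hy : 0 < y) :
    Summable fun n : ℕ ↦ ‖((√y : ℂ) * besselK ν (α * (n + 1) * y)) • c n‖ := by
  have hs : 0 < (ν + 1 / 2).re := by norm_num; linarith
  obtain ⟨d, -, h⟩ := exists_besselK_nat_eq_abel rfl hs hα
  have h1 : IsSubExp fun n ↦ ((‖c n‖ : ℝ) : ℂ) := hc.of_norm_le fun n ↦ by simp
  have h2 := (hasSum_abel_expSeries (h1.mul_cpow ν) hα hs hy).summable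
  have h3 := (summable_norm_iff.2 h2).mul_left ‖d‖
  refine h3.congr fun n ↦ ?_
  rw [h n y hy]
  simp only [norm_smul, norm_mul, norm_real, norm_norm, smul_eq_mul]
  ring

variable {V : Type*} [NormedAddCommGroup V] [NormedSpace ℂ V] {η : Representation ℂ PSL(2, ℤ) V}

lemma ord_pos (hfin : (Set.range fun γ : PSL(2, ℤ) ↦ η γ).Finite) : 0 < ord η := by
  have hinf : ¬ Function.Injective fun n : ℕ ↦ (⟨η (T ^ n), T ^ n, rfl⟩ :
      Set.range fun γ : PSL(2, ℤ) ↦ η γ) := by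
    have := hfin.to_subtype
    exact not_injective_infinite_finite _
  obtain ⟨i, j, hij, hne⟩ : ∃ i j : ℕ, η (T ^ i) = η (T ^ j) ∧ i < j := by
    simp only [Function.Injective, not_forall] at hinf
    obtain ⟨i, j, h, hne⟩ := hinf
    rcases lt_or_gt_of_ne hne with h' | h'
    · exact ⟨i, j, congrArg Subtype.val h, h'⟩
    · exact ⟨j, i, (congrArg Subtype.val h).symm, h'⟩
  rw [ord, orderOf_pos_iff, isOfFinOrder_iff_pow_eq_one]
  refine ⟨j - i, Nat.sub_pos_of_lt hne, ?_⟩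
  rw [← map_pow, pow_sub _ hne.le, map_mul, ← hij, ← map_mul, mul_inv_cancel, map_one]

variable {ν : ℂ} {u : UpperHalfPlane → V}

omit [NormedAddCommGroup V] [NormedSpace ℂ V] in
lemma comp_ofComplex_of_im_pos (u : UpperHalfPlane → V) {z : ℂ} (hz : 0 < z.im) :
    (u ∘ UpperHalfPlane.ofComplex) z = u ⟨z, hz⟩ := by
  rw [Function.comp_apply, UpperHalfPlane.ofComplex_apply_of_im_pos hz]

omit [NormedAddCommGroup V] [NormedSpace ℂ V] in
lemma comp_ofComplex_coe (u : UpperHalfPlane → V) (τ : UpperHalfPlane) :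
    (u ∘ UpperHalfPlane.ofComplex) τ = u τ := by
  rw [Function.comp_apply, UpperHalfPlane.ofComplex_apply]

namespace IsMaassForm

lemma apply_add_one (h : IsMaassForm ν η u) {z : ℂ} (hz : 0 < z.im) :
    (u ∘ UpperHalfPlane.ofComplex) (z + 1) = η T ((u ∘ UpperHalfPlane.ofComplex) z) := by
  have h1 := h.equivariant ModularGroup.T ⟨z, hz⟩
  rw [comp_ofComplex_of_im_pos u hz, T, ← h1, ← comp_ofComplex_coe u]
  congr 1
  rw [UpperHalfPlane.modular_T_smul, UpperHalfPlane.coe_vadd, add_comm]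
  simp

lemma apply_add_nat (h : IsMaassForm ν η u) {z : ℂ} (hz : 0 < z.im) (n : ℕ) :
    (u ∘ UpperHalfPlane.ofComplex) (z + n) = (η T ^ n) ((u ∘ UpperHalfPlane.ofComplex) z) := by
  induction n with
  | zero => simp
  | succ n ih =>
    rw [Nat.cast_succ, ← add_assoc, h.apply_add_one (by simpa using hz), ih, pow_succ']
    rfl

lemma apply_neg_inv (h : IsMaassForm ν η u) {z : ℂ} (hz : 0 < z.im) :
    (u ∘ UpperHalfPlane.ofComplex) (-z)⁻¹ = η S ((u ∘ UpperHalfPlane.ofComplex) z) := by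
  have h1 := h.equivariant ModularGroup.S ⟨z, hz⟩
  rw [comp_ofComplex_of_im_pos u hz, S, ← h1, ← comp_ofComplex_coe u]
  congr 1
  rw [UpperHalfPlane.modular_S_smul]

/-- In real coordinates the eigenvalue equation reads `u_xx + u_yy = ((ν² - 1/4) / y²) u`. -/
lemma isEigen (h : IsMaassForm ν η u) :
    IsEigen (ord η) (ν ^ 2 - 1 / 4) (u ∘ UpperHalfPlane.ofComplex) where
  contDiffOn := h.contDiff
  periodic z hz := by
    rw [h.apply_add_nat hz, ord, pow_orderOf_eq_one]; rfl
  eigen z hz := by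
    have h1 := h.eigen ⟨z, hz⟩
    rw [InnerProductSpace.laplacian_eq_iteratedFDeriv_complexPlane] at h1
    simp only [iteratedFDeriv_two_apply] at h1
    rw [← comp_ofComplex_of_im_pos u hz] at h1
    have hz0 : (z.im : ℂ) ≠ 0 := by exact_mod_cast hz.ne'
    have h2 := congrArg (fun v ↦ (-((z.im : ℂ) ^ 2)⁻¹) • v) h1
    simp only [smul_smul] at h2
    change (-((z.im : ℂ) ^ 2)⁻¹ * -(z.im : ℂ) ^ 2) • _ = _ at h2
    rw [neg_mul_neg, inv_mul_cancel₀ (pow_ne_zero 2 hz0), one_smul] at h2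
    refine (Eq.trans ?_ h2).trans ?_
    · rfl
    · congr 1; ring

/-- Integral translations act through the finitely many powers of `η T`, so they change the norm by
a bounded factor. -/
lemma exists_shift_bound [FiniteDimensional ℂ V] (h : IsMaassForm ν η u) (hN : 0 < ord η) :
    ∃ M : ℝ, ∀ (j : ℕ) (z : ℂ), 0 < z.im → ‖(u ∘ UpperHalfPlane.ofComplex) (z + j)‖
      ≤ M * ‖(u ∘ UpperHalfPlane.ofComplex) z‖ := by
  refine ⟨∑ i ∈ Finset.range (ord η), ‖LinearMap.toContinuousLinearMap (η T ^ i)‖, fun j z hz ↦ ?_⟩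
  rw [h.apply_add_nat hz, ← pow_mod_orderOf]
  refine ((LinearMap.toContinuousLinearMap (η T ^ (j % ord η))).le_opNorm _).trans ?_
  refine mul_le_mul_of_nonneg_right ?_ (norm_nonneg _)
  exact Finset.single_le_sum (f := fun i ↦ ‖LinearMap.toContinuousLinearMap (η T ^ i)‖)
    (fun i _ ↦ norm_nonneg _) (Finset.mem_range.2 (Nat.mod_lt j hN))

/-- Square integrability over the fundamental domain gives square integrability over the cusp, in
the coordinates `(x, y)`. -/
lemma integrableOn_cusp (h : IsMaassForm ν η u) :
    IntegrableOn (fun p : ℝ × ℝ ↦ ‖(u ∘ UpperHalfPlane.ofComplex) (p.1 + p.2 * I)‖ ^ 2 / p.2 ^ 2)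
      (Set.Icc (-(1 / 2)) (1 / 2) ×ˢ Set.Ioi 1) := by
  have h1 : Integrable (fun τ ↦ ‖u τ‖ ^ 2)
      ((volume : Measure UpperHalfPlane).restrict ModularGroup.fd) :=
    MemLp.integrable_norm_pow (p := 2) (by exact_mod_cast h.sqIntegrable) two_ne_zero
  have hmeas : Measurable fun τ : UpperHalfPlane ↦ (1 / NNReal.mk τ.im τ.im_pos.le) ^ 2 := by
    refine Measurable.pow_const (Measurable.const_div ?_ 1) 2
    exact Measurable.subtype_mk UpperHalfPlane.continuous_im.measurable
  rw [UpperHalfPlane.volume_def, restrict_withDensity',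
    integrable_withDensity_iff_integrable_smul hmeas,
    UpperHalfPlane.measurableEmbedding_coe.restrict_comap] at h1
  set g : ℂ → ℝ := fun z ↦ ‖(u ∘ UpperHalfPlane.ofComplex) z‖ ^ 2 / z.im ^ 2 with hg
  have h2 : Integrable (g ∘ UpperHalfPlane.coe) (Measure.comap UpperHalfPlane.coe
      (volume.restrict (UpperHalfPlane.coe '' ModularGroup.fd))) := by
    refine h1.congr (Eventually.of_forall fun τ ↦ ?_)
    simp only [hg, Function.comp_apply, UpperHalfPlane.ofComplex_apply, NNReal.smul_def, smul_eq_mul]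
    push_cast
    rw [UpperHalfPlane.coe_im, div_pow, one_pow]
    ring
  rw [← UpperHalfPlane.measurableEmbedding_coe.integrable_map_iff,
    UpperHalfPlane.measurableEmbedding_coe.map_comap, Measure.restrict_restrict
    UpperHalfPlane.measurableEmbedding_coe.measurableSet_range] at h2
  have h3 : IntegrableOn g {z : ℂ | |z.re| ≤ 1 / 2 ∧ 1 < z.im} := by
    refine IntegrableOn.mono_set h2 fun z hz ↦ ?_
    have hz0 : 0 < z.im := one_pos.trans hz.2
    refine ⟨⟨⟨z, hz0⟩, rfl⟩, ⟨z, hz0⟩, ⟨?_, hz.1⟩, rfl⟩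
    change 1 ≤ normSq z
    rw [normSq_apply]
    nlinarith [hz.2, mul_self_nonneg z.re]
  have h4 := (Complex.volume_preserving_equiv_real_prod.symm.integrableOn_comp_preimage
    Complex.measurableEquivRealProd.symm.measurableEmbedding).2 h3
  have he : ∀ p : ℝ × ℝ, Complex.measurableEquivRealProd.symm p = p.1 + p.2 * I := by
    intro p; apply Complex.ext <;> simp
  refine (h4.mono_set fun p hp ↦ ?_).congr_fun (fun p _ ↦ ?_)
    (measurableSet_Icc.prod measurableSet_Ioi)
  · change |(Complex.measurableEquivRealProd.symm p).re| ≤ 1 / 2 ∧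
      1 < (Complex.measurableEquivRealProd.symm p).im
    rw [he, im_ofReal_add_mul_I]
    exact ⟨by simpa [abs_le] using hp.1, hp.2⟩
  · simp only [Function.comp_apply, hg, he, im_ofReal_add_mul_I]

end IsMaassForm

/-- The cusp condition is the vanishing of the zeroth Fourier coefficient. -/
lemma IsCuspForm.fourierInt_zero (h : IsCuspForm ν η u) {y : ℝ} (hy : 0 < y) :
    fourierInt (ord η) (fun x ↦ (u ∘ UpperHalfPlane.ofComplex) (x + y * I)) 0 = 0 := by
  have h1 := h.cusp ⟨((-(1 / 2) : ℝ) : ℂ) + y * I, by rwa [im_ofReal_add_mul_I]⟩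
  have h2 := intervalIntegral.integral_comp_add_right (a := 0) (b := (ord η : ℝ))
    (fun x : ℝ ↦ (u ∘ UpperHalfPlane.ofComplex) (x + y * I)) (-(1 / 2))
  rw [zero_add, add_comm (ord η : ℝ)] at h2
  rw [fourierInt]
  have h3 : freq (ord η) 0 = 0 := by simp [freq]
  simp only [h3, zero_mul, neg_zero, exp_zero, one_smul]
  rw [← h2]
  refine (congrArg ((1 / (ord η : ℂ)) • ·) (Eq.trans ?_ h1)).trans (smul_zero _)
  refine intervalIntegral.integral_congr fun t _ ↦ ?_
  rw [← comp_ofComplex_coe u, UpperHalfPlane.coe_vadd]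
  congr 1
  push_cast; ring

variable [FiniteDimensional ℂ V]

/-- The Fourier coefficients of a cusp form, as multiples of Bessel functions. -/
theorem IsCuspForm.exists_coeff (h : IsCuspForm ν η u) (hN : 0 < ord η) :
    ∃ v : ℤ → V, v 0 = 0 ∧ ∀ (k : ℤ) (y : ℝ), 0 < y →
      fourierInt (ord η) (fun x ↦ (u ∘ UpperHalfPlane.ofComplex) (x + y * I)) k
        = ((√y : ℂ) * besselK ν (absFreq (ord η) k * y)) • v k := by
  have := FiniteDimensional.complete ℂ V
  obtain ⟨M, hM⟩ := h.toIsMaassForm.exists_shift_bound hN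
  choose! v hv using fun (k : ℤ) (hk : k ≠ 0) ↦
    h.toIsMaassForm.isEigen.exists_fourierInt_eq hN hk hM h.toIsMaassForm.integrableOn_cusp
  refine ⟨fun k ↦ if k = 0 then 0 else v k, by simp, fun k y hy ↦ ?_⟩
  by_cases hk : k = 0
  · rw [hk, h.fourierInt_zero hy]; simp
  · simp only [if_neg hk]; exact hv k hk y hy

end CuspForm

/-! ### Existence and uniqueness of the Bessel coefficients -/

section Coefficients

variable {V : Type*} [NormedAddCommGroup V] [NormedSpace ℂ V]

lemma absFreq_natCast_add_one (N n : ℕ) : absFreq N ((n : ℤ) + 1) = 2 * Real.pi / N * (n + 1) := by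
  have h : |(((n : ℤ) + 1 : ℤ) : ℝ)| = n + 1 := by
    push_cast; exact abs_of_nonneg (by positivity)
  rw [absFreq, h]; ring

lemma absFreq_neg (N : ℕ) (k : ℤ) : absFreq N (-k) = absFreq N k := by
  simp [absFreq]

lemma two_pi_div_pos {N : ℕ} (hN : 0 < N) : 0 < 2 * Real.pi / N := by
  have : (0 : ℝ) < N := by exact_mod_cast hN
  have := Real.pi_pos
  positivity

lemma freq_natCast_add_one (N n : ℕ) :
    freq N ((n : ℤ) + 1) = (2 * Real.pi / N : ℝ) * I * ((n + 1 : ℕ) : ℂ) := by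
  rw [freq]; push_cast; ring

lemma freq_neg (N : ℕ) (k : ℤ) : freq N (-k) = -freq N k := by
  rw [freq, freq]; push_cast; ring

/-- Subexponential growth in both directions of a family of coefficients indexed by `ℤ`. -/
structure IsSubExpInt (v : ℤ → V) : Prop where
  pos : IsSubExp fun n : ℕ ↦ v ((n : ℤ) + 1)
  neg : IsSubExp fun n : ℕ ↦ v (-((n : ℤ) + 1))

/-- Two-sided form of `isSubExp_of_besselK`. -/
lemma isSubExpInt_of_besselK {ν : ℂ} {N : ℕ} (hN : 0 < N) {v : ℤ → V}
    (h : ∀ y : ℝ, 0 < y → ∃ D, ∀ k : ℤ, ‖((√y : ℂ) * besselK ν (absFreq N k * y)) • v k‖ ≤ D) :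
    IsSubExpInt v := by
  constructor <;> refine isSubExp_of_besselK (ν := ν) (two_pi_div_pos hN) fun y hy ↦ ?_ <;>
    obtain ⟨D, hD⟩ := h y hy <;> refine ⟨D, fun n ↦ ?_⟩
  · have := hD ((n : ℤ) + 1)
    rwa [absFreq_natCast_add_one] at this
  · have := hD (-((n : ℤ) + 1))
    rwa [absFreq_neg, absFreq_natCast_add_one] at this

lemma IsSubExpInt.freq_smul {v : ℤ → V} (hv : IsSubExpInt v) (N : ℕ) :
    IsSubExpInt fun k ↦ freq N k • v k := by
  constructor
  · simpa only [freq_natCast_add_one] using hv.pos.mul_nat ((2 * Real.pi / N : ℝ) * I)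
  · have := (hv.neg.mul_nat ((2 * Real.pi / N : ℝ) * I)).neg
    simpa only [freq_neg, freq_natCast_add_one, neg_smul] using this

lemma IsSubExpInt.summable_norm {ν : ℂ} (hν : -1 / 2 < ν.re) {N : ℕ} (hN : 0 < N) {v : ℤ → V}
    (hv : IsSubExpInt v) {y : ℝ} (hy : 0 < y) :
    Summable fun k : ℤ ↦ ‖((√y : ℂ) * besselK ν (absFreq N k * y)) • v k‖ := by
  refine Summable.of_add_one_of_neg_add_one ?_ ?_
  · simpa only [absFreq_natCast_add_one] using
      summable_norm_besselK_smul hν hv.pos (two_pi_div_pos hN) hy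
  · simpa only [absFreq_neg, absFreq_natCast_add_one] using
      summable_norm_besselK_smul hν hv.neg (two_pi_div_pos hN) hy

/-- A Bessel series over `ℤ` folds into an Abel transform of an exponential series. -/
lemma IsSubExpInt.abel_expSeries_eq [CompleteSpace V] {ν s : ℂ} (hs : 0 < s.re) {N : ℕ}
    (hN : 0 < N) {v : ℤ → V} (hv : IsSubExpInt v) {d : ℂ}
    (hd : ∀ (n : ℕ) (y : ℝ), 0 < y → (√y : ℂ) * besselK ν (2 * Real.pi / N * (n + 1) * y)
      = d * (((n + 1 : ℕ) : ℂ) ^ ν *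
        abel s (fun q ↦ exp (-((2 * Real.pi / N * (n + 1) : ℝ) * q))) y)) (hv0 : v 0 = 0)
    {y : ℝ} (hy : 0 < y) {w : V}
    (hw : HasSum (fun k : ℤ ↦ ((√y : ℂ) * besselK ν (absFreq N k * y)) • v k) w) :
    w = d • abel s (expSeries (2 * Real.pi / N) fun n ↦
      ((n + 1 : ℕ) : ℂ) ^ ν • (v ((n : ℤ) + 1) + v (-((n : ℤ) + 1)))) y := by
  have h1 := (hasSum_nat_add_iff' 1).2 hw.nat_add_neg
  simp only [Finset.range_one, Finset.sum_singleton, Nat.cast_zero, neg_zero, hv0, smul_zero,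
    add_zero, sub_zero] at h1
  have h2 := (hasSum_abel_expSeries ((hv.pos.add hv.neg).mul_cpow ν) (two_pi_div_pos hN) hs
    hy).const_smul d
  refine h1.unique (h2.congr_fun fun n ↦ ?_)
  push_cast
  rw [absFreq_neg, absFreq_natCast_add_one, ← smul_add, hd n y hy, smul_smul, smul_smul]
  push_cast
  congr 1
  ring

variable {ν : ℂ} {η : Representation ℂ PSL(2, ℤ) V} {u : UpperHalfPlane → V} {v : ℤ → V}

/-- The expansion in terms of real coordinates. -/
lemma IsFourierCoeff.hasSum (hv : IsFourierCoeff ν η u v) (x : ℝ) {y : ℝ} (hy : 0 < y) :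
    HasSum (fun k : ℤ ↦ exp (freq (ord η) k * x) •
      ((√y : ℂ) * besselK ν (absFreq (ord η) k * y)) • v k)
      ((u ∘ UpperHalfPlane.ofComplex) (x + y * I)) := by
  have hz : 0 < ((x : ℂ) + y * I).im := by rwa [im_ofReal_add_mul_I]
  have h1 := hv.2 ⟨x + y * I, hz⟩
  rw [comp_ofComplex_of_im_pos u hz]
  have e1 : UpperHalfPlane.im ⟨x + y * I, hz⟩ = y := im_ofReal_add_mul_I x y
  have e2 : UpperHalfPlane.re ⟨x + y * I, hz⟩ = x := by
    change ((x : ℂ) + y * I).re = x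
    simp
  rw [e1, e2] at h1
  refine h1.congr_fun fun k ↦ ?_
  rw [smul_smul, mul_comm]
  rfl

lemma isFourierCoeff_of_hasSum (hv0 : v 0 = 0) (h : ∀ x y : ℝ, 0 < y → HasSum (fun k : ℤ ↦
    exp (freq (ord η) k * x) • ((√y : ℂ) * besselK ν (absFreq (ord η) k * y)) • v k)
      ((u ∘ UpperHalfPlane.ofComplex) (x + y * I))) : IsFourierCoeff ν η u v := by
  refine ⟨hv0, fun z ↦ ?_⟩
  have h1 := h z.re z.im z.im_pos
  have e : (z.re : ℂ) + z.im * I = z := re_add_im (z : ℂ)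
  rw [e, comp_ofComplex_coe] at h1
  refine h1.congr_fun fun k ↦ ?_
  rw [smul_smul, mul_comm]
  rfl

variable [FiniteDimensional ℂ V]

/-- A Bessel expansion is a Fourier expansion on every horizontal line. -/
lemma IsFourierCoeff.fourierInt_eq (hN : 0 < ord η) (hv : IsFourierCoeff ν η u v) (k : ℤ) {y : ℝ}
    (hy : 0 < y) :
    fourierInt (ord η) (fun x ↦ (u ∘ UpperHalfPlane.ofComplex) (x + y * I)) k
      = ((√y : ℂ) * besselK ν (absFreq (ord η) k * y)) • v k := by
  have := FiniteDimensional.complete ℂ V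
  refine fourierInt_of_hasSum hN ?_ (fun x ↦ hv.hasSum x hy) k
  have h1 := (hv.hasSum 0 hy).summable
  simp only [ofReal_zero, mul_zero, exp_zero, one_smul] at h1
  -- in finite dimension, convergence of the series at `x = 0` is absolute convergence
  exact h1.norm

lemma IsFourierCoeff.unique (hN : 0 < ord η) {v v' : ℤ → V} (hv : IsFourierCoeff ν η u v)
    (hv' : IsFourierCoeff ν η u v') : v = v' := by
  funext k
  rcases eq_or_ne k 0 with rfl | hk
  · rw [hv.1, hv'.1]
  have hev := (tendsto_id.const_mul_atTop (absFreq_pos hN hk)).eventually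
    (eventually_besselK_ne_zero ν)
  obtain ⟨y, hne, hy⟩ := (hev.and (eventually_gt_atTop 0)).exists
  have h1 := (hv.fourierInt_eq hN k hy).symm.trans (hv'.fourierInt_eq hN k hy)
  refine smul_right_injective V (mul_ne_zero ?_ hne) h1
  exact_mod_cast (Real.sqrt_pos.2 hy).ne'

lemma IsFourierCoeff.isSubExpInt (hN : 0 < ord η) (hv : IsFourierCoeff ν η u v) :
    IsSubExpInt v :=
  isSubExpInt_of_besselK hN fun y hy ↦ ⟨_, fun k ↦ by
    rw [← hv.fourierInt_eq hN k hy]; exact norm_fourierInt_le k⟩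

/-- Every cusp form is the sum of its Bessel expansion: the Fourier coefficients are absolutely
summable because `K_ν` decays exponentially and the `v_k` grow subexponentially. -/
theorem IsCuspForm.exists_isFourierCoeff (hν : -1 / 2 < ν.re) (h : IsCuspForm ν η u)
    (hN : 0 < ord η) : ∃ v, IsFourierCoeff ν η u v := by
  have := FiniteDimensional.complete ℂ V
  obtain ⟨v, hv0, hv⟩ := h.exists_coeff hN
  have hsub : IsSubExpInt v := isSubExpInt_of_besselK hN fun y hy ↦ ⟨_, fun k ↦ by
    rw [← hv k y hy]; exact norm_fourierInt_le k⟩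
  refine ⟨v, isFourierCoeff_of_hasSum hv0 fun x y hy ↦ ?_⟩
  have hw := h.toIsMaassForm.isEigen
  have h1 := hasSum_fourierInt hN (continuous_comp_horizontal hw.continuousOn hy) (fun x ↦ ?_)
    (by simpa only [hv _ y hy] using hsub.summable_norm hν hN hy) x
  · simpa only [hv _ y hy] using h1
  · have := hw.periodic (x + y * I) (by rwa [im_ofReal_add_mul_I])
    rw [← this]; push_cast; congr 1; ring

/-- The Fourier expansion of the derivative in the horizontal direction, on the imaginary axis. -/
lemma IsCuspForm.hasSum_fderiv (hν : -1 / 2 < ν.re) (h : IsCuspForm ν η u)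
    (hN : 0 < ord η) (hv : IsFourierCoeff ν η u v) {y : ℝ} (hy : 0 < y) :
    HasSum (fun k : ℤ ↦ ((√y : ℂ) * besselK ν (absFreq (ord η) k * y)) • freq (ord η) k • v k)
      (fderiv ℝ (u ∘ UpperHalfPlane.ofComplex) (y * I) 1) := by
  have := FiniteDimensional.complete ℂ V
  have hw := h.toIsMaassForm.isEigen
  have hc : ∀ k : ℤ, fourierInt (ord η)
      (fun x ↦ fderiv ℝ (u ∘ UpperHalfPlane.ofComplex) (x + y * I) 1) k
      = ((√y : ℂ) * besselK ν (absFreq (ord η) k * y)) • freq (ord η) k • v k := fun k ↦ by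
    rw [hw.fourierInt_fderiv hN k hy, hv.fourierInt_eq hN k hy, smul_comm]
  have h1 := hasSum_fourierInt hN (continuous_comp_horizontal (hw.continuousOn_fderiv 1) hy)
    (fun x ↦ hw.fderiv_periodic hy)
    (by simpa only [hc] using ((hv.isSubExpInt hN).freq_smul (ord η)).summable_norm hν hN hy) 0
  simpa only [hc, ofReal_zero, mul_zero, exp_zero, one_smul, zero_add] using h1

/-- The Fourier coefficients are eigenvectors of `η T`, by uniqueness of the expansion of
`η(T) u(z - 1) = u(z)`. -/
lemma IsCuspForm.eta_T_coeff (h : IsCuspForm ν η u)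
    (hN : 0 < ord η) (hv : IsFourierCoeff ν η u v) (k : ℤ) :
    η T (v k) = exp (freq (ord η) k) • v k := by
  have h1 : IsFourierCoeff ν η u fun k ↦ exp (-freq (ord η) k) • η T (v k) := by
    refine isFourierCoeff_of_hasSum (by simp [hv.1]) fun x y hy ↦ ?_
    have h2 := (hv.hasSum (x - 1) hy).mapL (LinearMap.toContinuousLinearMap (η T))
    have h3 := h.toIsMaassForm.apply_add_one (z := (x - 1 : ℝ) + y * I)
      (by rwa [im_ofReal_add_mul_I])
    rw [show ((x - 1 : ℝ) : ℂ) + y * I + 1 = x + y * I by push_cast; ring] at h3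
    rw [h3]
    refine h2.congr_fun fun k ↦ ?_
    simp only [map_smul, LinearMap.coe_toContinuousLinearMap']
    rw [smul_comm _ (exp (-freq (ord η) k)), smul_smul, ← exp_add]
    congr 2
    push_cast; ring
  have h2 := congrFun (hv.unique hN h1) k
  conv_rhs => rw [h2]
  rw [smul_smul, ← exp_add, add_neg_cancel, exp_zero, one_smul]

end Coefficients

/-! ### The function attached to a family of coefficients -/

section LewisFunction

variable {V : Type*} [NormedAddCommGroup V] [NormedSpace ℂ V]

lemma expSeries_smul (α : ℝ) (a : ℂ) (c : ℕ → V) (q : ℂ) :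
    expSeries α (fun n ↦ a • c n) q = a • expSeries α c q := by
  simp only [expSeries, smul_comm _ a]
  exact tsum_const_smul'' a

/-- The exponential series `∑ n^ν e^{-2π n q / N} v_n` over positive indices. -/
def coeffSeries (N : ℕ) (ν : ℂ) (v : ℕ → V) : ℂ → V :=
  expSeries (2 * Real.pi / N) fun n ↦ ((n + 1 : ℕ) : ℂ) ^ ν • v n

/-- The function on `ℂ ∖ ℝ` whose expansion on the upper half plane is given by the coefficients
with positive index and on the lower half plane by those with negative index. -/
def lewisFun (N : ℕ) (ν : ℂ) (v : ℤ → V) (z : ℂ) : V :=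
  if 0 < z.im then coeffSeries N ν (fun n ↦ v ((n : ℤ) + 1)) (-I * z)
  else -coeffSeries N ν (fun n ↦ v (-((n : ℤ) + 1))) (I * z)

lemma neg_I_mul_re (z : ℂ) : (-I * z).re = z.im := by simp

lemma I_mul_re_eq (z : ℂ) : (I * z).re = -z.im := by simp

lemma IsExpDecay.tendsto_zero {F : ℂ → V} (h : IsExpDecay F) :
    Tendsto F (comap re atTop) (𝓝 0) := by
  obtain ⟨c, hc, hd⟩ := h.decay
  obtain ⟨C, hC⟩ := hd 1 one_pos
  have h1 : Tendsto (fun q : ℂ ↦ C * Real.exp (-c * q.re)) (comap re atTop) (𝓝 0) := by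
    have h2 : Tendsto (fun t : ℝ ↦ C * Real.exp (-c * t)) atTop (𝓝 (C * 0)) :=
      (Real.tendsto_exp_atBot.comp (tendsto_id.const_mul_atTop_of_neg (neg_lt_zero.2 hc))).const_mul C
    rw [mul_zero] at h2
    exact h2.comp tendsto_comap
  refine squeeze_zero_norm' ?_ h1
  filter_upwards [tendsto_comap.eventually (eventually_ge_atTop (1 : ℝ))] with q hq using hC q hq

variable {N : ℕ} {ν : ℂ} {v : ℤ → V}

section Complete

variable [CompleteSpace V]

lemma isExpDecay_coeffSeries (hN : 0 < N) {c : ℕ → V} (hc : IsSubExp c) :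
    IsExpDecay (coeffSeries N ν c) :=
  isExpDecay_expSeries (hc.mul_cpow ν) (two_pi_div_pos hN)

lemma coeffSeries_add (hN : 0 < N) {c d : ℕ → V} (hc : IsSubExp c) (hd : IsSubExp d) {q : ℂ}
    (hq : 0 < q.re) :
    coeffSeries N ν (fun n ↦ c n + d n) q = coeffSeries N ν c q + coeffSeries N ν d q := by
  have h1 := hasSum_expSeries (hc.mul_cpow ν) (two_pi_div_pos hN) hq
  have h2 := hasSum_expSeries (hd.mul_cpow ν) (two_pi_div_pos hN) hq
  have h3 := hasSum_expSeries ((hc.add hd).mul_cpow ν) (two_pi_div_pos hN) hq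
  refine h3.unique ((h1.add h2).congr_fun fun n ↦ ?_)
  rw [smul_add, smul_add]

omit [CompleteSpace V] in
lemma coeffSeries_neg (N : ℕ) (ν : ℂ) (c : ℕ → V) (q : ℂ) :
    coeffSeries N ν (fun n ↦ -c n) q = -coeffSeries N ν c q := by
  have := expSeries_smul (2 * Real.pi / N) (-1) (fun n ↦ ((n + 1 : ℕ) : ℂ) ^ ν • c n) q
  simp only [neg_smul, one_smul, ← smul_neg] at this
  exact this

lemma differentiableOn_lewisFun (hN : 0 < N) (hv : IsSubExpInt v) :
    DifferentiableOn ℂ (lewisFun N ν v) nonreal := by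
  intro z hz
  refine DifferentiableAt.differentiableWithinAt ?_
  have hhalf : IsOpen {q : ℂ | 0 < q.re} := isOpen_lt continuous_const continuous_re
  rcases lt_or_gt_of_ne (show z.im ≠ 0 from hz) with h | h
  · have h1 : DifferentiableAt ℂ (fun z ↦ -coeffSeries N ν (fun n ↦ v (-((n : ℤ) + 1))) (I * z)) z :=
      (DifferentiableAt.comp z (((isExpDecay_coeffSeries hN hv.neg).diff.differentiableAt
        (hhalf.mem_nhds (by rw [Set.mem_ofPred_eq, I_mul_re_eq]; linarith)))) (by fun_prop)).neg
    refine h1.congr_of_eventuallyEq ?_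
    filter_upwards [(isOpen_lt continuous_im continuous_const).mem_nhds h] with w hw
    exact if_neg (not_lt.2 (le_of_lt hw))
  · have h1 : DifferentiableAt ℂ (fun z ↦ coeffSeries N ν (fun n ↦ v ((n : ℤ) + 1)) (-I * z)) z :=
      DifferentiableAt.comp z (((isExpDecay_coeffSeries hN hv.pos).diff.differentiableAt
        (hhalf.mem_nhds (by rw [Set.mem_ofPred_eq, neg_I_mul_re]; exact h)))) (by fun_prop)
    refine h1.congr_of_eventuallyEq ?_
    filter_upwards [isOpen_upper.mem_nhds h] with w hw
    exact if_pos hw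

lemma tendsto_lewisFun (hN : 0 < N) (hv : IsSubExpInt v) :
    Tendsto (lewisFun N ν v) (comap (fun z : ℂ ↦ |z.im|) atTop) (𝓝 0) := by
  have h0 : Tendsto (fun z : ℂ ↦ |z.im|) (comap (fun z : ℂ ↦ |z.im|) atTop) atTop := tendsto_comap
  refine Tendsto.if ?_ ?_
  · refine (isExpDecay_coeffSeries hN hv.pos).tendsto_zero.comp (tendsto_comap_iff.2 ?_)
    refine (h0.mono_left inf_le_left).congr' ?_
    filter_upwards [mem_inf_of_right (mem_principal_self _)] with z hz
    rw [Function.comp_apply, neg_I_mul_re, abs_of_pos hz]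
  · rw [← neg_zero (G := V)]
    refine ((isExpDecay_coeffSeries hN hv.neg).tendsto_zero.comp (tendsto_comap_iff.2 ?_)).neg
    refine (h0.mono_left inf_le_left).congr' ?_
    filter_upwards [mem_inf_of_right (mem_principal_self _)] with z hz
    rw [Function.comp_apply, I_mul_re_eq, abs_of_nonpos (not_lt.1 hz)]

lemma hasSum_lewisFun_of_pos (hN : 0 < N) (hv : IsSubExpInt v) {z : ℂ} (hz : 0 < z.im) :
    HasSum (fun n : ℕ ↦ (((n + 1 : ℕ) : ℂ) ^ ν * exp (freq N ((n : ℤ) + 1) * z)) • v ((n : ℤ) + 1))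
      (lewisFun N ν v z) := by
  rw [lewisFun, if_pos hz]
  refine (hasSum_expSeries (hv.pos.mul_cpow ν) (two_pi_div_pos hN)
    (by rwa [neg_I_mul_re])).congr_fun fun n ↦ ?_
  rw [smul_smul, mul_comm, freq_natCast_add_one]
  congr 3
  push_cast; ring

lemma hasSum_lewisFun_of_neg (hN : 0 < N) (hv : IsSubExpInt v) {z : ℂ} (hz : z.im < 0) :
    HasSum (fun n : ℕ ↦ (((n + 1 : ℕ) : ℂ) ^ ν * exp (freq N (-((n : ℤ) + 1)) * z)) •
      v (-((n : ℤ) + 1))) (-lewisFun N ν v z) := by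
  rw [lewisFun, if_neg (not_lt.2 hz.le), neg_neg]
  refine (hasSum_expSeries (hv.neg.mul_cpow ν) (two_pi_div_pos hN)
    (by rw [I_mul_re_eq]; linarith)).congr_fun fun n ↦ ?_
  rw [smul_smul, mul_comm, freq_neg, freq_natCast_add_one]
  congr 3
  push_cast; ring

end Complete

/-- The positive integers as shifted natural numbers. -/
def natEquivPosInt : ℕ ≃ {k : ℤ // 0 < k} where
  toFun n := ⟨n + 1, by positivity⟩
  invFun k := (k.1 - 1).toNat
  left_inv n := by simp
  right_inv k := Subtype.ext (by have := k.2; simp only; omega)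

/-- The negative integers as shifted and reflected natural numbers. -/
def natEquivNegInt : ℕ ≃ {k : ℤ // k < 0} where
  toFun n := ⟨-(n + 1), by omega⟩
  invFun k := (-k.1 - 1).toNat
  left_inv n := by simp
  right_inv k := Subtype.ext (by have := k.2; simp only; omega)

variable {η : Representation ℂ PSL(2, ℤ) V} {u : UpperHalfPlane → V} [FiniteDimensional ℂ V]

lemma isLewisSeries_lewisFun (hN : 0 < ord η) (hv : IsSubExpInt v) :
    IsLewisSeries ν η v fun z ↦ lewisFun (ord η) ν v z := by
  have := FiniteDimensional.complete ℂ V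
  refine fun z ↦ ⟨fun hz ↦ ?_, fun hz ↦ ?_⟩
  · rw [← natEquivPosInt.hasSum_iff]
    refine (hasSum_lewisFun_of_pos hN hv hz).congr_fun fun n ↦ ?_
    have e : |(n : ℤ) + 1| = n + 1 := abs_of_nonneg (by positivity)
    simp only [Function.comp_apply, natEquivPosInt, Equiv.coe_fn_mk, e]
    push_cast
    rw [freq]; push_cast; rfl
  · rw [← natEquivNegInt.hasSum_iff]
    refine (hasSum_lewisFun_of_neg hN hv hz).congr_fun fun n ↦ ?_
    have e : |-((n : ℤ) + 1)| = n + 1 := by rw [abs_neg]; exact abs_of_nonneg (by positivity)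
    simp only [Function.comp_apply, natEquivNegInt, Equiv.coe_fn_mk, e]
    push_cast
    rw [freq]; push_cast; rfl

lemma IsCuspForm.lewisFun_add_one (h : IsCuspForm ν η u) (hN : 0 < ord η)
    (hv : IsFourierCoeff ν η u v) {z : ℂ} (hz : z.im ≠ 0) :
    lewisFun (ord η) ν v (z + 1) = η T (lewisFun (ord η) ν v z) := by
  have := FiniteDimensional.complete ℂ V
  have hs := hv.isSubExpInt hN
  have key : ∀ (k : ℤ) (a : ℂ), (a * exp (freq (ord η) k * (z + 1))) • v k
      = η T ((a * exp (freq (ord η) k * z)) • v k) := fun k a ↦ by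
    rw [map_smul, h.eta_T_coeff hN hv, smul_smul, mul_add, exp_add, mul_one, mul_assoc]
  rcases lt_or_gt_of_ne hz with hz | hz
  · have h1 := hasSum_lewisFun_of_neg (ν := ν) hN hs (z := z + 1) (by simpa using hz)
    have h2 := (hasSum_lewisFun_of_neg (ν := ν) hN hs hz).mapL (LinearMap.toContinuousLinearMap (η T))
    simp only [key] at h1
    have h3 := h1.unique h2
    rw [map_neg, neg_inj] at h3
    exact h3
  · have h1 := hasSum_lewisFun_of_pos (ν := ν) hN hs (z := z + 1) (by simpa using hz)
    have h2 := (hasSum_lewisFun_of_pos (ν := ν) hN hs hz).mapL (LinearMap.toContinuousLinearMap (η T))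
    simp only [key] at h1
    exact h1.unique h2

/-- The derivative of the transformation rule under `z ↦ -1/z`, on the imaginary axis. -/
lemma IsMaassForm.fderiv_inv (h : IsMaassForm ν η u) {y : ℝ} (hy : 0 < y) :
    fderiv ℝ (u ∘ UpperHalfPlane.ofComplex) ((y⁻¹ : ℝ) * I) 1
      = -((y : ℂ) ^ 2 • η S (fderiv ℝ (u ∘ UpperHalfPlane.ofComplex) (y * I) 1)) := by
  set w := u ∘ UpperHalfPlane.ofComplex with hw
  have hyI : 0 < ((y : ℂ) * I).im := by simpa using hy
  have hyc : (y : ℂ) ≠ 0 := by exact_mod_cast hy.ne'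
  have e1 : (-((y : ℂ) * I))⁻¹ = (y⁻¹ : ℝ) * I := by
    rw [inv_neg, mul_inv, inv_I]; push_cast; ring
  have hinv : HasDerivAt (fun z : ℂ ↦ (-z)⁻¹) (-((y : ℂ)⁻¹ ^ 2)) (y * I) := by
    have := ((hasDerivAt_id ((y : ℂ) * I)).fun_neg).fun_inv (by simpa using hyc)
    refine this.congr_deriv ?_
    simp only [id, neg_neg, neg_sq, mul_pow, I_sq]
    field_simp
  have h1 : HasFDerivAt w (fderiv ℝ w ((y⁻¹ : ℝ) * I)) (-((y : ℂ) * I))⁻¹ := by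
    rw [e1]
    exact (h.isEigen.differentiableAt (by simpa using hy)).hasFDerivAt
  have h2 := HasFDerivAt.comp ((y : ℂ) * I) h1 (hinv.hasFDerivAt.restrictScalars ℝ)
  have h3 := (((LinearMap.toContinuousLinearMap (η S)).restrictScalars ℝ).hasFDerivAt).comp
    ((y : ℂ) * I) (h.isEigen.differentiableAt hyI).hasFDerivAt
  have h4 := h2.unique (h3.congr_of_eventuallyEq (by
    filter_upwards [isOpen_upper.mem_nhds hyI] with z hz using h.apply_neg_inv hz))
  have h5 := DFunLike.congr_fun h4 1
  simp only [ContinuousLinearMap.comp_apply, ContinuousLinearMap.coe_restrictScalars',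
    LinearMap.coe_toContinuousLinearMap'] at h5
  have e2 : (ContinuousLinearMap.toSpanSingleton ℂ (-((y : ℂ)⁻¹ ^ 2))) 1
      = (-(y⁻¹ ^ 2) : ℝ) • (1 : ℂ) := by
    simp
  rw [e2, map_smul] at h5
  rw [← h5, ← ofReal_pow, Complex.coe_smul, smul_smul]
  rw [mul_neg, ← mul_pow, mul_inv_cancel₀ hy.ne', one_pow, neg_smul, neg_neg, one_smul]

end LewisFunction

/-! ### The period function of a cusp form -/

section PeriodFunction

variable {V : Type*} [NormedAddCommGroup V] [NormedSpace ℂ V] [FiniteDimensional ℂ V]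
  {ν : ℂ} {η : Representation ℂ PSL(2, ℤ) V} {u : UpperHalfPlane → V} {v : ℤ → V}

omit [FiniteDimensional ℂ V] in
/-- An identity between holomorphic functions on the right half plane that holds on the positive
real axis. -/
lemma eq_of_eq_on_pos [CompleteSpace V] {f g : ℂ → V} (hf : DifferentiableOn ℂ f {y | 0 < y.re})
    (hg : DifferentiableOn ℂ g {y | 0 < y.re}) (h : ∀ y : ℝ, 0 < y → f y = g y) {y : ℂ}
    (hy : 0 < y.re) : f y = g y := by
  refine eqOn_of_eq_on_ray (isOpen_lt continuous_const continuous_re)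
    (convex_halfSpace_re_gt 0).isPreconnected hf hg one_ne_zero (a := 1) (by simp)
    (fun t ht ↦ ?_) hy
  rw [mul_one]
  exact h t (one_pos.trans ht)

omit [FiniteDimensional ℂ V] in
lemma differentiableOn_comp_inv {f : ℂ → V} (hf : DifferentiableOn ℂ f {y | 0 < y.re}) :
    DifferentiableOn ℂ (fun y ↦ f y⁻¹) {y | 0 < y.re} := by
  have hne : ∀ y : ℂ, 0 < y.re → y ≠ 0 := by rintro y hy rfl; simp at hy
  refine hf.comp (fun y hy ↦ (differentiableAt_inv (hne y hy)).differentiableWithinAt) fun y hy ↦ ?_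
  have hy : 0 < y.re := hy
  rw [Set.mem_ofPred_eq, inv_re]
  exact div_pos hy (normSq_pos.2 (hne y hy))

/-- The function attached to a cusp form has a period function that extends to the slit plane. -/
theorem IsCuspForm.exists_period_extension (hν : -1 / 2 < ν.re) (h : IsCuspForm ν η u)
    (hN : 0 < ord η) (hv : IsFourierCoeff ν η u v) :
    ∃ ψ : ℂ → V, DifferentiableOn ℂ ψ slitPlane ∧
      (∀ δ : ℝ, 0 < δ → ∃ K : ℝ, ∀ z ∈ slitPlane, |arg z| ≤ Real.pi - δ →
        ‖ψ z‖ ≤ K * min 1 (‖z‖ ^ (-(2 * ν.re + 1)))) ∧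
      ∀ z : ℂ, z.im ≠ 0 → ψ z = lewisFun (ord η) ν v z
        - z ^ (-2 * ν - 1) • η S (lewisFun (ord η) ν v (-1 / z)) := by
  have := FiniteDimensional.complete ℂ V
  set N := ord η with hNdef
  set s : ℂ := ν + 1 / 2 with hsν
  have hsre : s.re = ν.re + 1 / 2 := by rw [hsν]; simp
  have hs : 0 < s.re := by rw [hsre]; linarith
  set A := LinearMap.toContinuousLinearMap (η S) with hA
  have hsub : IsSubExpInt v := hv.isSubExpInt hN
  have hsub' : IsSubExpInt fun k ↦ freq N k • v k := hsub.freq_smul N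
  set F₀ := coeffSeries N ν fun n ↦ v ((n : ℤ) + 1) + v (-((n : ℤ) + 1)) with hF₀
  set F₁ := coeffSeries N ν fun n ↦ v ((n : ℤ) + 1) + -v (-((n : ℤ) + 1)) with hF₁
  set G₁ := coeffSeries N ν fun n ↦ freq N ((n : ℤ) + 1) • v ((n : ℤ) + 1)
    + freq N (-((n : ℤ) + 1)) • v (-((n : ℤ) + 1)) with hG₁
  have dF₀ : IsExpDecay F₀ := isExpDecay_coeffSeries hN (hsub.pos.add hsub.neg)
  have dF₁ : IsExpDecay F₁ := isExpDecay_coeffSeries hN (hsub.pos.add hsub.neg.neg)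
  have dG₁ : IsExpDecay G₁ := isExpDecay_coeffSeries hN (hsub'.pos.add hsub'.neg)
  have hder : ∀ q : ℂ, 0 < q.re → HasDerivAt F₁ (I • G₁ q) q := fun q hq ↦ by
    refine (hasDerivAt_expSeries ((hsub.pos.add hsub.neg.neg).mul_cpow ν) (two_pi_div_pos hN)
      hq).congr_deriv ?_
    rw [hG₁, coeffSeries, ← expSeries_smul]
    congr 1
    funext n
    rw [freq_neg, freq_natCast_add_one, neg_smul, ← smul_neg, ← smul_add, smul_smul, smul_smul,
      smul_smul]
    congr 1
    linear_combination (-(2 * Real.pi / N : ℝ) * ((n + 1 : ℕ) : ℂ) * ((n + 1 : ℕ) : ℂ) ^ ν) * I_sq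
  obtain ⟨d, hd0, hd⟩ := exists_besselK_nat_eq_abel hsν hs (two_pi_div_pos hN)
  -- the values of the form and of its horizontal derivative on the imaginary axis
  have hu : ∀ y : ℝ, 0 < y → (u ∘ UpperHalfPlane.ofComplex) (y * I) = d • abel s F₀ y := fun y hy ↦ by
    have h1 := hv.hasSum 0 hy
    simp only [ofReal_zero, mul_zero, exp_zero, one_smul, zero_add] at h1
    exact hsub.abel_expSeries_eq hs hN hd hv.1 hy h1
  have hux : ∀ y : ℝ, 0 < y → fderiv ℝ (u ∘ UpperHalfPlane.ofComplex) (y * I) 1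
      = d • abel s G₁ y := fun y hy ↦
    hsub'.abel_expSeries_eq hs hN hd (by simp [hv.1]) hy (h.hasSum_fderiv hν hN hv hy)
  have h₀ : ∀ y : ℂ, 0 < y.re → abel s F₀ y⁻¹ = A (abel s F₀ y) := by
    have hd₀ := differentiableOn_abel dF₀ hs
    refine fun y hy ↦ eq_of_eq_on_pos (differentiableOn_comp_inv hd₀)
      (A.differentiable.comp_differentiableOn hd₀) (fun y hy ↦ ?_) hy
    have h1 := h.toIsMaassForm.apply_neg_inv (z := y * I) (by simpa using hy)
    have e1 : (-((y : ℂ) * I))⁻¹ = (y⁻¹ : ℝ) * I := by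
      rw [inv_neg, mul_inv, inv_I]; push_cast; ring
    rw [e1, hu _ (inv_pos.2 hy), hu _ hy, map_smul, ofReal_inv] at h1
    exact smul_right_injective V hd0 h1
  have h₁ : ∀ y : ℂ, 0 < y.re → abel s G₁ y⁻¹ = -(y ^ 2 • A (abel s G₁ y)) := by
    have hd₁ := differentiableOn_abel dG₁ hs
    refine fun y hy ↦ eq_of_eq_on_pos (g := fun y ↦ -(y ^ 2 • A (abel s G₁ y)))
      (differentiableOn_comp_inv hd₁)
      (((differentiable_id.pow 2).differentiableOn.smul
        (A.differentiable.comp_differentiableOn hd₁)).neg) (fun y hy ↦ ?_) hy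
    have h1 := h.toIsMaassForm.fderiv_inv hy
    rw [hux _ (inv_pos.2 hy), hux _ hy, map_smul, ofReal_inv, smul_comm _ d, ← smul_neg] at h1
    exact smul_right_injective V hd0 h1
  have hfu : ∀ z : ℂ, 0 < z.im →
      lewisFun N ν v z = (1 / 2 : ℂ) • (F₁ (-I * z) + F₀ (-I * z)) := fun z hz ↦ by
    have hq : 0 < (-I * z).re := by rwa [neg_I_mul_re]
    rw [lewisFun, if_pos hz, hF₁, hF₀, coeffSeries_add hN hsub.pos hsub.neg hq,
      coeffSeries_add hN hsub.pos hsub.neg.neg hq, coeffSeries_neg]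
    module
  have hfl : ∀ z : ℂ, z.im < 0 →
      lewisFun N ν v z = (1 / 2 : ℂ) • (F₁ (I * z) - F₀ (I * z)) := fun z hz ↦ by
    have hq : 0 < (I * z).re := by rw [I_mul_re_eq]; linarith
    rw [lewisFun, if_neg (not_lt.2 hz.le), hF₁, hF₀, coeffSeries_add hN hsub.pos hsub.neg hq,
      coeffSeries_add hN hsub.pos hsub.neg.neg hq, coeffSeries_neg]
    module
  have h0 : Tendsto (fun t : ℝ ↦ F₁ t) atTop (𝓝 0) :=
    dF₁.tendsto_zero.comp (tendsto_comap_iff.2 tendsto_id)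
  obtain ⟨ψ, hψ, hK, hψf⟩ := LewisCorr.exists_period_extension hs A dF₀ dG₁ hder h0 h₀ h₁ hfu hfl
  refine ⟨ψ, hψ, ?_, ?_⟩
  · rw [hsre, mul_add] at hK
    norm_num at hK ⊢
    exact hK
  · intro z hz
    have e : -2 * ν - 1 = -2 * s := by rw [hsν]; ring
    rw [e]
    exact hψf z hz

end PeriodFunction

/-! ### The three term equation -/

section ThreeTerm

lemma cpow_add_one_mul_cpow_div {t : ℝ} (ht : 0 < t) (a : ℂ) :
    ((t : ℂ) * I + 1) ^ a * ((t : ℂ) * I / (t * I + 1)) ^ a = ((t : ℂ) * I) ^ a := by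
  have h1 : (t : ℂ) * I + 1 ≠ 0 := fun h ↦ by simpa using congrArg re h
  have h2 : (t : ℂ) * I ≠ 0 := mul_ne_zero (by exact_mod_cast ht.ne') I_ne_zero
  have hre : 0 < ((t : ℂ) * I + 1).re := by simp
  have hre2 : 0 < ((t : ℂ) * I / (t * I + 1)).re := by
    have : 0 < normSq ((t : ℂ) * I + 1) := normSq_pos.2 h1
    rw [div_re]
    simp only [mul_re, ofReal_re, I_re, mul_zero, ofReal_im, I_im, mul_one, sub_self, add_re,
      one_re, zero_add, zero_div, mul_im, add_zero, add_im, one_im]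
    positivity
  -- both factors lie in the right half plane, so their arguments add up to less than `π`
  have a1 := abs_lt.1 (abs_arg_lt_pi_div_two_iff.2 (Or.inl hre))
  have a2 := abs_lt.1 (abs_arg_lt_pi_div_two_iff.2 (Or.inl hre2))
  have hlog := log_mul h1 (div_ne_zero h2 h1) ⟨by linarith [a1.1, a2.1], by linarith [a1.2, a2.2]⟩
  rw [mul_div_cancel₀ _ h1] at hlog
  rw [cpow_def_of_ne_zero h1, cpow_def_of_ne_zero (div_ne_zero h2 h1), cpow_def_of_ne_zero h2,
    ← exp_add, ← add_mul, ← hlog]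

lemma mk_eq_mk_of_eq_neg {a b : SL(2, ℤ)} (h : a = -b) :
    (QuotientGroup.mk a : PSL(2, ℤ)) = QuotientGroup.mk b := by
  rw [QuotientGroup.eq, h, Subgroup.mem_center_iff]
  intro g
  have : (-b)⁻¹ * b = -1 := by
    rw [inv_mul_eq_iff_eq_mul]; simp
  rw [this]; simp

lemma S_mul_S : S * S = 1 :=
  mk_eq_mk_of_eq_neg (by
    apply Subtype.ext
    simp only [Matrix.SpecialLinearGroup.coe_mul, Matrix.SpecialLinearGroup.coe_neg,
      Matrix.SpecialLinearGroup.coe_one, ModularGroup.coe_S]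
    decide)

/-- The relation `(S T⁻¹)³ = 1`, in the form that the three term equation needs. -/
lemma S_mul_T_inv_mul_S_mul_T_inv : S * T⁻¹ * (S * T⁻¹) = T * S :=
  mk_eq_mk_of_eq_neg (a := ModularGroup.S * ModularGroup.T⁻¹ * (ModularGroup.S * ModularGroup.T⁻¹))
    (b := ModularGroup.T * ModularGroup.S) (by
      apply Subtype.ext
      simp only [Matrix.SpecialLinearGroup.coe_mul, Matrix.SpecialLinearGroup.coe_neg,
        ModularGroup.coe_S, ModularGroup.coe_T, ModularGroup.coe_T_inv]
      decide)

variable {V : Type*} [NormedAddCommGroup V] [NormedSpace ℂ V] {η : Representation ℂ PSL(2, ℤ) V}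

/-- The three term equation, on the positive imaginary axis, where all points that occur lie in the
upper half plane and no branch of the power has to be compared across the cut. -/
lemma three_term_of_shift {f ψ : ℂ → V} {a : ℂ}
    (hshift : ∀ z : ℂ, z.im ≠ 0 → f (z + 1) = η T (f z))
    (hψ : ∀ z : ℂ, z.im ≠ 0 → ψ z = f z - z ^ a • η S (f (-1 / z))) {t : ℝ} (ht : 0 < t) :
    η T (ψ (t * I)) = ψ (t * I + 1)
      + ((t : ℂ) * I + 1) ^ a • η (S * T⁻¹) (ψ (t * I / (t * I + 1))) := by
  set z : ℂ := t * I with hz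
  have hzim : z.im = t := by simp [hz]
  have hz0 : z ≠ 0 := fun h ↦ ht.ne' (by rw [← hzim, h, zero_im])
  have h1 : z + 1 ≠ 0 := fun h ↦ ht.ne' (by simpa [hzim] using congrArg im h)
  have him : ∀ w : ℂ, 0 < w.im → 0 < (-1 / w).im := fun w hw ↦ by
    have hw0 : w ≠ 0 := by rintro rfl; simp at hw
    have : 0 < normSq w := normSq_pos.2 hw0
    rw [neg_div, one_div, neg_im, inv_im, neg_div, neg_neg]
    positivity
  have i0 : 0 < z.im := hzim.symm ▸ ht
  have i1 : 0 < (z + 1).im := by simpa using i0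
  have i2 := him z i0
  have i3 := him _ i1
  have e1 : z / (z + 1) = -1 / (z + 1) + 1 := by field_simp; ring
  have i4 : 0 < (z / (z + 1)).im := by rw [e1]; simpa using i3
  have e2 : -1 / (z / (z + 1)) + 1 = -1 / z := by field_simp; ring
  have i5 := him _ i4
  have f1 : f (z / (z + 1)) = η T (f (-1 / (z + 1))) := by rw [e1, hshift _ i3.ne']
  have f2 : f (-1 / z) = η T (f (-1 / (z / (z + 1)))) := by rw [← e2, hshift _ i5.ne']
  have g1 : ∀ x : V, η (S * T⁻¹) (η T x) = η S x := fun x ↦ by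
    rw [← Module.End.mul_apply, ← map_mul, inv_mul_cancel_right]
  have g2 : ∀ x : V, η (S * T⁻¹) (η S x) = η T (η S (η T x)) := fun x ↦ by
    rw [← Module.End.mul_apply, ← map_mul, ← Module.End.mul_apply, ← map_mul,
      ← Module.End.mul_apply, ← map_mul, ← S_mul_T_inv_mul_S_mul_T_inv]
    congr 2
    group
  rw [hψ z i0.ne', hψ _ i1.ne', hψ _ i4.ne', hshift z i0.ne', f1, f2]
  simp only [map_sub, map_smul, g1, g2, smul_sub, smul_smul]
  rw [cpow_add_one_mul_cpow_div ht]
  abel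

/-- The product `z^a (-1/z)^a` is bounded; in fact it is constant on each half plane. -/
lemma norm_cpow_mul_norm_cpow_neg_inv_le {z : ℂ} (hz : z ≠ 0) (a : ℂ) :
    ‖z ^ a‖ * ‖(-1 / z) ^ a‖ ≤ Real.exp (Real.pi * |a.im|) ^ 2 := by
  have key : ∀ w : ℂ, ‖w ^ a‖ ≤ ‖w‖ ^ a.re * Real.exp (Real.pi * |a.im|) := fun w ↦ by
    refine (norm_cpow_le w a).trans ?_
    rw [div_eq_mul_inv, ← Real.exp_neg]
    gcongr
    refine (neg_le_abs _).trans ?_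
    rw [abs_mul]
    gcongr
    exact abs_arg_le_pi w
  refine (mul_le_mul (key _) (key _) (norm_nonneg _) (by positivity)).trans_eq ?_
  have : ‖z‖ ^ a.re * ‖-1 / z‖ ^ a.re = 1 := by
    rw [← Real.mul_rpow (norm_nonneg _) (norm_nonneg _), ← norm_mul, mul_div_cancel₀ _ hz]
    simp
  calc _ = (‖z‖ ^ a.re * ‖-1 / z‖ ^ a.re) * Real.exp (Real.pi * |a.im|) ^ 2 := by ring
    _ = _ := by rw [this, one_mul]

end ThreeTerm

/-! ### The two linear maps -/

section LinearMaps

variable {V : Type*} [NormedAddCommGroup V] [NormedSpace ℂ V] {ν : ℂ}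
  {η : Representation ℂ PSL(2, ℤ) V} {u u' : UpperHalfPlane → V} {v v' : ℤ → V}

lemma IsFourierCoeff.add (h : IsFourierCoeff ν η u v) (h' : IsFourierCoeff ν η u' v') :
    IsFourierCoeff ν η (u + u') (v + v') :=
  ⟨by simp [h.1, h'.1], fun z ↦ by simpa only [Pi.add_apply, smul_add] using (h.2 z).add (h'.2 z)⟩

lemma IsFourierCoeff.smul (c : ℂ) (h : IsFourierCoeff ν η u v) :
    IsFourierCoeff ν η (c • u) (c • v) :=
  ⟨by simp [h.1], fun z ↦ by
    simpa only [Pi.smul_apply, smul_comm c] using (h.2 z).const_smul c⟩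

lemma IsLewisSeries.add {f f' : nonreal → V} (h : IsLewisSeries ν η v f)
    (h' : IsLewisSeries ν η v' f') : IsLewisSeries ν η (v + v') (f + f') := fun z ↦
  ⟨fun hz ↦ by simpa only [Pi.add_apply, smul_add] using ((h z).1 hz).add ((h' z).1 hz),
    fun hz ↦ by
      simpa only [Pi.add_apply, smul_add, neg_add] using ((h z).2 hz).add ((h' z).2 hz)⟩

lemma IsLewisSeries.smul (c : ℂ) {f : nonreal → V} (h : IsLewisSeries ν η v f) :
    IsLewisSeries ν η (c • v) (c • f) := fun z ↦
  ⟨fun hz ↦ by simpa only [Pi.smul_apply, smul_comm c] using ((h z).1 hz).const_smul c,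
    fun hz ↦ by
      simpa only [Pi.smul_apply, smul_comm c, smul_neg] using ((h z).2 hz).const_smul c⟩

lemma IsLewisSeries.unique {f f' : nonreal → V} (h : IsLewisSeries ν η v f)
    (h' : IsLewisSeries ν η v f') : f = f' := by
  funext z
  rcases lt_or_gt_of_ne (show (z : ℂ).im ≠ 0 from z.2) with hz | hz
  · exact neg_injective (((h z).2 hz).unique ((h' z).2 hz))
  · exact ((h z).1 hz).unique ((h' z).1 hz)

lemma isPreconnected_slitPlane : IsPreconnected slitPlane :=
  (starConvex_one_slitPlane.isPathConnected one_mem_slitPlane).isConnected.isPreconnected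

/-- A holomorphic function on the slit plane is determined by its values off the real axis. -/
lemma Holo.eq_of_eq_on_nonreal [CompleteSpace V] {ψ φ : slitPlane → V} (hψ : Holo slitPlane ψ)
    (hφ : Holo slitPlane φ) (h : ∀ z : nonreal, ψ (toSlit z) = φ (toSlit z)) : ψ = φ := by
  obtain ⟨p, hp, hp'⟩ := hψ
  obtain ⟨q, hq, hq'⟩ := hφ
  funext z
  rw [← hp', ← hq']
  refine eqOn_of_eq_on_ray isOpen_slitPlane isPreconnected_slitPlane hp hq I_ne_zero (a := 1)
    (Or.inr (by simp)) (fun t ht ↦ ?_) z.2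
  have ht0 : ((t : ℂ) * I).im ≠ 0 := by simpa using (one_pos.trans ht).ne'
  have := h ⟨t * I, ht0⟩
  rwa [← hp', ← hq'] at this

variable [FiniteDimensional ℂ V]

/-- The series decays exponentially, so both limits at `±i∞` are zero. -/
lemma IsCuspForm.isFν (hν : -1 / 2 < ν.re) (h : IsCuspForm ν η u) (hN : 0 < ord η)
    (hv : IsFourierCoeff ν η u v) :
    IsFν ν η fun z ↦ lewisFun (ord η) ν v z := by
  have := FiniteDimensional.complete ℂ V
  have hs := hv.isSubExpInt hN
  have hlim : Tendsto (fun z : nonreal ↦ lewisFun (ord η) ν v z)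
      (comap (fun z : nonreal ↦ |(z : ℂ).im|) atTop) (𝓝 0) :=
    (tendsto_lewisFun hN hs).comp (tendsto_comap_iff.2 tendsto_comap)
  obtain ⟨ψ, hψ, -, hψf⟩ := h.exists_period_extension hν hN hv
  exact
  { holo := ⟨lewisFun (ord η) ν v, differentiableOn_lewisFun hN hs, fun _ ↦ rfl⟩
    shift := fun z ↦ h.lewisFun_add_one hN hv z.2
    bounded := hlim.isBigO_one ℝ
    limits := ⟨0, 0,
      hlim.mono_left (tendsto_iff_comap.1 (tendsto_abs_atTop_atTop.comp tendsto_comap)),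
      hlim.mono_left (tendsto_iff_comap.1 (tendsto_abs_atBot_atTop.comp tendsto_comap)),
      add_zero 0⟩
    extend := ⟨fun z ↦ ψ z, ⟨ψ, hψ, fun _ ↦ rfl⟩, fun z ↦ hψf z z.2⟩ }

lemma neg_inv_im_ne_zero {z : ℂ} (hz : z.im ≠ 0) : (-1 / z).im ≠ 0 := (negInv ⟨z, hz⟩).2

/-- The extended period function belongs to `Ψ°`. The three term equation needs to be checked on
the imaginary axis only, and both limits in the condition at `±i∞` are zero. -/
lemma IsCuspForm.exists_isPsiO (hν : -1 / 2 < ν.re) (h : IsCuspForm ν η u) (hN : 0 < ord η)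
    (hv : IsFourierCoeff ν η u v) :
    ∃ ψ : slitPlane → V, IsPsiO ν η ψ ∧
      ∀ z : nonreal, ψ (toSlit z) = periodOf ν η (fun z ↦ lewisFun (ord η) ν v z) z := by
  have := FiniteDimensional.complete ℂ V
  obtain ⟨ψ, hψ, hK, hψf⟩ := h.exists_period_extension hν hN hv
  set f := lewisFun (ord η) ν v with hf
  set a : ℂ := -2 * ν - 1 with ha
  have hlim : Tendsto (fun z : nonreal ↦ f z)
      (comap (fun z : nonreal ↦ |(z : ℂ).im|) atTop) (𝓝 0) :=
    (tendsto_lewisFun hN (hv.isSubExpInt hN)).comp (tendsto_comap_iff.2 tendsto_comap)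
  -- applying the involution to the period function gives a bounded multiple of `f`
  have hinv : ∀ z : nonreal, invOf ν η (fun z ↦ ψ z) z
      = f z - ((z : ℂ) ^ a * (-1 / (z : ℂ)) ^ a) • f z := fun z ↦ by
    have hz : (z : ℂ).im ≠ 0 := z.2
    have hz0 : (z : ℂ) ≠ 0 := by rintro h0; simp [h0] at hz
    have e : -1 / (-1 / (z : ℂ)) = z := by field_simp
    have hSS : ∀ x : V, η S (η S x) = x := fun x ↦ by
      rw [← Module.End.mul_apply, ← map_mul, S_mul_S, map_one, Module.End.one_apply]
    simp only [invOf, toSlit, negInv]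
    rw [hψf _ hz, hψf _ (neg_inv_im_ne_zero hz), e, map_sub, map_smul, hSS, smul_sub, smul_smul]
    abel
  have hinvlim : Tendsto (invOf ν η fun z ↦ ψ z)
      (comap (fun z : nonreal ↦ |(z : ℂ).im|) atTop) (𝓝 0) := by
    have h1 := hlim.norm.mul_const (1 + Real.exp (Real.pi * |a.im|) ^ 2)
    rw [norm_zero, zero_mul] at h1
    refine squeeze_zero_norm (fun z ↦ ?_) h1
    have hz0 : (z : ℂ) ≠ 0 := by
      have hz : (z : ℂ).im ≠ 0 := z.2
      rintro h0; simp [h0] at hz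
    rw [hinv, mul_add, mul_one]
    refine (norm_sub_le _ _).trans (add_le_add_right ?_ _)
    rw [norm_smul, norm_mul, mul_comm]
    exact mul_le_mul_of_nonneg_left (norm_cpow_mul_norm_cpow_neg_inv_le hz0 a) (norm_nonneg _)
  have hcont : ∀ γ : PSL(2, ℤ), Differentiable ℂ (LinearMap.toContinuousLinearMap (η γ)) :=
    fun γ ↦ ContinuousLinearMap.differentiable _
  refine ⟨fun z ↦ ψ z, ⟨⟨⟨ψ, hψ, fun _ ↦ rfl⟩, fun z ↦ ?_, ?_⟩, ?_⟩, fun z ↦ hψf z z.2⟩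
  · have hshift : DifferentiableOn ℂ (fun z : ℂ ↦ z + 1) slitPlane := by fun_prop
    have hfrac : DifferentiableOn ℂ (fun z : ℂ ↦ z / (z + 1)) slitPlane :=
      differentiableOn_id.fun_div hshift fun z hz ↦ slitPlane_ne_zero (slit_shift_mem hz)
    have hpow : DifferentiableOn ℂ (fun z : ℂ ↦ (z + 1) ^ a) slitPlane := fun z hz ↦
      (hshift z hz).cpow (differentiableWithinAt_const a) (slit_shift_mem hz)
    refine eqOn_of_eq_on_ray (f := fun z ↦ LinearMap.toContinuousLinearMap (η T) (ψ z))
      (g := fun z ↦ ψ (z + 1) + (z + 1) ^ a •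
        LinearMap.toContinuousLinearMap (η (S * T⁻¹)) (ψ (z / (z + 1))))
      isOpen_slitPlane isPreconnected_slitPlane ((hcont T).comp_differentiableOn hψ)
      ((hψ.comp hshift fun z hz ↦ slit_shift_mem hz).add (hpow.smul
        ((hcont _).comp_differentiableOn (hψ.comp hfrac fun z hz ↦ slit_frac_mem hz))))
      I_ne_zero (a := 1) (Or.inr (by simp)) (fun t ht ↦ ?_) z.2
    exact three_term_of_shift (fun z hz ↦ h.lewisFun_add_one hN hv hz) hψf (one_pos.trans ht)
  · exact ⟨0, 0,
      hinvlim.mono_left (tendsto_iff_comap.1 (tendsto_abs_atTop_atTop.comp tendsto_comap)),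
      hinvlim.mono_left (tendsto_iff_comap.1 (tendsto_abs_atBot_atTop.comp tendsto_comap)),
      by simp⟩
  -- the bound holds with exponent `2 Re ν + 1`; half of it lies strictly inside the range
  · refine ⟨ν.re + 1 / 2, by linarith, by linarith, fun δ hδ ↦ ?_⟩
    obtain ⟨K, hK⟩ := hK δ hδ
    refine ⟨|K|, fun z hz ↦ (hK z z.2 hz).trans ?_⟩
    have hpos : 0 < ‖(z : ℂ)‖ := norm_pos_iff.2 (slitPlane_ne_zero z.2)
    exact mul_le_mul (le_abs_self K) (min_one_rpow_mono hpos (by linarith) (by linarith))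
      (le_min zero_le_one (by positivity)) (abs_nonneg K)

end LinearMaps

end LewisCorr

end

theorem lemma3p1 {V : Type*} [NormedAddCommGroup V] [NormedSpace ℂ V] [FiniteDimensional ℂ V]
    (η : Representation ℂ PSL(2, ℤ) V) (hirr : η.IsIrreducible)
    (hfin : (Set.range fun γ : PSL(2, ℤ) ↦ η γ).Finite)
    (ν : ℂ) (hν : -1 / 2 < ν.re) :
    (∀ u ∈ LewisCorr.cuspForms ν η, ∃! v : ℤ → V, LewisCorr.IsFourierCoeff ν η u v) ∧
    ∃ (F : LewisCorr.cuspForms ν η →ₗ[ℂ] LewisCorr.spaceF ν η)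
      (L : LewisCorr.cuspForms ν η →ₗ[ℂ] LewisCorr.periodFunctions ν hν η),
      ∀ (u : LewisCorr.cuspForms ν η) (v : ℤ → V), LewisCorr.IsFourierCoeff ν η u v →
        LewisCorr.IsLewisSeries ν η v (F u) ∧
        ∀ z : LewisCorr.nonreal,
          (L u : Complex.slitPlane → V) (LewisCorr.toSlit z) = LewisCorr.periodOf ν η (F u) z := by
  have := FiniteDimensional.complete ℂ V
  have hN : 0 < LewisCorr.ord η := LewisCorr.ord_pos hfin
  have hex : ∀ u : LewisCorr.cuspForms ν η, ∃ v, LewisCorr.IsFourierCoeff ν η u v := fun u ↦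
    LewisCorr.IsCuspForm.exists_isFourierCoeff hν u.2 hN
  choose c hc using hex
  let f : LewisCorr.cuspForms ν η → LewisCorr.nonreal → V := fun u z ↦
    LewisCorr.lewisFun (LewisCorr.ord η) ν (c u) z
  have hf : ∀ u, LewisCorr.IsLewisSeries ν η (c u) (f u) := fun u ↦
    LewisCorr.isLewisSeries_lewisFun hN ((hc u).isSubExpInt hN)
  have hfF : ∀ u, f u ∈ LewisCorr.spaceF ν η := fun u ↦
    LewisCorr.IsCuspForm.isFν hν u.2 hN (hc u)
  choose ψ hψ hψf using fun u : LewisCorr.cuspForms ν η ↦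
    LewisCorr.IsCuspForm.exists_isPsiO hν u.2 hN (hc u)
  change ∀ u z, ψ u (LewisCorr.toSlit z) = LewisCorr.periodOf ν η (f u) z at hψf
  -- linearity of both maps comes from the uniqueness of Fourier coefficients and of
  -- holomorphic extensions
  have f_add : ∀ u u', f (u + u') = f u + f u' := fun u u' ↦ by
    have h1 := hf (u + u')
    rw [(hc (u + u')).unique hN ((hc u).add (hc u'))] at h1
    exact h1.unique ((hf u).add (hf u'))
  have f_smul : ∀ (a : ℂ) u, f (a • u) = a • f u := fun a u ↦ by
    have h1 := hf (a • u)
    rw [(hc (a • u)).unique hN ((hc u).smul a)] at h1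
    exact h1.unique ((hf u).smul a)
  have ψ_add : ∀ u u', ψ (u + u') = ψ u + ψ u' := fun u u' ↦
    LewisCorr.Holo.eq_of_eq_on_nonreal (hψ (u + u')).holo ((hψ u).holo.add (hψ u').holo) fun z ↦ by
      rw [Pi.add_apply, hψf, hψf, hψf, f_add, LewisCorr.periodOf_add]
  have ψ_smul : ∀ (a : ℂ) u, ψ (a • u) = a • ψ u := fun a u ↦
    LewisCorr.Holo.eq_of_eq_on_nonreal (hψ (a • u)).holo ((hψ u).holo.smul a) fun z ↦ by
      rw [Pi.smul_apply, hψf, hψf, f_smul, LewisCorr.periodOf_smul]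
  refine ⟨fun u hu ↦ ⟨c ⟨u, hu⟩, hc ⟨u, hu⟩, fun v hv ↦ hv.unique hN (hc ⟨u, hu⟩)⟩,
    { toFun := fun u ↦ ⟨f u, hfF u⟩
      map_add' := fun u u' ↦ Subtype.ext (f_add u u')
      map_smul' := fun a u ↦ Subtype.ext (f_smul a u) },
    { toFun := fun u ↦ ⟨ψ u, hψ u⟩
      map_add' := fun u u' ↦ Subtype.ext (ψ_add u u')
      map_smul' := fun a u ↦ Subtype.ext (ψ_smul a u) }, fun u v hv ↦ ⟨?_, hψf u⟩⟩
  rw [hv.unique hN (hc u)]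
  exact hf u
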